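/- Let $n,m\ge 0$ be integers, and suppose the following. (Hq) $q\in H^1(\mathbb R,\mathbb R^{m\times m})\cap L^1(\mathbb R,\mathbb R^{m\times m})$ satisfies $q(-x)=q(x)=q(x)^T$ for all $x$, and $\widehat q(k)$ is non-negative definite for all $k\in\mathbb R$. Write $Qv=q*v$ for the associated bounded, symmetric, non-negative operator on $L^2(\mathbb R,\mathbb R^m)$. (HEq) $f,h:\mathbb R^n\to\mathbb R^n$ and $g:\mathbb R^n\to\mathbb R^{n\times m}$ satisfy $f(u_\pm)=g(u_\pm)=h(u_\pm)=0$ for two points $u_\pm\in\mathbb R^n$ (possibly equal). (HDt) $\rho=\mathrm{diag}(\rho_1,\dots,\rho_n)$ with all $\rho_i>0$; $f,h\in C^3$ with $D^3f$, $D^3h$ bounded; and there is $K_{\rm var}>0$ with $\langle f(u_A)-f(u_B),u_A-u_B\rangle+\sigma^2\langle h(u_A)-h(u_B),u_A-u_B\rangle\le K_{\rm var}|u_A-u_B|^2$ for all $u_A,u_B\in\mathbb R^n$ and $0\le\sigma\le1$. (HSt) $g\in C^2$, and $Dg$ is bounded and globally Lipschitz. (HTw) $c_0\in\mathbb R$ and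 $\Phi_0\in C^2(\mathbb R,\mathbb R^n)$ satisfy $\rho\Phi_0''+c_0\Phi_0'+f(\Phi_0)=0$, with $\Phi_0(x)\to u_\pm$ exponentially fast as $x\to\pm\infty$. The operator $\mathcal L_{\rm tw}v=\rho v''+c_0v'+Df(\Phi_0)v$ from $H^2$ to $L^2$ has a simple eigenvalue at $0$ (the kernel is one-dimensional and $L^2$ is the direct sum of the kernel and the range), and it has no other spectrum in $\{\mathrm{Re}\,\lambda\ge-2\beta\}$ for some $\beta>0$. Let $\psi_{\rm tw}\in H^2(\mathbb R,\mathbb R^n)$ be the adjoint eigenfunction: $\rho\psi_{\rm tw}''-c_0\psi_{\rm tw}'+Df(\Phi_0)^T\psi_{\rm tw}=0$ and $\langle\Phi_0',\psi_{\rm tw}\rangle_{L^2}=1$. Let $\Phi_{\rm ref}$ be a smooth function with $\Phi_{\rm ref}(\pm\infty)=u_\pm$ and $\Phi_0-\Phi_{\rm ref}\in H^2$, and put $\mathcal U_{H^2}=\Phi_{\rm ref}+H^2(\mathbb R,\mathbb R^n)$. Let $\chi_{\rm low}:\mathbb R\to[\frac14,\infty)$ be smooth and non-decreasing, with $\chi_{\rm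 low}(t)=\frac14$ for $t\le\frac14$ and $\chi_{\rm low}(t)=t$ for $t\ge\frac12$. For some $K_{\rm up}>0$ let $\chi_{\rm high}$ be smooth and non-increasing with values in $[0,1]$, equal to $1$ on $[0,K_{\rm up}]$ and to $0$ on $[K_{\rm up}+1,\infty)$. With $T_\Gamma U=U(\cdot-\Gamma)$ define $$\overline\chi_l(U,\Gamma)=\big[\chi_{\rm low}(\langle U',T_\Gamma\psi_{\rm tw}\rangle_{L^2})\big]^{-1},\qquad \overline\chi_h(U,\Gamma)=\chi_{\rm high}(\|U-T_\Gamma\Phi_{\rm ref}\|_{L^2}),$$ $$\overline b(U,\Gamma)[v]=-\overline\chi_h^2\,\overline\chi_l\,\langle g(U)v,T_\Gamma\psi_{\rm tw}\rangle_{L^2},\qquad \|\overline b(U,\Gamma)\|_{HS}^2=\sum_k\overline b(U,\Gamma)[Q^{1/2}e_k]^2,$$ where $(e_k)$ is an orthonormal basis of $L^2(\mathbb R,\mathbb R^m)$, and $$\mathcal K_\sigma(U,\Gamma,c)=cU'+\rho U''+f(U)+\sigma^2h(U)+\tfrac{\sigma^2}{2}\|\overline b(U,\Gamma)\|_{HS}^2\,U''-\sigma^2\big[\overline\chi_h^2\,\overline\chi_l\;g(U)\,Q\,g(U)^T\,T_\Gamma\psi_{\rm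 tw}\big]'.$$ Then for every sufficiently large $K>0$ there exists $\delta_\sigma>0$ such that for every $0\le\sigma\le\delta_\sigma$ there is a unique pair $(\Phi_\sigma,c_\sigma)\in\mathcal U_{H^2}\times\mathbb R$ (the instantaneous stochastic wave) that satisfies $$\mathcal K_\sigma(\Phi_\sigma,0,c_\sigma)=0,\qquad \|\Phi_\sigma-\Phi_0\|_{H^2}+|c_\sigma-c_0|\le K\sigma^2 \tag{1}$$ together with the phase condition $\langle\Phi_\sigma-\Phi_0,\psi_{\rm tw}\rangle_{L^2}=0$. Moreover, the phase is the only freedom: if two pairs $(\Phi,c),(\Phi',c')\in\mathcal U_{H^2}\times\mathbb R$ both satisfy (1) and $\langle\Phi-\Phi',\psi_{\rm tw}\rangle_{L^2}=0$, then they are equal. -/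

import Mathlib

open MeasureTheory Filter Topology
open scoped ContDiff FourierTransform ComplexOrder

namespace StochWave

noncomputable section

/-! ### One-dimensional Sobolev spaces, through weak derivatives -/

section Sobolev

variable {F : Type*} [NormedAddCommGroup F] [NormedSpace ℝ F]

/-- `w` is a weak derivative of `u` on the real line. -/
def HasWeakDeriv (u w : ℝ → F) : Prop :=
  LocallyIntegrable u volume ∧ LocallyIntegrable w volume ∧
    ∀ φ : ℝ → ℝ, ContDiff ℝ ∞ φ → HasCompactSupport φ →
      ∫ x, deriv φ x • u x = -∫ x, φ x • w x

open Classical in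
/-- The weak derivative of `u` (determined almost everywhere). -/
def weakDeriv (u : ℝ → F) : ℝ → F :=
  if hu : ∃ w, HasWeakDeriv u w then Classical.choose hu else 0

/-- `u ∈ H¹(ℝ, F)`. -/
def MemH1 (u : ℝ → F) : Prop :=
  MemLp u 2 volume ∧ ∃ u₁, MemLp u₁ 2 volume ∧ HasWeakDeriv u u₁

/-- `u ∈ H²(ℝ, F)`. -/
def MemH2 (u : ℝ → F) : Prop :=
  MemLp u 2 volume ∧ ∃ u₁ u₂, MemLp u₁ 2 volume ∧ MemLp u₂ 2 volume ∧
    HasWeakDeriv u u₁ ∧ HasWeakDeriv u₁ u₂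

/-- The `L²`-norm. -/
def l2Norm (u : ℝ → F) : ℝ := Real.sqrt (∫ x, ‖u x‖ ^ 2)

/-- The `H²`-norm. -/
def h2Norm (u : ℝ → F) : ℝ :=
  Real.sqrt (l2Norm u ^ 2 + l2Norm (weakDeriv u) ^ 2 + l2Norm (weakDeriv (weakDeriv u)) ^ 2)

/-- The affine space `Φref + H²(ℝ, F)`, as a set of almost-everywhere classes. -/
def affineH2 (Φref : ℝ → F) : Set (ℝ →ₘ[volume] F) :=
  {U | MemH2 (fun x => U x - Φref x)}

/-- The right shift `T_Γ U = U(· - Γ)`. -/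
def shift (Γ : ℝ) (U : ℝ → F) : ℝ → F := fun x => U (x - Γ)

end Sobolev

/-- `ℝⁿ` with the Euclidean norm. -/
abbrev E (n : ℕ) : Type := EuclideanSpace ℝ (Fin n)

/-- `ℂⁿ` with the Hermitian norm. -/
abbrev EC (n : ℕ) : Type := EuclideanSpace ℂ (Fin n)

/-- The Hilbert space `L²(ℝ, ℝᵐ)`. -/
abbrev L2 (m : ℕ) : Type := Lp (E m) 2 (volume : Measure ℝ)

/-- The `L²` inner product. -/
def l2Inner {n : ℕ} (u v : ℝ → E n) : ℝ := ∫ x, inner ℝ (u x) (v x)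

/-- The action of the diagonal matrix `diag(ρ₁, …, ρₙ)` on `ℝⁿ` or `ℂⁿ`. -/
def diagMul {𝕜 : Type*} [RCLike 𝕜] {n : ℕ} (ρ : Fin n → ℝ) (w : EuclideanSpace 𝕜 (Fin n)) :
    EuclideanSpace 𝕜 (Fin n) :=
  WithLp.toLp 2 fun i => (ρ i : 𝕜) * w i

/-- The complex-linear extension of a real linear map to `ℂⁿ`. -/
def complexify {n : ℕ} (A : E n →L[ℝ] E n) (z : EC n) : EC n :=
  WithLp.toLp 2 fun i =>
    ((A (WithLp.toLp 2 fun j => (z j).re) i : ℝ) : ℂ) +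
      Complex.I * ((A (WithLp.toLp 2 fun j => (z j).im) i : ℝ) : ℂ)

/-! ### The covariance operator -/

/-- `(Q v)(x) = ∫ q(x - y) v(y) dy`. -/
def conv {m : ℕ} (q : ℝ → Matrix (Fin m) (Fin m) ℝ) (v : ℝ → E m) : ℝ → E m :=
  fun x => ∫ y, Matrix.toEuclideanCLM (𝕜 := ℝ) (q (x - y)) (v y)

/-- `R` is the non-negative square root of the operator `Q v = q * v` on `L²(ℝ, ℝᵐ)`. -/
def IsSqrtConv {m : ℕ} (q : ℝ → Matrix (Fin m) (Fin m) ℝ) (R : L2 m →L[ℝ] L2 m) : Prop :=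
  R.IsPositive ∧ ∀ v : L2 m, ⇑(R (R v)) =ᵐ[volume] conv q v

open Classical in
/-- `Q^{1/2}`, the (unique) non-negative square root of `Q`. It exists as soon as `Q` is a bounded
symmetric non-negative operator; the other branch is never used then. -/
def sqrtConv {m : ℕ} (q : ℝ → Matrix (Fin m) (Fin m) ℝ) : L2 m →L[ℝ] L2 m :=
  if hR : ∃ R, IsSqrtConv q R then Classical.choose hR else 0

/-- A set of vectors that forms an orthonormal basis `(e_k)` of `L²(ℝ, ℝᵐ)`. -/
def onb (m : ℕ) : Set (L2 m) := Classical.choose (exists_hilbertBasis ℝ (L2 m))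

/-- The squared Hilbert-Schmidt norm `∑_k (Λ(Q^{1/2} e_k))²` of a linear functional `Λ` on
`L²_Q = Q^{1/2}(L²(ℝ, ℝᵐ))`. -/
def hsNormSq {m : ℕ} (q : ℝ → Matrix (Fin m) (Fin m) ℝ) (Λ : L2 m → ℝ) : ℝ :=
  ∑' e : onb m, Λ (sqrtConv q e) ^ 2

/-! ### The assumptions -/

/-- The assumption on the covariance kernel `q`. -/
structure HypQ {m : ℕ} (q : ℝ → Matrix (Fin m) (Fin m) ℝ) : Prop where
  memH1 : ∀ i j, MemH1 fun x => q x i j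
  integrable : ∀ i j, Integrable (fun x => q x i j) volume
  even : ∀ x, q (-x) = q x
  transpose : ∀ x, (q x).transpose = q x
  fourier_nonneg : ∀ k : ℝ,
    (Matrix.of fun i j => 𝓕 (fun x : ℝ => ((q x i j : ℝ) : ℂ)) k).PosSemidef

/-- The assumption that `u₋` and `u₊` are common equilibria. A matrix in `ℝ^{n×m}` is regarded as
a linear map `ℝᵐ → ℝⁿ`. -/
structure HypEq {n m : ℕ} (f h : E n → E n) (g : E n → (E m →L[ℝ] E n)) (um up : E n) :
    Prop where
  f_minus : f um = 0
  f_plus : f up = 0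
  g_minus : g um = 0
  g_plus : g up = 0
  h_minus : h um = 0
  h_plus : h up = 0

/-- The assumption on the stochastic term. -/
structure HypSt {n m : ℕ} (g : E n → (E m →L[ℝ] E n)) : Prop where
  contDiff : ContDiff ℝ 2 g
  bounded : ∃ C : ℝ, ∀ u, ‖fderiv ℝ g u‖ ≤ C
  lipschitz : ∃ C : NNReal, LipschitzWith C (fderiv ℝ g)

/-- The assumption on the deterministic terms. -/
structure HypDt {n : ℕ} (ρ : Fin n → ℝ) (f h : E n → E n) : Prop where
  rho_pos : ∀ i, 0 < ρ i
  f_contDiff : ContDiff ℝ 3 f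
  h_contDiff : ContDiff ℝ 3 h
  f_bounded : ∃ C : ℝ, ∀ u, ‖iteratedFDeriv ℝ 3 f u‖ ≤ C
  h_bounded : ∃ C : ℝ, ∀ u, ‖iteratedFDeriv ℝ 3 h u‖ ≤ C
  oneSided : ∃ Kvar : ℝ, 0 < Kvar ∧ ∀ uA uB : E n, ∀ σ : ℝ, 0 ≤ σ → σ ≤ 1 →
    inner ℝ (f uA - f uB) (uA - uB) + σ ^ 2 * inner ℝ (h uA - h uB) (uA - uB)
      ≤ Kvar * ‖uA - uB‖ ^ 2

/-- The linearisation `L_tw v = ρ v'' + c₀ v' + Df(Φ₀) v`, acting on complex-valued functions. -/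
def linTw {n : ℕ} (ρ : Fin n → ℝ) (f : E n → E n) (Φ₀ : ℝ → E n) (c₀ : ℝ) (v : ℝ → EC n) :
    ℝ → EC n := fun x =>
  diagMul ρ (weakDeriv (weakDeriv v) x) + (c₀ : ℂ) • weakDeriv v x
    + complexify (fderiv ℝ f (Φ₀ x)) (v x)

/-- `lam` lies in the resolvent set of `L_tw : H² → L²`: the operator `lam - L_tw` is a bijection
from `H²` onto `L²` with a bounded inverse. -/
def InResolventSet {n : ℕ} (ρ : Fin n → ℝ) (f : E n → E n) (Φ₀ : ℝ → E n) (c₀ : ℝ) (lam : ℂ) :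
    Prop :=
  (∀ v : ℝ → EC n, MemH2 v → (∀ᵐ x, lam • v x - linTw ρ f Φ₀ c₀ v x = 0) → ∀ᵐ x, v x = 0) ∧
  ∃ C : ℝ, ∀ r : ℝ → EC n, MemLp r 2 volume →
    ∃ v : ℝ → EC n, MemH2 v ∧ (∀ᵐ x, lam • v x - linTw ρ f Φ₀ c₀ v x = r x) ∧
      l2Norm v ≤ C * l2Norm r

/-- Zero is a simple eigenvalue of `L_tw`: the kernel is spanned by one function `φ ≠ 0`, and
`L²` is the direct sum of the kernel and the range (that is, for the isolated point `0` of the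
spectrum, the spectral projection has rank one). -/
def SimpleZeroEigenvalue {n : ℕ} (ρ : Fin n → ℝ) (f : E n → E n) (Φ₀ : ℝ → E n) (c₀ : ℝ) :
    Prop :=
  ∃ φ : ℝ → EC n, MemH2 φ ∧ (¬ ∀ᵐ x, φ x = 0) ∧ (∀ᵐ x, linTw ρ f Φ₀ c₀ φ x = 0) ∧
    (∀ v : ℝ → EC n, MemH2 v → (∀ᵐ x, linTw ρ f Φ₀ c₀ v x = 0) →
      ∃ a : ℂ, ∀ᵐ x, v x = a • φ x) ∧
    (∀ v : ℝ → EC n, MemH2 v → ¬ ∀ᵐ x, linTw ρ f Φ₀ c₀ v x = φ x) ∧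
    (∀ r : ℝ → EC n, MemLp r 2 volume →
      ∃ (a : ℂ) (v : ℝ → EC n), MemH2 v ∧ ∀ᵐ x, r x = a • φ x + linTw ρ f Φ₀ c₀ v x)

/-- The assumption that `(Φ₀, c₀)` is a spectrally stable travelling wave from `u₋` to `u₊`. -/
structure HypTw {n : ℕ} (ρ : Fin n → ℝ) (f : E n → E n) (um up : E n) (Φ₀ : ℝ → E n) (c₀ : ℝ) :
    Prop where
  contDiff : ContDiff ℝ 2 Φ₀
  ode : ∀ x, diagMul ρ (deriv (deriv Φ₀) x) + c₀ • deriv Φ₀ x + f (Φ₀ x) = 0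
  exp_plus : ∃ C ν : ℝ, 0 < ν ∧ ∀ x, 0 ≤ x → ‖Φ₀ x - up‖ ≤ C * Real.exp (-ν * x)
  exp_minus : ∃ C ν : ℝ, 0 < ν ∧ ∀ x, x ≤ 0 → ‖Φ₀ x - um‖ ≤ C * Real.exp (ν * x)
  simple : SimpleZeroEigenvalue ρ f Φ₀ c₀
  spectrum : ∃ β : ℝ, 0 < β ∧ ∀ lam : ℂ, -2 * β ≤ lam.re → lam ≠ 0 →
    InResolventSet ρ f Φ₀ c₀ lam

/-- `ψ` is the adjoint eigenfunction: `ψ ∈ H²`, `L_tw^* ψ = ρ ψ'' - c₀ ψ' + Df(Φ₀)ᵀ ψ = 0`, with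
the normalisation `⟨Φ₀', ψ⟩ = 1`. -/
structure IsAdjointEigenfunction {n : ℕ} (ρ : Fin n → ℝ) (f : E n → E n) (Φ₀ : ℝ → E n) (c₀ : ℝ)
    (ψ : ℝ → E n) : Prop where
  memH2 : MemH2 ψ
  kernel : ∀ᵐ x, diagMul ρ (weakDeriv (weakDeriv ψ) x) - c₀ • weakDeriv ψ x
    + ContinuousLinearMap.adjoint (fderiv ℝ f (Φ₀ x)) (ψ x) = 0
  normalised : l2Inner (deriv Φ₀) ψ = 1

/-- A smooth reference function with limits `u₋`, `u₊` for which `Φ₀ ∈ Φref + H²`. -/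
structure IsReference {n : ℕ} (um up : E n) (Φ₀ Φref : ℝ → E n) : Prop where
  contDiff : ContDiff ℝ ∞ Φref
  lim_plus : Tendsto Φref atTop (𝓝 up)
  lim_minus : Tendsto Φref atBot (𝓝 um)
  memH2 : MemH2 fun x => Φ₀ x - Φref x

/-- The lower cut-off function. -/
structure IsLowCutoff (χ : ℝ → ℝ) : Prop where
  contDiff : ContDiff ℝ ∞ χ
  monotone : Monotone χ
  eq_quarter : ∀ t, t ≤ 1 / 4 → χ t = 1 / 4
  eq_self : ∀ t, 1 / 2 ≤ t → χ t = t

/-- The upper cut-off function with threshold `Kup`; only its values on `[0, ∞)` matter. -/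
structure IsHighCutoff (Kup : ℝ) (χ : ℝ → ℝ) : Prop where
  contDiff : ContDiff ℝ ∞ χ
  antitone : Antitone χ
  mem_Icc : ∀ t, χ t ∈ Set.Icc (0 : ℝ) 1
  eq_one : ∀ t, t ≤ Kup → χ t = 1
  eq_zero : ∀ t, Kup + 1 ≤ t → χ t = 0

/-! ### The operator `K_σ` -/

section Operator

variable {n m : ℕ}

/-- `χ̄_l(U, Γ) = χ_low(⟨U', T_Γ ψ⟩)⁻¹`. -/
def chiL (χlow : ℝ → ℝ) (ψ : ℝ → E n) (U : ℝ → E n) (Γ : ℝ) : ℝ :=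
  (χlow (l2Inner (weakDeriv U) (shift Γ ψ)))⁻¹

/-- `χ̄_h(U, Γ) = χ_high(‖U - T_Γ Φref‖)`. -/
def chiH (χhigh : ℝ → ℝ) (Φref : ℝ → E n) (U : ℝ → E n) (Γ : ℝ) : ℝ :=
  χhigh (l2Norm fun x => U x - shift Γ Φref x)

/-- `b̄(U, Γ)[v] = -χ̄_h(U, Γ)² χ̄_l(U, Γ) ⟨g(U) v, T_Γ ψ⟩`. -/
def bBar (g : E n → (E m →L[ℝ] E n)) (Φref ψ : ℝ → E n) (χlow χhigh : ℝ → ℝ)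
    (U : ℝ → E n) (Γ : ℝ) (v : L2 m) : ℝ :=
  -(chiH χhigh Φref U Γ ^ 2 * chiL χlow ψ U Γ
    * l2Inner (fun x => g (U x) (v x)) (shift Γ ψ))

/-- `g^adj(U)[w] = Q g(U)ᵀ w`. -/
def gAdj (g : E n → (E m →L[ℝ] E n)) (q : ℝ → Matrix (Fin m) (Fin m) ℝ)
    (U : ℝ → E n) (w : ℝ → E n) : ℝ → E m :=
  conv q fun x => ContinuousLinearMap.adjoint (g (U x)) (w x)

/-- `K_{σ;A}(U) = ρ U'' + f(U) + σ² h(U)`. -/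
def opA (ρ : Fin n → ℝ) (f h : E n → E n) (σ : ℝ) (U : ℝ → E n) : ℝ → E n := fun x =>
  diagMul ρ (weakDeriv (weakDeriv U) x) + f (U x) + σ ^ 2 • h (U x)

/-- `K_B(U, Γ) = ½ ‖b̄(U, Γ)‖²_{HS(L²_Q, ℝ)} U''`. -/
def opB (g : E n → (E m →L[ℝ] E n)) (q : ℝ → Matrix (Fin m) (Fin m) ℝ) (Φref ψ : ℝ → E n)
    (χlow χhigh : ℝ → ℝ) (U : ℝ → E n) (Γ : ℝ) : ℝ → E n := fun x =>
  (1 / 2 * hsNormSq q (bBar g Φref ψ χlow χhigh U Γ)) • weakDeriv (weakDeriv U) x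

/-- `K_C(U, Γ) = -χ̄_h(U, Γ)² χ̄_l(U, Γ) g(U) g^adj(U) T_Γ ψ`. -/
def opC (g : E n → (E m →L[ℝ] E n)) (q : ℝ → Matrix (Fin m) (Fin m) ℝ) (Φref ψ : ℝ → E n)
    (χlow χhigh : ℝ → ℝ) (U : ℝ → E n) (Γ : ℝ) : ℝ → E n := fun x =>
  -((chiH χhigh Φref U Γ ^ 2 * chiL χlow ψ U Γ) • g (U x) (gAdj g q U (shift Γ ψ) x))

/-- `K_σ(U, Γ, c) = c U' + K_{σ;A}(U) + σ² K_B(U, Γ) + σ² [K_C(U, Γ)]'`. -/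
def opK (ρ : Fin n → ℝ) (f h : E n → E n) (g : E n → (E m →L[ℝ] E n))
    (q : ℝ → Matrix (Fin m) (Fin m) ℝ) (Φref ψ : ℝ → E n) (χlow χhigh : ℝ → ℝ)
    (σ : ℝ) (U : ℝ → E n) (Γ c : ℝ) : ℝ → E n := fun x =>
  c • weakDeriv U x + opA ρ f h σ U x
    + σ ^ 2 • opB g q Φref ψ χlow χhigh U Γ x
    + σ ^ 2 • weakDeriv (opC g q Φref ψ χlow χhigh U Γ) x

/-- `p = (Φ, c)` lies in `(Φref + H²) × ℝ`, solves `K_σ(Φ, 0, c) = 0`, and satisfies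
`‖Φ - Φ₀‖_{H²} + |c - c₀| ≤ K σ²`. -/
def IsInstantaneousWave (ρ : Fin n → ℝ) (f h : E n → E n) (g : E n → (E m →L[ℝ] E n))
    (q : ℝ → Matrix (Fin m) (Fin m) ℝ) (Φref ψ : ℝ → E n) (χlow χhigh : ℝ → ℝ)
    (Φ₀ : ℝ → E n) (c₀ K σ : ℝ) (p : (ℝ →ₘ[volume] E n) × ℝ) : Prop :=
  p.1 ∈ affineH2 Φref ∧
    (∀ᵐ x, opK ρ f h g q Φref ψ χlow χhigh σ p.1 0 p.2 x = 0) ∧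
    h2Norm (fun x => p.1 x - Φ₀ x) + |p.2 - c₀| ≤ K * σ ^ 2

end Operator

end

end StochWave

/-! Write Φ = Φ₀ + v and c = c₀ + γ with v ∈ H². The wave equation for Φ₀ cancels all terms without
v, γ or σ, and what is left of K_σ(Φ, 0, c) = 0 is

L v + γ Φ₀' + G_σ(v, γ) = 0, G_σ(v, γ) = γ v' + R(v) + σ² N(v).

Here L is the linearisation, R(v) is the Taylor remainder of f at Φ₀, and N collects h, the
Hilbert-Schmidt term and the derivative of the noise correction (`opK_eq_zero_iff`).

Simplicity of the eigenvalue 0 inverts the linear part: the kernel of L is spanned by Φ₀', the range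
of L is a complement of it, and ⟨Φ₀', ψ⟩ = 1. Hence (v, γ) ↦ L v + γ Φ₀' is a bijection from {⟨v, ψ⟩
= 0} × ℝ onto L², and the open mapping theorem gives a bounded inverse T
(`exists_bordered_inverse`). The spectral assumption is about complex functions; real parts carry it
over to real ones (`SimpleZeroEigenvalue.real`).

The perturbation satisfies ‖G_σ(0)‖ ≤ Cσ² and has Lipschitz constant C(s + σ²) on the ball of radius
s ≤ 1 (`perturbation_bounds`): γ v' and R are quadratic, and N is Lipschitz from the unit ball of H²
to L² (`lipL2_orderTwo`). The term with U'' loses no derivative, since its coefficient is a scalar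
and its values are only required in L². So y ↦ T(-G_σ(y)) contracts a ball of radius proportional to
σ² (`exists_fixedPoint`). Two waves satisfying (1) differ by T applied to a difference of values of
G_σ as soon as their difference has phase zero, and the contraction estimate makes them equal; both
uniqueness claims follow.

Three facts support the Lipschitz bounds. The embedding of H² into bounded C¹ functions makes local
Lipschitz constants sufficient. Exponential convergence to common zeros of f, g, h puts f(Φ₀),
g(Φ₀), h(Φ₀) and the derivatives of Φ₀ into L² (`waveRegularity`). Parseval's identity turns the
Hilbert-Schmidt norm into the L² norm of Q^{1/2} applied to one vector (`hsNormSq_eq`). -/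

namespace StochWave

noncomputable section

/-! ### Weak derivatives -/

section WeakDerivatives

variable {F G : Type*} [NormedAddCommGroup F] [NormedSpace ℝ F]
  [NormedAddCommGroup G] [NormedSpace ℝ G]

lemma integrable_smul_test {φ : ℝ → ℝ} (hφ : Continuous φ) (hc : HasCompactSupport φ)
    {u : ℝ → F} (hu : LocallyIntegrable u volume) : Integrable (fun x => φ x • u x) volume :=
  hu.integrable_smul_left_of_hasCompactSupport hφ hc

lemma continuous_deriv_test {φ : ℝ → ℝ} (hφ : ContDiff ℝ ∞ φ) : Continuous (deriv φ) :=
  hφ.continuous_deriv (by simp)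

lemma HasWeakDeriv.congr {u u' w w' : ℝ → F} (h : HasWeakDeriv u w) (hu : u =ᵐ[volume] u')
    (hw : w =ᵐ[volume] w') : HasWeakDeriv u' w' := by
  refine ⟨h.1.congr hu, h.2.1.congr hw, fun φ hφ hc => ?_⟩
  have h1 : ∫ x, deriv φ x • u' x = ∫ x, deriv φ x • u x :=
    integral_congr_ae (hu.mono fun x hx => by simp [hx])
  have h2 : ∫ x, φ x • w' x = ∫ x, φ x • w x :=
    integral_congr_ae (hw.mono fun x hx => by simp [hx])
  rw [h1, h2, h.2.2 φ hφ hc]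

lemma HasWeakDeriv.add {u u' w w' : ℝ → F} (h : HasWeakDeriv u w) (h' : HasWeakDeriv u' w') :
    HasWeakDeriv (fun x => u x + u' x) (fun x => w x + w' x) := by
  refine ⟨h.1.add h'.1, h.2.1.add h'.2.1, fun φ hφ hc => ?_⟩
  have hd := continuous_deriv_test hφ
  simp only [smul_add]
  rw [integral_add (integrable_smul_test hd hc.deriv h.1) (integrable_smul_test hd hc.deriv h'.1),
    integral_add (integrable_smul_test hφ.continuous hc h.2.1)
      (integrable_smul_test hφ.continuous hc h'.2.1), h.2.2 φ hφ hc, h'.2.2 φ hφ hc, neg_add]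

lemma HasWeakDeriv.clm [CompleteSpace F] [CompleteSpace G] {u w : ℝ → F} (h : HasWeakDeriv u w)
    (A : F →L[ℝ] G) : HasWeakDeriv (fun x => A (u x)) (fun x => A (w x)) := by
  have hA : ∀ {u : ℝ → F}, LocallyIntegrable u volume →
      LocallyIntegrable (fun x => A (u x)) volume := fun hu x => by
    obtain ⟨s, hs, hi⟩ := hu x
    exact ⟨s, hs, A.integrable_comp hi⟩
  refine ⟨hA h.1, hA h.2.1, fun φ hφ hc => ?_⟩
  have hd := continuous_deriv_test hφ
  simp only [← map_smul]
  rw [A.integral_comp_comm (integrable_smul_test hd hc.deriv h.1),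
    A.integral_comp_comm (integrable_smul_test hφ.continuous hc h.2.1), h.2.2 φ hφ hc, map_neg]

lemma HasWeakDeriv.const_smul [CompleteSpace F] {u w : ℝ → F} (h : HasWeakDeriv u w) (c : ℝ) :
    HasWeakDeriv (fun x => c • u x) (fun x => c • w x) :=
  h.clm (c • ContinuousLinearMap.id ℝ F)

lemma HasWeakDeriv.sub [CompleteSpace F] {u u' w w' : ℝ → F} (h : HasWeakDeriv u w)
    (h' : HasWeakDeriv u' w') :
    HasWeakDeriv (fun x => u x - u' x) (fun x => w x - w' x) := by
  simpa [sub_eq_add_neg] using h.add (h'.const_smul (-1))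

lemma HasWeakDeriv.unique [CompleteSpace F] {u w w' : ℝ → F} (h : HasWeakDeriv u w)
    (h' : HasWeakDeriv u w') : w =ᵐ[volume] w' :=
  ae_eq_of_integral_contDiff_smul_eq h.2.1 h'.2.1 fun φ hφ hc => by
    rw [← neg_inj, ← h.2.2 φ hφ hc, h'.2.2 φ hφ hc]

lemma HasWeakDeriv.weakDeriv_ae_eq [CompleteSpace F] {u w : ℝ → F} (h : HasWeakDeriv u w) :
    weakDeriv u =ᵐ[volume] w := by
  have hex : ∃ w, HasWeakDeriv u w := ⟨w, h⟩
  rw [weakDeriv, dif_pos hex]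
  exact (Classical.choose_spec hex).unique h

lemma HasWeakDeriv.weakDeriv_weakDeriv_ae_eq [CompleteSpace F] {u w z : ℝ → F}
    (h : HasWeakDeriv u w) (h' : HasWeakDeriv w z) :
    weakDeriv (weakDeriv u) =ᵐ[volume] z :=
  (h'.congr h.weakDeriv_ae_eq.symm (ae_eq_refl z)).weakDeriv_ae_eq

lemma hasWeakDeriv_of_hasDerivAt [CompleteSpace F] {u w : ℝ → F}
    (h : ∀ x, HasDerivAt u (w x) x) (hw : LocallyIntegrable w volume) : HasWeakDeriv u w := by
  have hu : Continuous u := continuous_iff_continuousAt.2 fun x => (h x).continuousAt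
  refine ⟨hu.locallyIntegrable, hw, fun φ hφ hc => ?_⟩
  have hd := continuous_deriv_test hφ
  have := integral_bilinear_hasDerivAt_right_eq_neg_left_of_integrable (u := φ) (u' := deriv φ)
    (v := u) (v' := w) (L := ContinuousLinearMap.lsmul ℝ ℝ)
    (fun x _ => ((hφ.differentiable (by simp)) x).hasDerivAt) (fun x _ => h x)
    (integrable_smul_test hφ.continuous hc hw)
    (integrable_smul_test hd hc.deriv hu.locallyIntegrable)
    (integrable_smul_test hφ.continuous hc hu.locallyIntegrable)
  simp only [ContinuousLinearMap.lsmul_apply] at this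
  rw [this, neg_neg]

/-- Fubini on the half plane y ≤ x: the inner integral of φ' over [y, ∞) is -φ(y). -/
lemma hasWeakDeriv_setIntegral_Iic [CompleteSpace F] {w : ℝ → F} (hw : Integrable w volume) :
    HasWeakDeriv (fun x => ∫ y in Set.Iic x, w y) w := by
  have hcont : Continuous (fun x => ∫ y in Set.Iic x, w y) := by
    have : (fun x => ∫ y in Set.Iic x, w y)
        = fun x => (∫ y in Set.Iic 0, w y) + ∫ y in (0 : ℝ)..x, w y := by
      funext x
      rw [← intervalIntegral.integral_Iic_sub_Iic hw.integrableOn hw.integrableOn]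
      abel
    rw [this]
    exact continuous_const.add (intervalIntegral.continuous_primitive
      (fun a b => hw.intervalIntegrable) 0)
  refine ⟨hcont.locallyIntegrable, hw.locallyIntegrable, fun φ hφ hc => ?_⟩
  have hd := continuous_deriv_test hφ
  have hdi : Integrable (deriv φ) volume := hd.integrable_of_hasCompactSupport hc.deriv
  have hprod : Integrable (Function.uncurry fun x y =>
      (Set.Iic x).indicator (fun y => deriv φ x • w y) y) (volume.prod volume) := by
    have := (hdi.smul_prod hw).indicator
      (measurableSet_le measurable_snd measurable_fst : MeasurableSet {z : ℝ × ℝ | z.2 ≤ z.1})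
    refine this.congr (ae_of_all _ fun z => ?_)
    simp [Set.indicator, Function.uncurry]
  calc ∫ x, deriv φ x • ∫ y in Set.Iic x, w y
      = ∫ x, ∫ y, (Set.Iic x).indicator (fun y => deriv φ x • w y) y := by
        congr 1; funext x
        rw [integral_indicator measurableSet_Iic, integral_smul]
    _ = ∫ y, ∫ x, (Set.Iic x).indicator (fun y => deriv φ x • w y) y :=
        integral_integral_swap hprod
    _ = ∫ y, -(φ y • w y) := by
        congr 1; funext y
        have : (fun x => (Set.Iic x).indicator (fun y => deriv φ x • w y) y)
            = (Set.Ici y).indicator (fun x => deriv φ x • w y) := by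
          funext x; simp [Set.indicator]
        rw [this, integral_indicator measurableSet_Ici, integral_smul_const,
          integral_Ici_eq_integral_Ioi, hc.integral_Ioi_deriv_eq (hφ.of_le (by simp)), neg_smul]
    _ = -∫ x, φ x • w x := integral_neg _

/-- For a fixed test function only a bounded window of w matters, so the integrable case applies to
a truncation of w. The two primitives differ on the window by a constant, which pairs to zero with
φ'. -/
lemma hasWeakDeriv_intervalIntegral [CompleteSpace F] {w : ℝ → F}
    (hw : LocallyIntegrable w volume) : HasWeakDeriv (fun x => ∫ y in (0 : ℝ)..x, w y) w := by
  have hii : ∀ a b, IntervalIntegrable w volume a b := fun a b =>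
    (hw.integrableOn_isCompact isCompact_uIcc).intervalIntegrable
  refine ⟨(intervalIntegral.continuous_primitive hii 0).locallyIntegrable, hw,
    fun φ hφ hc => ?_⟩
  obtain ⟨R, hR0, hR⟩ : ∃ R : ℝ, 0 < R ∧ ∀ x, R < |x| → φ x = 0 ∧ deriv φ x = 0 := by
    obtain ⟨R, hR⟩ := (hc.isCompact.union hc.deriv.isCompact).isBounded.exists_norm_le
    refine ⟨max R 1, by positivity, fun x hx => ⟨?_, ?_⟩⟩
    · by_contra h0
      exact absurd (hR x (Or.inl (subset_tsupport _ h0))) (not_le.2 (lt_of_le_of_lt (le_max_left _ _) hx))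
    · by_contra h0
      exact absurd (hR x (Or.inr (subset_tsupport _ h0))) (not_le.2 (lt_of_le_of_lt (le_max_left _ _) hx))
  set wR : ℝ → F := (Set.Ioc (-R) R).indicator w with hwR
  have hwRi : Integrable wR volume :=
    (integrable_indicator_iff measurableSet_Ioc).2 (hii (-R) R).1
  have hd := continuous_deriv_test hφ
  have key := (hasWeakDeriv_setIntegral_Iic hwRi).2.2 φ hφ hc
  -- The window is half open, so its left endpoint is an exceptional point of measure zero.
  have e1 : ∀ x, φ x • wR x = φ x • w x ∨ x = -R := by
    intro x
    by_cases hx : R < |x|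
    · simp [(hR x hx).1]
    · obtain ⟨h1, h2⟩ := abs_le.1 (not_lt.1 hx)
      rcases h1.eq_or_lt with h | h
      · exact Or.inr h.symm
      · left; rw [hwR, Set.indicator_of_mem (Set.mem_Ioc.2 ⟨h, h2⟩)]
  have e1' : ∫ x, φ x • wR x = ∫ x, φ x • w x := by
    refine integral_congr_ae ?_
    filter_upwards [compl_mem_ae_iff.2 (measure_singleton (μ := volume) (-R))] with x hx
    exact (e1 x).resolve_right hx
  have e2 : ∀ x, deriv φ x • ∫ y in (0 : ℝ)..x, w y
      = deriv φ x • (∫ y in (0 : ℝ)..(-R), w y) + deriv φ x • ∫ y in Set.Iic x, wR y := by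
    intro x
    by_cases hx : R < |x|
    · simp [(hR x hx).2]
    · obtain ⟨h1, h2⟩ := abs_le.1 (not_lt.1 hx)
      rw [← smul_add]; congr 1
      rw [hwR, setIntegral_indicator measurableSet_Ioc]
      have : Set.Iic x ∩ Set.Ioc (-R) R = Set.Ioc (-R) x := by
        ext y; simp only [Set.mem_inter_iff, Set.mem_Iic, Set.mem_Ioc]
        constructor
        · rintro ⟨a, b, c⟩; exact ⟨b, a⟩
        · rintro ⟨a, b⟩; exact ⟨b, a, b.trans h2⟩
      rw [this, ← intervalIntegral.integral_of_le h1,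
        intervalIntegral.integral_add_adjacent_intervals (hii _ _) (hii _ _)]
  have e3 : ∫ x, deriv φ x • (∫ y in (0 : ℝ)..(-R), w y) = 0 := by
    have h0 : ∫ x, deriv φ x = 0 := integral_eq_zero_of_hasDerivAt_of_integrable
      (fun x => ((hφ.differentiable (by simp)) x).hasDerivAt)
      (hd.integrable_of_hasCompactSupport hc.deriv)
      (hφ.continuous.integrable_of_hasCompactSupport hc)
    rw [integral_smul_const, h0, zero_smul]
  simp only [e2]
  rw [integral_add _ (integrable_smul_test hd hc.deriv (hasWeakDeriv_setIntegral_Iic hwRi).1), e3,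
    zero_add, key, e1']
  exact (hd.integrable_of_hasCompactSupport hc.deriv).smul_const _

/-- Du Bois-Reymond: fix a bump e of integral 1. For every test function φ, the function φ - (∫ φ) e
has mean zero, hence is the derivative of a test function and is annihilated by u. This says ∫ φ u =
(∫ φ)(∫ e u). -/
lemma HasWeakDeriv.ae_eq_const [CompleteSpace F] {u : ℝ → F} (h : HasWeakDeriv u fun _ => 0) :
    ∃ c : F, u =ᵐ[volume] fun _ => c := by
  obtain ⟨η, hη⟩ : ∃ η : ContDiffBump (0 : ℝ), True := ⟨⟨1, 2, by norm_num, by norm_num⟩, trivial⟩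
  set e : ℝ → ℝ := η.normed volume
  have he : ContDiff ℝ ∞ e := η.contDiff_normed
  have hec : HasCompactSupport e := η.hasCompactSupport_normed
  have hei : ∫ x, e x = 1 := η.integral_normed
  refine ⟨∫ x, e x • u x, ae_eq_of_integral_contDiff_smul_eq h.1
    continuous_const.locallyIntegrable fun φ hφ hc => ?_⟩
  set a : ℝ := ∫ x, φ x
  set ζ : ℝ → ℝ := fun x => φ x - a * e x
  have hζ : ContDiff ℝ ∞ ζ := hφ.sub (contDiff_const.mul he)
  have hζc : HasCompactSupport ζ := hc.sub hec.mul_left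
  have hφi := hφ.continuous.integrable_of_hasCompactSupport (μ := volume) hc
  have hei' := he.continuous.integrable_of_hasCompactSupport (μ := volume) hec
  have hζi : Integrable ζ volume := hζ.continuous.integrable_of_hasCompactSupport hζc
  have hζ0 : ∫ x, ζ x = 0 := by
    simp only [ζ]
    rw [integral_sub hφi (hei'.const_mul a), integral_const_mul, hei, mul_one, sub_self]
  set Z : ℝ → ℝ := fun x => ∫ y in Set.Iic x, ζ y with hZ
  have hZd : ∀ x, HasDerivAt Z (ζ x) x := by
    intro x
    have : Z = fun x => (∫ y in Set.Iic 0, ζ y) + ∫ y in (0 : ℝ)..x, ζ y := by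
      funext x
      rw [← intervalIntegral.integral_Iic_sub_Iic hζi.integrableOn hζi.integrableOn]
      simp [hZ]
    rw [this]
    exact (hζ.continuous.integral_hasStrictDerivAt 0 x).hasDerivAt.const_add _
  have hdZ : deriv Z = ζ := funext fun x => (hZd x).deriv
  have hZs : ContDiff ℝ ∞ Z := by
    rw [contDiff_infty_iff_deriv]
    exact ⟨fun x => (hZd x).differentiableAt, hdZ ▸ hζ⟩
  -- To the right of the support of ζ the primitive equals the full integral of ζ, which vanishes.
  have hZc : HasCompactSupport Z := by
    obtain ⟨R, hR⟩ := hζc.isCompact.isBounded.exists_norm_le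
    refine HasCompactSupport.intro (isCompact_Icc (a := -|R|) (b := |R|)) fun x hx => ?_
    have hz : ∀ y, |R| < |y| → ζ y = 0 := fun y hy => by
      by_contra h0
      exact absurd (hR y (subset_tsupport _ h0)) (not_le.2 ((le_abs_self R).trans_lt hy))
    have hx' : x < -|R| ∨ |R| < x := by
      by_contra hcon
      push Not at hcon
      exact hx ⟨hcon.1, hcon.2⟩
    rcases hx' with h1 | h1
    · refine setIntegral_eq_zero_of_forall_eq_zero fun y hy => hz y ?_
      rw [Set.mem_Iic] at hy
      rw [lt_abs]; right; linarith
    · have h2 : ∫ y in Set.Ioi x, ζ y = 0 :=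
        setIntegral_eq_zero_of_forall_eq_zero fun y hy => hz y (by
          rw [Set.mem_Ioi] at hy
          rw [lt_abs]; left; linarith)
      have h3 := intervalIntegral.integral_Iic_add_Ioi (b := x) hζi.integrableOn hζi.integrableOn
      simpa [h2, hζ0] using h3
  have key := h.2.2 Z hZs hZc
  simp only [hdZ, smul_zero, integral_zero, neg_zero] at key
  have hsplit : ∫ x, ζ x • u x = (∫ x, φ x • u x) - a • ∫ x, e x • u x := by
    simp only [ζ, sub_smul, mul_smul]
    have hi : Integrable (fun x => a • e x • u x) volume :=
      (integrable_smul_test he.continuous hec h.1).smul a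
    rw [integral_sub (integrable_smul_test hφ.continuous hc h.1) hi, integral_smul]
  rw [hsplit, sub_eq_zero] at key
  rw [key, integral_smul_const]

lemma HasWeakDeriv.ae_eq_integral [CompleteSpace F] {u w : ℝ → F} (h : HasWeakDeriv u w) :
    ∃ c : F, u =ᵐ[volume] fun x => c + ∫ y in (0 : ℝ)..x, w y := by
  have h2 := h.sub (hasWeakDeriv_intervalIntegral h.2.1)
  simp only [sub_self] at h2
  obtain ⟨c, hc⟩ := h2.ae_eq_const
  exact ⟨c, hc.mono fun x hx => eq_add_of_sub_eq hx⟩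

end WeakDerivatives

/-! ### Continuous representatives -/

section Representatives

variable {F : Type*} [NormedAddCommGroup F] [NormedSpace ℝ F]

/-- An interval of length one is a probability space, where the L¹ norm is at most the L² norm. -/
lemma integral_norm_unit_le {H : Type*} [NormedAddCommGroup H] {u : ℝ → H} (hu : MemLp u 2 volume) (x : ℝ) :
    ∫ y in x..(x + 1), ‖u y‖ ≤ (eLpNorm u 2 volume).toReal := by
  have hprob : IsProbabilityMeasure (volume.restrict (Set.Ioc x (x + 1))) :=
    ⟨by simp [Real.volume_Ioc]⟩
  have hr : MemLp u 2 (volume.restrict (Set.Ioc x (x + 1))) := hu.restrict _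
  rw [intervalIntegral.integral_of_le (by linarith)]
  have h1 : ∫ y in Set.Ioc x (x + 1), ‖u y‖
      = (eLpNorm u 1 (volume.restrict (Set.Ioc x (x + 1)))).toReal := by
    rw [integral_norm_eq_lintegral_enorm hr.1, eLpNorm_one_eq_lintegral_enorm]
  rw [h1]
  refine ENNReal.toReal_mono hu.2.ne ?_
  exact (eLpNorm_le_eLpNorm_of_exponent_le (by norm_num) hr.1).trans
    (eLpNorm_mono_measure _ Measure.restrict_le_self)

variable [CompleteSpace F]

/-- Sobolev embedding by averaging: r(x) = r(y) - ∫ w over [x, y], and the mean over y in [x, x + 1]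
bounds r(x) by L¹ norms on a unit interval. -/
lemma HasWeakDeriv.exists_continuous_rep {u w : ℝ → F} (h : HasWeakDeriv u w)
    (hu : MemLp u 2 volume) (hw : MemLp w 2 volume) :
    ∃ r : ℝ → F, Continuous r ∧ u =ᵐ[volume] r ∧
      ∀ x, ‖r x‖ ≤ (eLpNorm u 2 volume).toReal + (eLpNorm w 2 volume).toReal := by
  obtain ⟨c, hc⟩ := h.ae_eq_integral
  have hii : ∀ a b, IntervalIntegrable w volume a b := fun a b =>
    (h.2.1.integrableOn_isCompact isCompact_uIcc).intervalIntegrable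
  set r : ℝ → F := fun x => c + ∫ y in (0 : ℝ)..x, w y with hr
  have hrc : Continuous r := continuous_const.add (intervalIntegral.continuous_primitive hii 0)
  refine ⟨r, hrc, hc, fun x => ?_⟩
  have hur : eLpNorm u 2 volume = eLpNorm r 2 volume := eLpNorm_congr_ae hc
  have hrL : MemLp r 2 volume := hu.ae_eq hc
  have hpt : ∀ y ∈ Set.Icc x (x + 1), ‖r x‖ ≤ ‖r y‖ + (eLpNorm w 2 volume).toReal := by
    intro y hy
    have h1 : r x = r y - ∫ z in x..y, w z := by
      simp only [hr]
      rw [← intervalIntegral.integral_add_adjacent_intervals (hii 0 x) (hii x y)]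
      abel
    have h2 : ‖∫ z in x..y, w z‖ ≤ ∫ z in x..(x + 1), ‖w z‖ :=
      (intervalIntegral.norm_integral_le_integral_norm hy.1).trans
        (intervalIntegral.integral_mono_interval le_rfl hy.1 hy.2
          (ae_of_all _ fun _ => norm_nonneg _) (hii _ _).norm)
    rw [h1]
    exact (norm_sub_le _ _).trans (add_le_add le_rfl (h2.trans (integral_norm_unit_le hw x)))
  have h3 : ∫ _ in x..(x + 1), ‖r x‖
      ≤ ∫ y in x..(x + 1), (‖r y‖ + (eLpNorm w 2 volume).toReal) :=
    intervalIntegral.integral_mono_on (by linarith) intervalIntegrable_const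
      ((hrc.norm.add continuous_const).intervalIntegrable _ _) hpt
  rw [intervalIntegral.integral_add (hrc.norm.intervalIntegrable _ _) intervalIntegrable_const] at h3
  simp only [intervalIntegral.integral_const, add_sub_cancel_left, one_smul] at h3
  rw [hur]
  linarith [integral_norm_unit_le hrL x]

lemma HasWeakDeriv.exists_hasDerivAt_rep {u w : ℝ → F} (h : HasWeakDeriv u w)
    (hw : Continuous w) : ∃ r : ℝ → F, u =ᵐ[volume] r ∧ ∀ x, HasDerivAt r (w x) x := by
  obtain ⟨c, hc⟩ := h.ae_eq_integral
  exact ⟨_, hc, fun x => (hw.integral_hasStrictDerivAt 0 x).hasDerivAt.const_add c⟩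

/-- An `H²` function agrees almost everywhere with a `C¹` function which is bounded together with
its derivative. -/
lemma exists_C1_rep {u u₁ u₂ : ℝ → F} (hu : MemLp u 2 volume) (hu₁ : MemLp u₁ 2 volume)
    (hu₂ : MemLp u₂ 2 volume) (h₁ : HasWeakDeriv u u₁) (h₂ : HasWeakDeriv u₁ u₂) :
    ∃ r r₁ : ℝ → F, u =ᵐ[volume] r ∧ u₁ =ᵐ[volume] r₁ ∧ (∀ x, HasDerivAt r (r₁ x) x) ∧
      Continuous r₁ ∧
      (∀ x, ‖r x‖ ≤ (eLpNorm u 2 volume).toReal + (eLpNorm u₁ 2 volume).toReal) ∧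
      (∀ x, ‖r₁ x‖ ≤ (eLpNorm u₁ 2 volume).toReal + (eLpNorm u₂ 2 volume).toReal) := by
  obtain ⟨r₁, hc₁, he₁, hb₁⟩ := h₂.exists_continuous_rep hu₁ hu₂
  obtain ⟨r, he, hd⟩ := (h₁.congr (ae_eq_refl u) he₁).exists_hasDerivAt_rep hc₁
  obtain ⟨r', hc', he', hb'⟩ := h₁.exists_continuous_rep hu hu₁
  have hrc : Continuous r := continuous_iff_continuousAt.2 fun x => (hd x).continuousAt
  -- The representative with a derivative and the one with a bound are continuous and agree almost
  -- everywhere, so they coincide.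
  have : r = r' := (hrc.ae_eq_iff_eq volume hc').1 (he.symm.trans he')
  exact ⟨r, r₁, he, he₁, hd, hc₁, this ▸ hb', hb₁⟩

end Representatives

/-! ### The Banach space `H²` -/

section SobolevSpace

variable {n : ℕ}

lemma memLp_test_smul {φ : ℝ → ℝ} (hφ : Continuous φ) (hc : HasCompactSupport φ) (e : E n) :
    MemLp (fun x => φ x • e) 2 volume :=
  (hφ.smul continuous_const).memLp_of_hasCompactSupport hc.smul_right

lemma inner_toLp_test {φ : ℝ → ℝ} (hφ : Continuous φ) (hc : HasCompactSupport φ) (e : E n)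
    (u : L2 n) : inner ℝ ((memLp_test_smul hφ hc e).toLp _) u = inner ℝ e (∫ x, φ x • u x) := by
  have hi := integrable_smul_test hφ hc ((Lp.memLp u).locallyIntegrable (by norm_num))
  have := (innerSL ℝ e).integral_comp_comm hi
  simp only [innerSL_apply_apply] at this
  rw [L2.inner_def, ← this]
  refine integral_congr_ae ?_
  filter_upwards [(memLp_test_smul hφ hc e).coeFn_toLp] with x hx
  rw [hx, real_inner_smul_left, real_inner_smul_right]

/-- Each test function, paired with a vector e, imposes one closed condition, an equality of L²
inner products. Completeness of H² rests on this. -/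
lemma isClosed_hasWeakDeriv : IsClosed {z : L2 n × L2 n | HasWeakDeriv z.1 z.2} := by
  have : {z : L2 n × L2 n | HasWeakDeriv z.1 z.2} =
      ⋂ (φ : ℝ → ℝ) (hφ : ContDiff ℝ ∞ φ) (hc : HasCompactSupport φ) (e : E n),
        {z : L2 n × L2 n |
          inner ℝ ((memLp_test_smul (continuous_deriv_test hφ) hc.deriv e).toLp _) z.1
            = -(inner ℝ ((memLp_test_smul hφ.continuous hc e).toLp _) z.2 : ℝ)} := by
    ext z
    simp only [Set.mem_ofPred_eq, Set.mem_iInter]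
    have key : ∀ (φ : ℝ → ℝ) (hφ : ContDiff ℝ ∞ φ) (hc : HasCompactSupport φ) (e : E n),
        inner ℝ ((memLp_test_smul (continuous_deriv_test hφ) hc.deriv e).toLp _) z.1
            = -(inner ℝ ((memLp_test_smul hφ.continuous hc e).toLp _) z.2 : ℝ) ↔
          inner ℝ e (∫ x, deriv φ x • z.1 x) = inner ℝ e (-∫ x, φ x • z.2 x) := by
      intro φ hφ hc e
      rw [inner_toLp_test (continuous_deriv_test hφ) hc.deriv,
        inner_toLp_test hφ.continuous hc, inner_neg_right]
    constructor
    · intro h φ hφ hc e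
      exact (key φ hφ hc e).2 (by rw [h.2.2 φ hφ hc])
    · intro h
      exact ⟨(Lp.memLp z.1).locallyIntegrable (by norm_num),
        (Lp.memLp z.2).locallyIntegrable (by norm_num),
        fun φ hφ hc => ext_inner_left ℝ fun e => (key φ hφ hc e).1 (h φ hφ hc e)⟩
  rw [this]
  refine isClosed_iInter fun φ => isClosed_iInter fun hφ => isClosed_iInter fun hc =>
    isClosed_iInter fun e => isClosed_eq ?_ ?_
  · exact continuous_const.inner continuous_fst
  · exact (continuous_const.inner continuous_snd).neg

lemma hasWeakDeriv_coe_zero : HasWeakDeriv (⇑(0 : L2 n)) (⇑(0 : L2 n)) :=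
  HasWeakDeriv.congr (u := fun _ => 0) (w := fun _ => 0)
    (hasWeakDeriv_of_hasDerivAt (fun x => hasDerivAt_const x 0)
      continuous_const.locallyIntegrable) (Lp.coeFn_zero _ _ _).symm (Lp.coeFn_zero _ _ _).symm

lemma HasWeakDeriv.coe_add {u u' w w' : L2 n} (h : HasWeakDeriv u w) (h' : HasWeakDeriv u' w') :
    HasWeakDeriv (⇑(u + u')) (⇑(w + w')) :=
  (h.add h').congr (Lp.coeFn_add u u').symm (Lp.coeFn_add w w').symm

lemma HasWeakDeriv.coe_smul {u w : L2 n} (h : HasWeakDeriv u w) (c : ℝ) :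
    HasWeakDeriv (⇑(c • u)) (⇑(c • w)) :=
  (h.const_smul c).congr (Lp.coeFn_smul c u).symm (Lp.coeFn_smul c w).symm

/-- The Sobolev space `H²(ℝ, ℝⁿ)`, as a space of triples `(v, v', v'')`. -/
def sobolev (n : ℕ) : Submodule ℝ (L2 n × L2 n × L2 n) where
  carrier := {z | HasWeakDeriv z.1 z.2.1 ∧ HasWeakDeriv z.2.1 z.2.2}
  zero_mem' := ⟨hasWeakDeriv_coe_zero, hasWeakDeriv_coe_zero⟩
  add_mem' hz hw := ⟨hz.1.coe_add hw.1, hz.2.coe_add hw.2⟩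
  smul_mem' c _ hz := ⟨hz.1.coe_smul c, hz.2.coe_smul c⟩

lemma isClosed_sobolev : IsClosed (sobolev n : Set (L2 n × L2 n × L2 n)) := by
  have h1 : Continuous fun z : L2 n × L2 n × L2 n => (z.1, z.2.1) := by fun_prop
  have h2 : Continuous fun z : L2 n × L2 n × L2 n => (z.2.1, z.2.2) := by fun_prop
  exact (isClosed_hasWeakDeriv.preimage h1).inter (isClosed_hasWeakDeriv.preimage h2)

instance : CompleteSpace (sobolev n) := isClosed_sobolev.completeSpace_coe

namespace sobolev

/-- The inclusion of `H²` into `L²`. -/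
def incl : sobolev n →L[ℝ] L2 n := (ContinuousLinearMap.fst ℝ _ _).comp (sobolev n).subtypeL

/-- The first derivative. -/
def d1 : sobolev n →L[ℝ] L2 n :=
  ((ContinuousLinearMap.fst ℝ _ _).comp (ContinuousLinearMap.snd ℝ _ _)).comp (sobolev n).subtypeL

/-- The second derivative. -/
def d2 : sobolev n →L[ℝ] L2 n :=
  ((ContinuousLinearMap.snd ℝ _ _).comp (ContinuousLinearMap.snd ℝ _ _)).comp (sobolev n).subtypeL

lemma norm_eq (v : sobolev n) : ‖v‖ = max ‖incl v‖ (max ‖d1 v‖ ‖d2 v‖) := rfl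

lemma norm_incl_le (v : sobolev n) : ‖incl v‖ ≤ ‖v‖ := by rw [norm_eq]; exact le_max_left _ _

lemma norm_d1_le (v : sobolev n) : ‖d1 v‖ ≤ ‖v‖ := by
  rw [norm_eq]; exact (le_max_left _ _).trans (le_max_right _ _)

lemma norm_d2_le (v : sobolev n) : ‖d2 v‖ ≤ ‖v‖ := by
  rw [norm_eq]; exact (le_max_right _ _).trans (le_max_right _ _)

lemma hasWeakDeriv_incl (v : sobolev n) : HasWeakDeriv (incl v) (d1 v) := v.2.1

lemma hasWeakDeriv_d1 (v : sobolev n) : HasWeakDeriv (d1 v) (d2 v) := v.2.2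

/-- Weak derivatives are unique, so the first entry of a triple determines the other two. -/
lemma ext_incl {v w : sobolev n} (h : ⇑(incl v) =ᵐ[volume] incl w) : v = w := by
  have h1 : ⇑(d1 v) =ᵐ[volume] d1 w :=
    ((hasWeakDeriv_incl v).congr h (ae_eq_refl _)).unique (hasWeakDeriv_incl w)
  have h2 : ⇑(d2 v) =ᵐ[volume] d2 w :=
    ((hasWeakDeriv_d1 v).congr h1 (ae_eq_refl _)).unique (hasWeakDeriv_d1 w)
  exact Subtype.ext (Prod.ext (Lp.ext h) (Prod.ext (Lp.ext h1) (Lp.ext h2)))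

lemma exists_rep (v : sobolev n) : ∃ r r₁ : ℝ → E n, incl v =ᵐ[volume] r ∧ d1 v =ᵐ[volume] r₁ ∧
    (∀ x, HasDerivAt r (r₁ x) x) ∧ Continuous r₁ ∧ (∀ x, ‖r x‖ ≤ 2 * ‖v‖) ∧
      ∀ x, ‖r₁ x‖ ≤ 2 * ‖v‖ := by
  obtain ⟨r, r₁, h1, h2, h3, h4, h5, h6⟩ := exists_C1_rep (Lp.memLp (incl v)) (Lp.memLp (d1 v))
    (Lp.memLp (d2 v)) (hasWeakDeriv_incl v) (hasWeakDeriv_d1 v)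
  simp only [← Lp.norm_def] at h5 h6
  exact ⟨r, r₁, h1, h2, h3, h4,
    fun x => (h5 x).trans (by linarith [norm_incl_le v, norm_d1_le v]),
    fun x => (h6 x).trans (by linarith [norm_d1_le v, norm_d2_le v])⟩

/-- The `C¹` representative. -/
def rep (v : sobolev n) : ℝ → E n := Classical.choose (exists_rep v)

/-- The derivative of the `C¹` representative. -/
def rep1 (v : sobolev n) : ℝ → E n := Classical.choose (Classical.choose_spec (exists_rep v))

lemma rep_spec (v : sobolev n) : incl v =ᵐ[volume] rep v ∧ d1 v =ᵐ[volume] rep1 v ∧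
    (∀ x, HasDerivAt (rep v) (rep1 v x) x) ∧ Continuous (rep1 v) ∧ (∀ x, ‖rep v x‖ ≤ 2 * ‖v‖) ∧
      ∀ x, ‖rep1 v x‖ ≤ 2 * ‖v‖ :=
  Classical.choose_spec (Classical.choose_spec (exists_rep v))

lemma incl_ae_eq (v : sobolev n) : incl v =ᵐ[volume] rep v := (rep_spec v).1

lemma d1_ae_eq (v : sobolev n) : d1 v =ᵐ[volume] rep1 v := (rep_spec v).2.1

lemma hasDerivAt_rep (v : sobolev n) (x : ℝ) : HasDerivAt (rep v) (rep1 v x) x :=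
  (rep_spec v).2.2.1 x

lemma continuous_rep1 (v : sobolev n) : Continuous (rep1 v) := (rep_spec v).2.2.2.1

lemma continuous_rep (v : sobolev n) : Continuous (rep v) :=
  continuous_iff_continuousAt.2 fun x => (hasDerivAt_rep v x).continuousAt

lemma norm_rep_le (v : sobolev n) (x : ℝ) : ‖rep v x‖ ≤ 2 * ‖v‖ := (rep_spec v).2.2.2.2.1 x

lemma norm_rep1_le (v : sobolev n) (x : ℝ) : ‖rep1 v x‖ ≤ 2 * ‖v‖ := (rep_spec v).2.2.2.2.2 x

/-- The representative comes from a choice, but continuity makes it unique and therefore compatible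
with differences. -/
lemma rep_sub (v w : sobolev n) : rep (v - w) = rep v - rep w := by
  refine ((continuous_rep _).ae_eq_iff_eq volume ((continuous_rep v).sub (continuous_rep w))).1 ?_
  have h := (incl_ae_eq v).sub (incl_ae_eq w)
  refine (incl_ae_eq (v - w)).symm.trans (EventuallyEq.trans ?_ h)
  rw [map_sub]
  exact Lp.coeFn_sub _ _

lemma rep1_sub (v w : sobolev n) : rep1 (v - w) = rep1 v - rep1 w := by
  refine ((continuous_rep1 _).ae_eq_iff_eq volume
    ((continuous_rep1 v).sub (continuous_rep1 w))).1 ?_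
  have h := (d1_ae_eq v).sub (d1_ae_eq w)
  refine (d1_ae_eq (v - w)).symm.trans (EventuallyEq.trans ?_ h)
  rw [map_sub]
  exact Lp.coeFn_sub _ _

lemma rep_zero : rep (0 : sobolev n) = 0 :=
  funext fun x => norm_le_zero_iff.1 (by simpa using norm_rep_le (0 : sobolev n) x)

lemma rep1_zero : rep1 (0 : sobolev n) = 0 :=
  funext fun x => norm_le_zero_iff.1 (by simpa using norm_rep1_le (0 : sobolev n) x)

/-- The element of `H²` given by a function with two weak derivatives in `L²`. -/
def mk {u u₁ u₂ : ℝ → E n} (hu : MemLp u 2 volume) (hu₁ : MemLp u₁ 2 volume)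
    (hu₂ : MemLp u₂ 2 volume) (h₁ : HasWeakDeriv u u₁) (h₂ : HasWeakDeriv u₁ u₂) : sobolev n :=
  ⟨(hu.toLp u, hu₁.toLp u₁, hu₂.toLp u₂),
    h₁.congr hu.coeFn_toLp.symm hu₁.coeFn_toLp.symm,
    h₂.congr hu₁.coeFn_toLp.symm hu₂.coeFn_toLp.symm⟩

end sobolev

/-! ### Translation between functions with weak derivatives and elements of the Banach space -/

lemma MemH2.exists_sobolev {u : ℝ → E n} (hu : MemH2 u) :
    ∃ v : sobolev n, u =ᵐ[volume] sobolev.incl v := by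
  obtain ⟨h0, u₁, u₂, h1, h2, hw1, hw2⟩ := hu
  exact ⟨sobolev.mk h0 h1 h2 hw1 hw2, h0.coeFn_toLp.symm⟩

lemma sobolev.memH2 {u : ℝ → E n} {v : sobolev n} (h : u =ᵐ[volume] incl v) : MemH2 u :=
  ⟨(Lp.memLp (incl v)).ae_eq h.symm, d1 v, d2 v, Lp.memLp _, Lp.memLp _,
    (hasWeakDeriv_incl v).congr h.symm (ae_eq_refl _), hasWeakDeriv_d1 v⟩

lemma l2Norm_eq_norm {u : ℝ → E n} {v : L2 n} (h : u =ᵐ[volume] v) : l2Norm u = ‖v‖ := by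
  have h1 : ∫ x, ‖u x‖ ^ 2 = ‖v‖ ^ 2 := by
    rw [← real_inner_self_eq_norm_sq, L2.inner_def]
    exact integral_congr_ae (h.mono fun x hx => by simp [hx])
  rw [l2Norm, h1, Real.sqrt_sq (norm_nonneg _)]

lemma sobolev.h2Norm_eq {u : ℝ → E n} {v : sobolev n} (h : u =ᵐ[volume] incl v) :
    h2Norm u = Real.sqrt (‖incl v‖ ^ 2 + ‖d1 v‖ ^ 2 + ‖d2 v‖ ^ 2) := by
  have h1 := (hasWeakDeriv_incl v).congr h.symm (ae_eq_refl _)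
  rw [h2Norm, l2Norm_eq_norm h, l2Norm_eq_norm h1.weakDeriv_ae_eq,
    l2Norm_eq_norm (h1.weakDeriv_weakDeriv_ae_eq (hasWeakDeriv_d1 v))]

lemma sobolev.norm_le_h2Norm {u : ℝ → E n} {v : sobolev n} (h : u =ᵐ[volume] incl v) :
    ‖v‖ ≤ h2Norm u := by
  rw [h2Norm_eq h, norm_eq]
  refine max_le (Real.le_sqrt_of_sq_le ?_) (max_le (Real.le_sqrt_of_sq_le ?_)
    (Real.le_sqrt_of_sq_le ?_)) <;>
  nlinarith [sq_nonneg ‖incl v‖, sq_nonneg ‖d1 v‖, sq_nonneg ‖d2 v‖]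

/-- The norm on triples is the maximum of three L² norms, so the Euclidean combination is at most √3
≤ 2 times it. The constant 2 enters the choice of the radius of the contraction. -/
lemma sobolev.h2Norm_le {u : ℝ → E n} {v : sobolev n} (h : u =ᵐ[volume] incl v) :
    h2Norm u ≤ 2 * ‖v‖ := by
  rw [h2Norm_eq h]
  refine Real.sqrt_le_iff.2 ⟨by positivity, ?_⟩
  have h1 := pow_le_pow_left₀ (norm_nonneg _) (norm_incl_le v) 2
  have h2 := pow_le_pow_left₀ (norm_nonneg _) (norm_d1_le v) 2
  have h3 := pow_le_pow_left₀ (norm_nonneg _) (norm_d2_le v) 2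
  nlinarith [sq_nonneg ‖v‖]

end SobolevSpace

/-! ### Families of functions that are bounded and Lipschitz on the unit ball -/

section LipschitzFamilies

variable {X Y Z W : Type*} [NormedAddCommGroup X] [NormedAddCommGroup Y] [NormedAddCommGroup Z]
  [NormedAddCommGroup W]

/-- A family of functions that is bounded and Lipschitz on the unit ball in the supremum norm. -/
def LipSup (F : X → ℝ → Y) : Prop :=
  (∀ v, ‖v‖ ≤ 1 → AEStronglyMeasurable (F v) volume) ∧
    ∃ C : ℝ, 0 ≤ C ∧ ∀ v w, ‖v‖ ≤ 1 → ‖w‖ ≤ 1 → ∀ x, ‖F v x‖ ≤ C ∧ ‖F v x - F w x‖ ≤ C * ‖v - w‖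

/-- A family of functions that is bounded and Lipschitz on the unit ball in the `L²`-norm. -/
def LipL2 (F : X → ℝ → Y) : Prop :=
  (∀ v, ‖v‖ ≤ 1 → MemLp (F v) 2 volume) ∧ ∃ C : ℝ, 0 ≤ C ∧ ∀ v w, ‖v‖ ≤ 1 → ‖w‖ ≤ 1 →
    eLpNorm (F v) 2 volume ≤ ENNReal.ofReal C ∧
      eLpNorm (fun x => F v x - F w x) 2 volume ≤ ENNReal.ofReal (C * ‖v - w‖)

/-- On the unit ball, the bound at the origin and the Lipschitz estimate against the origin give
boundedness, so only differences need to be estimated. -/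
lemma LipSup.of_sub {F : X → ℝ → Y} (hm : ∀ v, ‖v‖ ≤ 1 → AEStronglyMeasurable (F v) volume)
    (h0 : ∃ M, ∀ x, ‖F 0 x‖ ≤ M)
    (h : ∃ C : ℝ, ∀ v w, ‖v‖ ≤ 1 → ‖w‖ ≤ 1 → ∀ x, ‖F v x - F w x‖ ≤ C * ‖v - w‖) :
    LipSup F := by
  obtain ⟨M, hM⟩ := h0
  obtain ⟨C, hC⟩ := h
  refine ⟨hm, |M| + |C|, by positivity, fun v w hv hw x => ⟨?_, ?_⟩⟩
  · have h1 := hC v 0 hv (by simp) x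
    have h2 := norm_le_norm_add_norm_sub' (F v x) (F 0 x)
    rw [sub_zero] at h1
    have h3 : C * ‖v‖ ≤ |C| * 1 := mul_le_mul (le_abs_self C) hv (norm_nonneg _) (abs_nonneg _)
    linarith [hM x, le_abs_self M]
  · refine (hC v w hv hw x).trans (mul_le_mul_of_nonneg_right ?_ (norm_nonneg _))
    linarith [le_abs_self C, abs_nonneg M]

lemma LipL2.of_sub {F : X → ℝ → Y} (hm : ∀ v, ‖v‖ ≤ 1 → AEStronglyMeasurable (F v) volume)
    (h0 : MemLp (F 0) 2 volume)
    (h : ∃ C : ℝ, ∀ v w, ‖v‖ ≤ 1 → ‖w‖ ≤ 1 →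
      eLpNorm (fun x => F v x - F w x) 2 volume ≤ ENNReal.ofReal (C * ‖v - w‖)) :
    LipL2 F := by
  obtain ⟨C, hC⟩ := h
  have hb : ∀ v, ‖v‖ ≤ 1 →
      eLpNorm (F v) 2 volume ≤ ENNReal.ofReal ((eLpNorm (F 0) 2 volume).toReal + |C|) := by
    intro v hv
    have e : F v = F 0 + fun x => F v x - F 0 x := by
      funext x; simp
    have h1 : eLpNorm (fun x => F v x - F 0 x) 2 volume ≤ ENNReal.ofReal |C| := by
      refine (hC v 0 hv (by simp)).trans (ENNReal.ofReal_le_ofReal ?_)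
      rw [sub_zero]
      calc C * ‖v‖ ≤ |C| * 1 := mul_le_mul (le_abs_self C) hv (norm_nonneg _) (abs_nonneg _)
        _ = |C| := mul_one _
    rw [e, ENNReal.ofReal_add ENNReal.toReal_nonneg (abs_nonneg _), ENNReal.ofReal_toReal h0.2.ne]
    exact (eLpNorm_add_le h0.1 ((hm v hv).sub h0.1) (by norm_num)).trans
      (add_le_add le_rfl h1)
  refine ⟨fun v hv => ⟨hm v hv, (hb v hv).trans_lt ENNReal.ofReal_lt_top⟩,
    (eLpNorm (F 0) 2 volume).toReal + |C|, by positivity, fun v w hv hw => ⟨hb v hv, ?_⟩⟩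
  refine (hC v w hv hw).trans (ENNReal.ofReal_le_ofReal
    (mul_le_mul_of_nonneg_right ?_ (norm_nonneg _)))
  linarith [le_abs_self C, ENNReal.toReal_nonneg (a := eLpNorm (F 0) 2 volume)]

lemma LipSup.const {u : ℝ → Y} (hm : AEStronglyMeasurable u volume) {M : ℝ}
    (hu : ∀ x, ‖u x‖ ≤ M) : LipSup fun _ : X => u :=
  .of_sub (fun _ _ => hm) ⟨M, hu⟩ ⟨0, fun v w _ _ x => by simp⟩

lemma LipL2.const {u : ℝ → Y} (hu : MemLp u 2 volume) : LipL2 fun _ : X => u :=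
  .of_sub (fun _ _ => hu.1) hu ⟨0, fun v w _ _ => by simp⟩

lemma LipSup.add {F G : X → ℝ → Y} (hF : LipSup F) (hG : LipSup G) :
    LipSup fun v x => F v x + G v x := by
  obtain ⟨hFm, C, hC0, hC⟩ := hF
  obtain ⟨hGm, D, hD0, hD⟩ := hG
  refine ⟨fun v hv => (hFm v hv).add (hGm v hv), C + D, by positivity, fun v w hv hw x => ⟨?_, ?_⟩⟩
  · exact (norm_add_le _ _).trans (add_le_add (hC v w hv hw x).1 (hD v w hv hw x).1)
  · rw [add_sub_add_comm, add_mul]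
    exact (norm_add_le _ _).trans (add_le_add (hC v w hv hw x).2 (hD v w hv hw x).2)

lemma LipL2.add {F G : X → ℝ → Y} (hF : LipL2 F) (hG : LipL2 G) :
    LipL2 fun v x => F v x + G v x := by
  obtain ⟨hFm, C, hC0, hC⟩ := hF
  obtain ⟨hGm, D, hD0, hD⟩ := hG
  refine ⟨fun v hv => (hFm v hv).add (hGm v hv), C + D, by positivity,
    fun v w hv hw => ⟨?_, ?_⟩⟩
  · rw [ENNReal.ofReal_add hC0 hD0]
    exact (eLpNorm_add_le (hFm v hv).1 (hGm v hv).1 (by norm_num)).trans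
      (add_le_add (hC v w hv hw).1 (hD v w hv hw).1)
  · simp only [add_sub_add_comm]
    rw [add_mul, ENNReal.ofReal_add (by positivity) (by positivity)]
    exact (eLpNorm_add_le ((hFm v hv).1.sub (hFm w hw).1) ((hGm v hv).1.sub (hGm w hw).1)
      (by norm_num)).trans (add_le_add (hC v w hv hw).2 (hD v w hv hw).2)

/-- Lipschitz continuity on every ball around the origin. -/
def LipOnBalls (φ : Y → Z) : Prop :=
  ∀ R : ℝ, ∃ L : ℝ, 0 ≤ L ∧ ∀ a b, ‖a‖ ≤ R → ‖b‖ ≤ R → ‖φ a - φ b‖ ≤ L * ‖a - b‖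

lemma LipOnBalls.continuous {φ : Y → Z} (h : LipOnBalls φ) : Continuous φ := by
  rw [continuous_iff_continuousAt]
  intro a
  obtain ⟨L, hL0, hL⟩ := h (‖a‖ + 1)
  have h1 : Tendsto (fun b => L * ‖b - a‖) (𝓝 a) (𝓝 0) := by
    have : Continuous fun b => L * ‖b - a‖ := by fun_prop
    simpa using this.tendsto a
  rw [ContinuousAt, tendsto_iff_norm_sub_tendsto_zero]
  refine squeeze_zero' (Eventually.of_forall fun _ => norm_nonneg _) ?_ h1
  filter_upwards [Metric.ball_mem_nhds a one_pos] with b hb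
  refine hL b a ?_ (by linarith)
  have := norm_le_norm_add_norm_sub' b a
  rw [mem_ball_iff_norm] at hb
  linarith

/-- A family bounded by C only sees φ on the ball of radius C, so a local Lipschitz constant is
enough. -/
lemma LipSup.comp {F : X → ℝ → Y} {φ : Y → Z} (hφ : LipOnBalls φ) (hF : LipSup F) :
    LipSup fun v x => φ (F v x) := by
  obtain ⟨hFm, C, hC0, hC⟩ := hF
  obtain ⟨L, hL0, hL⟩ := hφ C
  refine .of_sub (fun v hv => hφ.continuous.comp_aestronglyMeasurable (hFm v hv))
    ⟨‖φ 0‖ + L * C, fun x => ?_⟩ ⟨L * C, fun v w hv hw x => ?_⟩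
  · have h0 := (hC 0 0 (by simp) (by simp) x).1
    have h1 := hL (F 0 x) 0 h0 (by simpa using hC0)
    have h2 := norm_le_norm_add_norm_sub' (φ (F 0 x)) (φ 0)
    rw [sub_zero] at h1
    have : L * ‖F 0 x‖ ≤ L * C := by gcongr
    linarith
  · refine (hL _ _ (hC v w hv hw x).1 (hC w v hw hv x).1).trans ?_
    rw [mul_assoc]
    gcongr
    exact (hC v w hv hw x).2

lemma LipSup.norm {F : X → ℝ → Y} (hF : LipSup F) : LipSup fun v x => ‖F v x‖ :=
  hF.comp fun _ => ⟨1, zero_le_one, fun a b _ _ => by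
    rw [one_mul]; exact abs_norm_sub_norm_le a b⟩

variable [NormedSpace ℝ Y] [NormedSpace ℝ Z] [NormedSpace ℝ W]

lemma LipSup.bilin {F : X → ℝ → Y} {G : X → ℝ → Z} (B : Y →L[ℝ] Z →L[ℝ] W)
    (hF : LipSup F) (hG : LipSup G) : LipSup fun v x => B (F v x) (G v x) := by
  obtain ⟨hFm, C, hC0, hC⟩ := hF
  obtain ⟨hGm, D, hD0, hD⟩ := hG
  refine ⟨fun v hv => B.aestronglyMeasurable_comp₂ (hFm v hv) (hGm v hv), 2 * ‖B‖ * C * D,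
    by positivity, fun v w hv hw x => ⟨?_, ?_⟩⟩
  · refine (B.le_opNorm₂ _ _).trans ?_
    have h1 : ‖B‖ * ‖F v x‖ * ‖G v x‖ ≤ ‖B‖ * C * D := by
      gcongr
      exacts [(hC v w hv hw x).1, (hD v w hv hw x).1]
    have : 0 ≤ ‖B‖ * C * D := by positivity
    linarith
  · have e : B (F v x) (G v x) - B (F w x) (G w x)
        = B (F v x - F w x) (G v x) + B (F w x) (G v x - G w x) := by
      simp only [map_sub, _root_.sub_apply]; abel
    rw [e]
    have h1 : ‖B (F v x - F w x) (G v x)‖ ≤ ‖B‖ * (C * ‖v - w‖) * D := by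
      refine (B.le_opNorm₂ _ _).trans ?_
      gcongr
      exacts [(hC v w hv hw x).2, (hD v w hv hw x).1]
    have h2 : ‖B (F w x) (G v x - G w x)‖ ≤ ‖B‖ * C * (D * ‖v - w‖) := by
      refine (B.le_opNorm₂ _ _).trans ?_
      gcongr
      exacts [(hC w v hw hv x).1, (hD v w hv hw x).2]
    refine (norm_add_le _ _).trans ((add_le_add h1 h2).trans (le_of_eq (by ring)))

/-- In a product one factor is measured in the supremum norm and the other in L²; the difference is
split by changing one factor at a time. -/
lemma LipL2.bilin {F : X → ℝ → Y} {G : X → ℝ → Z} (B : Y →L[ℝ] Z →L[ℝ] W)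
    (hF : LipSup F) (hG : LipL2 G) : LipL2 fun v x => B (F v x) (G v x) := by
  obtain ⟨hFm, C, hC0, hC⟩ := hF
  obtain ⟨hGm, D, hD0, hD⟩ := hG
  have key : ∀ (a : ℝ → Y) (b : ℝ → Z) (s t : ℝ), 0 ≤ s → (∀ x, ‖a x‖ ≤ s) →
      eLpNorm b 2 volume ≤ ENNReal.ofReal t →
      eLpNorm (fun x => B (a x) (b x)) 2 volume ≤ ENNReal.ofReal (‖B‖ * s * t) := by
    intro a b s t hs ha hb
    have h1 : ∀ᵐ x ∂volume, ‖B (a x) (b x)‖ ≤ ‖B‖ * s * ‖b x‖ := ae_of_all _ fun x =>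
      (B.le_opNorm₂ _ _).trans (by gcongr; exact ha x)
    refine (eLpNorm_le_mul_eLpNorm_of_ae_le_mul h1 2).trans ?_
    rw [ENNReal.ofReal_mul (p := ‖B‖ * s) (by positivity)]
    exact mul_le_mul_right hb _
  refine ⟨fun v hv => ⟨B.aestronglyMeasurable_comp₂ (hFm v hv) (hGm v hv).1,
    (key _ _ C D hC0 (fun x => (hC v v hv hv x).1) (hD v v hv hv).1).trans_lt
      ENNReal.ofReal_lt_top⟩, 2 * ‖B‖ * C * D, by positivity, fun v w hv hw => ⟨?_, ?_⟩⟩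
  · refine (key _ _ C D hC0 (fun x => (hC v v hv hv x).1) (hD v v hv hv).1).trans
      (ENNReal.ofReal_le_ofReal ?_)
    have : 0 ≤ ‖B‖ * C * D := by positivity
    linarith
  · have e : (fun x => B (F v x) (G v x) - B (F w x) (G w x))
        = (fun x => B (F v x - F w x) (G v x)) + fun x => B (F w x) (G v x - G w x) := by
      funext x
      simp only [map_sub, _root_.sub_apply, Pi.add_apply]; abel
    rw [e]
    refine (eLpNorm_add_le
      (B.aestronglyMeasurable_comp₂ ((hFm v hv).sub (hFm w hw)) (hGm v hv).1)
      (B.aestronglyMeasurable_comp₂ (hFm w hw) ((hGm v hv).1.sub (hGm w hw).1))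
      (by norm_num)).trans ?_
    have h1 := key (fun x => F v x - F w x) (G v) (C * ‖v - w‖) D (by positivity)
      (fun x => (hC v w hv hw x).2) (hD v w hv hw).1
    have h2 := key (F w) (fun x => G v x - G w x) C (D * ‖v - w‖) hC0
      (fun x => (hC w v hw hv x).1) (hD v w hv hw).2
    refine (add_le_add h1 h2).trans ?_
    rw [← ENNReal.ofReal_add (by positivity) (by positivity)]
    exact ENNReal.ofReal_le_ofReal (le_of_eq (by ring))

lemma LipL2.bilin' {F : X → ℝ → Y} {G : X → ℝ → Z} (B : Y →L[ℝ] Z →L[ℝ] W)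
    (hF : LipL2 F) (hG : LipSup G) : LipL2 fun v x => B (F v x) (G v x) :=
  LipL2.bilin B.flip hG hF

lemma LipL2.smul {s : X → ℝ → ℝ} {G : X → ℝ → Y} (hs : LipSup s) (hG : LipL2 G) :
    LipL2 fun v x => s v x • G v x := LipL2.bilin (ContinuousLinearMap.lsmul ℝ ℝ) hs hG

lemma LipSup.mul {s t : X → ℝ → ℝ} (hs : LipSup s) (ht : LipSup t) :
    LipSup fun v x => s v x * t v x := hs.bilin (ContinuousLinearMap.mul ℝ ℝ) ht

lemma LipSup.clm {F : X → ℝ → Y} (A : Y →L[ℝ] Z) (hF : LipSup F) :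
    LipSup fun v x => A (F v x) := by
  have h1 : LipSup fun (_ : X) (_ : ℝ) => A := .const aestronglyMeasurable_const fun _ => le_rfl
  exact h1.bilin (ContinuousLinearMap.id ℝ (Y →L[ℝ] Z)) hF

lemma ContDiff.lipOnBalls [FiniteDimensional ℝ Y] {φ : Y → Z} (h : ContDiff ℝ 1 φ) :
    LipOnBalls φ := by
  intro R
  have : ProperSpace Y := FiniteDimensional.proper ℝ Y
  obtain ⟨C, hC⟩ := ((isCompact_closedBall (0 : Y) R).image
    (h.continuous_fderiv (by norm_num))).isBounded.exists_norm_le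
  refine ⟨|C|, abs_nonneg _, fun a b ha hb => ?_⟩
  refine (convex_closedBall (0 : Y) R).norm_image_sub_le_of_norm_fderiv_le (𝕜 := ℝ)
    (fun x _ => (h.differentiable (by norm_num)) x)
    (fun x hx => (hC _ ⟨x, hx, rfl⟩).trans (le_abs_self C)) ?_ ?_
  · simpa using hb
  · simpa using ha

/-- The difference of reciprocals is (t - s)/(st), and st ≥ c². This is where the lower cut-off,
bounded below by 1/4, will be used. -/
lemma LipSup.inv {s : X → ℝ → ℝ} {c : ℝ} (hc : 0 < c) (hs : LipSup s)
    (hpos : ∀ v x, c ≤ s v x) : LipSup fun v x => (s v x)⁻¹ := by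
  obtain ⟨hm, C, hC0, hC⟩ := hs
  have hp : ∀ v x, 0 < s v x := fun v x => hc.trans_le (hpos v x)
  refine .of_sub (fun v hv => (hm v hv).aemeasurable.inv.aestronglyMeasurable) ⟨c⁻¹, fun x => ?_⟩
    ⟨c⁻¹ * c⁻¹ * C, fun v w hv hw x => ?_⟩
  · rw [norm_inv, Real.norm_of_nonneg (hp 0 x).le]
    exact inv_anti₀ hc (hpos 0 x)
  · rw [inv_sub_inv (hp v x).ne' (hp w x).ne', norm_div, norm_mul, Real.norm_of_nonneg (hp v x).le,
      Real.norm_of_nonneg (hp w x).le, norm_sub_rev, div_eq_mul_inv, mul_inv]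
    calc ‖s v x - s w x‖ * ((s v x)⁻¹ * (s w x)⁻¹) ≤ (C * ‖v - w‖) * (c⁻¹ * c⁻¹) := by
          have := (hp v x).le
          have := (hp w x).le
          gcongr
          exacts [(hC v w hv hw x).2, hpos v x, hpos w x]
      _ = c⁻¹ * c⁻¹ * C * ‖v - w‖ := by ring

open Classical in
/-- The `L²`-class of a function (zero if the function is not square integrable). -/
def toL2 {n : ℕ} (u : ℝ → E n) : L2 n := if h : MemLp u 2 volume then h.toLp u else 0

lemma toL2_ae_eq {n : ℕ} {u : ℝ → E n} (h : MemLp u 2 volume) : toL2 u =ᵐ[volume] u := by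
  rw [toL2, dif_pos h]; exact h.coeFn_toLp

lemma norm_toL2 {n : ℕ} {u : ℝ → E n} (h : MemLp u 2 volume) :
    ‖toL2 u‖ = (eLpNorm u 2 volume).toReal := by
  rw [toL2, dif_pos h, Lp.norm_toLp]

lemma toL2_sub {n : ℕ} {u w : ℝ → E n} (hu : MemLp u 2 volume) (hw : MemLp w 2 volume) :
    toL2 u - toL2 w = toL2 fun x => u x - w x := by
  have h : MemLp (fun x => u x - w x) 2 volume := hu.sub hw
  rw [toL2, dif_pos hu, toL2, dif_pos hw, toL2, dif_pos h]
  rfl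

lemma LipL2.toL2 {n : ℕ} {F : X → ℝ → E n} (hF : LipL2 F) : ∃ C : ℝ, 0 ≤ C ∧
    ∀ v w, ‖v‖ ≤ 1 → ‖w‖ ≤ 1 → ‖toL2 (F v)‖ ≤ C ∧ ‖toL2 (F v) - toL2 (F w)‖ ≤ C * ‖v - w‖ := by
  obtain ⟨hm, C, hC0, hC⟩ := hF
  refine ⟨C, hC0, fun v w hv hw => ⟨?_, ?_⟩⟩
  · rw [norm_toL2 (hm v hv)]
    exact ENNReal.toReal_le_of_le_ofReal hC0 (hC v w hv hw).1
  · rw [toL2_sub (hm v hv) (hm w hw), norm_toL2 (show MemLp (fun x => F v x - F w x) 2 volume from (hm v hv).sub (hm w hw))]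
    exact ENNReal.toReal_le_of_le_ofReal (by positivity) (hC v w hv hw).2

/-- Viewing an L² vector as a family that is constant in x lets the pointwise calculus also handle
norms, inner products and the scalar cut-off factors. -/
lemma LipL2.lipSup_toL2 {n : ℕ} {F : X → ℝ → E n} (hF : LipL2 F) :
    LipSup fun v (_ : ℝ) => StochWave.toL2 (F v) := by
  obtain ⟨C, hC0, hC⟩ := hF.toL2
  exact ⟨fun v _ => aestronglyMeasurable_const, C, hC0, fun v w hv hw _ => hC v w hv hw⟩

end LipschitzFamilies

/-! ### Convolutions -/

section Convolution

variable {X Y Z : Type*} [NormedAddCommGroup X]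
  [NormedAddCommGroup Y] [NormedSpace ℝ Y] [NormedAddCommGroup Z] [NormedSpace ℝ Z]

lemma integrable_conv {k : ℝ → Y →L[ℝ] Z} (hk : Integrable k volume) {w : ℝ → Y}
    (hw : Continuous w) {M : ℝ} (hM : ∀ x, ‖w x‖ ≤ M) (x : ℝ) :
    Integrable (fun y => k y (w (x - y))) volume := by
  refine (hk.norm.mul_const M).mono' ?_ (ae_of_all _ fun y =>
    ((k y).le_opNorm _).trans (by gcongr; exact hM _))
  have hwc : Continuous fun y => w (x - y) := hw.comp (by fun_prop)
  exact (ContinuousLinearMap.id ℝ (Y →L[ℝ] Z)).aestronglyMeasurable_comp₂ hk.1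
    hwc.aestronglyMeasurable

lemma continuous_conv {k : ℝ → Y →L[ℝ] Z} (hk : Integrable k volume) {w : ℝ → Y}
    (hw : Continuous w) {M : ℝ} (hM : ∀ x, ‖w x‖ ≤ M) :
    Continuous fun x => ∫ y, k y (w (x - y)) :=
  continuous_of_dominated (fun x => (integrable_conv hk hw hM x).1)
    (fun x => ae_of_all _ fun y => ((k y).le_opNorm _).trans
      (mul_le_mul_of_nonneg_left (hM _) (norm_nonneg _))) (hk.norm.mul_const M)
    (ae_of_all _ fun y => (k y).continuous.comp (hw.comp (by fun_prop)))

/-- The difference variable sits in w, so the derivative falls on w while the kernel is merely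
integrable; ‖k‖ M₁ dominates the differentiated integrand. -/
lemma hasDerivAt_conv {k : ℝ → Y →L[ℝ] Z} (hk : Integrable k volume) {w w₁ : ℝ → Y}
    (hd : ∀ x, HasDerivAt w (w₁ x) x) (hw₁ : Continuous w₁) {M : ℝ} (hM : ∀ x, ‖w x‖ ≤ M)
    {M₁ : ℝ} (hM₁ : ∀ x, ‖w₁ x‖ ≤ M₁) (x : ℝ) :
    HasDerivAt (fun x => ∫ y, k y (w (x - y))) (∫ y, k y (w₁ (x - y))) x := by
  have hw : Continuous w := continuous_iff_continuousAt.2 fun x => (hd x).continuousAt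
  refine (hasDerivAt_integral_of_dominated_loc_of_deriv_le (F := fun x y => k y (w (x - y)))
    (F' := fun x y => k y (w₁ (x - y))) (bound := fun y => ‖k y‖ * M₁) univ_mem
    (Eventually.of_forall fun z => (integrable_conv hk hw hM z).1) (integrable_conv hk hw hM x)
    (integrable_conv hk hw₁ hM₁ x).1 (ae_of_all _ fun y z _ => ((k y).le_opNorm _).trans
      (mul_le_mul_of_nonneg_left (hM₁ _) (norm_nonneg _))) (hk.norm.mul_const M₁)
    (ae_of_all _ fun y z _ => ?_)).2
  exact (k y).hasFDerivAt.comp_hasDerivAt z ((hd (z - y)).comp_sub_const z y)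

lemma LipSup.conv {k : ℝ → Y →L[ℝ] Z} (hk : Integrable k volume) {w : X → ℝ → Y}
    (hw : LipSup w) (hc : ∀ v, Continuous (w v)) :
    LipSup fun v x => ∫ y, k y (w v (x - y)) := by
  obtain ⟨hm, C, hC0, hC⟩ := hw
  have key : ∀ (u : ℝ → Y) (s : ℝ) (x : ℝ), (∀ x, ‖u x‖ ≤ s) →
      ‖∫ y, k y (u (x - y))‖ ≤ (∫ y, ‖k y‖) * s := by
    intro u s x hu
    rw [← integral_mul_const]
    exact norm_integral_le_of_norm_le (hk.norm.mul_const s) (ae_of_all _ fun y =>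
      ((k y).le_opNorm _).trans (mul_le_mul_of_nonneg_left (hu _) (norm_nonneg _)))
  refine ⟨fun v hv => (continuous_conv hk (hc v) fun x => (hC v v hv hv x).1).aestronglyMeasurable,
    (∫ y, ‖k y‖) * C, by positivity, fun v w' hv hw x =>
      ⟨key _ _ x fun x => (hC v v hv hv x).1, ?_⟩⟩
  rw [← integral_sub (integrable_conv hk (hc v) (fun x => (hC v v hv hv x).1) x)
    (integrable_conv hk (hc w') (fun x => (hC w' w' hw hw x).1) x)]
  simp only [← map_sub]
  rw [mul_assoc]
  exact key (fun x => w v x - w w' x) _ x fun x => (hC v w' hv hw x).2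

end Convolution

/-! ### Decay of the travelling wave -/

section Decay

variable {n : ℕ}

/-- `diagMul ρ` as a continuous linear map. -/
def diagCLM (ρ : Fin n → ℝ) : E n →L[ℝ] E n :=
  LinearMap.toContinuousLinearMap
    { toFun := diagMul ρ
      map_add' := fun a b => by ext i; simp [diagMul, mul_add]
      map_smul' := fun c a => by ext i; simp [diagMul, mul_left_comm] }

@[simp] lemma diagCLM_apply (ρ : Fin n → ℝ) (w : E n) : diagCLM ρ w = diagMul ρ w := rfl

lemma diagMul_inv_diagMul {ρ : Fin n → ℝ} (hρ : ∀ i, 0 < ρ i) (w : E n) :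
    diagMul (fun i => (ρ i)⁻¹) (diagMul ρ w) = w := by
  ext i; simp [diagMul, inv_mul_cancel_left₀ (hρ i).ne']

/-- Exponential decay at both ends of the real line. -/
def DecaysExp {Y : Type*} [NormedAddCommGroup Y] (u : ℝ → Y) : Prop :=
  (∃ C ν : ℝ, 0 < ν ∧ ∀ x, 0 ≤ x → ‖u x‖ ≤ C * Real.exp (-ν * x)) ∧
    ∃ C ν : ℝ, 0 < ν ∧ ∀ x, x ≤ 0 → ‖u x‖ ≤ C * Real.exp (ν * x)

lemma DecaysExp.memLp {Y : Type*} [NormedAddCommGroup Y] {u : ℝ → Y} (h : DecaysExp u)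
    (hm : AEStronglyMeasurable u volume) : MemLp u 2 volume := by
  obtain ⟨⟨C, ν, hν, hC⟩, ⟨C', ν', hν', hC'⟩⟩ := h
  rw [memLp_two_iff_integrable_sq_norm hm]
  have hm2 : AEStronglyMeasurable (fun x => ‖u x‖ ^ 2) volume := (hm.norm.pow 2)
  rw [← integrableOn_univ, ← Set.Iic_union_Ioi (a := (0 : ℝ))]
  refine IntegrableOn.union ?_ ?_
  · have hi : IntegrableOn (fun x => C' ^ 2 * Real.exp ((2 * ν') * x)) (Set.Iic 0) :=
      (integrableOn_exp_mul_Iic (by positivity) 0).const_mul _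
    refine hi.mono' hm2.restrict ((ae_restrict_mem measurableSet_Iic).mono fun x hx => ?_)
    rw [Real.norm_of_nonneg (by positivity)]
    refine (pow_le_pow_left₀ (norm_nonneg _) (hC' x hx) 2).trans (le_of_eq ?_)
    rw [mul_pow, ← Real.exp_nat_mul]; push_cast; ring_nf
  · have hi : IntegrableOn (fun x => C ^ 2 * Real.exp ((-(2 * ν)) * x)) (Set.Ioi 0) :=
      (integrableOn_exp_mul_Ioi (by linarith) 0).const_mul _
    refine hi.mono' hm2.restrict ((ae_restrict_mem measurableSet_Ioi).mono fun x hx => ?_)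
    rw [Real.norm_of_nonneg (by positivity)]
    refine (pow_le_pow_left₀ (norm_nonneg _) (hC x (le_of_lt hx)) 2).trans (le_of_eq ?_)
    rw [mul_pow, ← Real.exp_nat_mul]; push_cast; ring_nf

lemma DecaysExp.bounded {Y : Type*} [NormedAddCommGroup Y] {u : ℝ → Y} (h : DecaysExp u) :
    ∃ M, ∀ x, ‖u x‖ ≤ M := by
  obtain ⟨⟨C, ν, hν, hC⟩, ⟨C', ν', hν', hC'⟩⟩ := h
  have key : ∀ C t : ℝ, t ≤ 0 → C * Real.exp t ≤ |C| := fun C t ht => by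
    calc C * Real.exp t ≤ |C| * 1 := mul_le_mul (le_abs_self C) (Real.exp_le_one_iff.2 ht)
          (Real.exp_pos t).le (abs_nonneg C)
      _ = |C| := mul_one _
  refine ⟨|C| + |C'|, fun x => ?_⟩
  rcases le_total 0 x with hx | hx
  · linarith [hC x hx, key C (-ν * x) (by nlinarith), abs_nonneg C']
  · linarith [hC' x hx, key C' (ν' * x) (by nlinarith), abs_nonneg C]

/-- The equation has the form P' = -F with P = D Φ' + c (Φ - u₊). Since F is integrable at infinity,
P converges; the limit must be zero because Φ converges; so P(x) is the integral of F over (x, ∞)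
and inherits its rate. Solving for Φ' gives the claim. -/
lemma norm_deriv_le_exp {Y : Type*} [NormedAddCommGroup Y] [NormedSpace ℝ Y] [CompleteSpace Y]
    {Φ Φ₁ Φ₂ F : ℝ → Y} {D : Y →L[ℝ] Y} {κ c C C' ν : ℝ} {up : Y} (hκ : 0 ≤ κ)
    (hD : ∀ w, ‖w‖ ≤ κ * ‖D w‖) (h1 : ∀ x, HasDerivAt Φ (Φ₁ x) x)
    (h2 : ∀ x, HasDerivAt Φ₁ (Φ₂ x) x) (ode : ∀ x, D (Φ₂ x) + c • Φ₁ x + F x = 0)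
    (hFc : Continuous F) (hν : 0 < ν) (hΦ : ∀ x, 0 ≤ x → ‖Φ x - up‖ ≤ C * Real.exp (-ν * x))
    (hF : ∀ x, 0 ≤ x → ‖F x‖ ≤ C' * Real.exp (-ν * x)) :
    ∃ K : ℝ, ∀ x, 0 ≤ x → ‖Φ₁ x‖ ≤ K * Real.exp (-ν * x) := by
  set P : ℝ → Y := fun x => D (Φ₁ x) + c • (Φ x - up) with hP
  have hPd : ∀ x, HasDerivAt P (-F x) x := by
    intro x
    have := (D.hasFDerivAt.comp_hasDerivAt x (h2 x)).add (((h1 x).sub_const up).const_smul c)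
    refine this.congr_deriv ?_
    rw [eq_neg_iff_add_eq_zero]; exact ode x
  have hexp0 : Tendsto (fun x : ℝ => Real.exp (-ν * x)) atTop (𝓝 0) :=
    Real.tendsto_exp_atBot.comp (tendsto_id.const_mul_atTop_of_neg (by linarith))
  have hexpi : ∀ x : ℝ, IntegrableOn (fun y => C' * Real.exp (-ν * y)) (Set.Ioi x) := fun x =>
    (integrableOn_exp_mul_Ioi (by linarith) x).const_mul _
  have hFi : ∀ x : ℝ, 0 ≤ x → IntegrableOn (fun y => -F y) (Set.Ioi x) := fun x hx =>
    (hexpi x).mono' hFc.neg.aestronglyMeasurable.restrict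
      ((ae_restrict_mem measurableSet_Ioi).mono fun y hy => by
        rw [norm_neg]; exact hF y (hx.trans (le_of_lt hy)))
  have hΦ0 : Tendsto (fun x => Φ x - up) atTop (𝓝 0) := by
    refine squeeze_zero_norm' ((eventually_ge_atTop 0).mono hΦ) ?_
    simpa using hexp0.const_mul C
  obtain ⟨A, hA⟩ : ∃ A, Tendsto P atTop (𝓝 A) :=
    ⟨_, tendsto_limUnder_of_hasDerivAt_of_integrableOn_Ioi (fun x _ => hPd x) (hFi 0 le_rfl)⟩
  have hDA : Tendsto (fun x => D (Φ₁ x)) atTop (𝓝 A) := by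
    have := hA.sub (hΦ0.const_smul c)
    simpa [hP] using this
  -- A non-zero limit A of D Φ' would make D Φ change by about A over each unit interval, whereas D
  -- (Φ(x + 1) - Φ(x)) tends to zero.
  have hA0 : A = 0 := by
    have hshift : Tendsto (fun x : ℝ => D (Φ (x + 1) - up) - D (Φ x - up)) atTop (𝓝 0) := by
      have a1 : Tendsto (fun x => D (Φ x - up)) atTop (𝓝 0) := by
        have := (D.continuous.tendsto 0).comp hΦ0
        rwa [map_zero] at this
      simpa using (a1.comp (tendsto_atTop_add_const_right atTop (1 : ℝ) tendsto_id)).sub a1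
    refine norm_le_zero_iff.1 (le_of_forall_pos_le_add fun ε hε => ?_)
    rw [zero_add]
    obtain ⟨x0, hx0⟩ := eventually_atTop.1 (Metric.tendsto_nhds.1 hDA ε hε)
    have hmv : ∀ x, x0 ≤ x → ‖D (Φ (x + 1) - up) - D (Φ x - up) - A‖ ≤ ε := by
      intro x hx
      have hg : ∀ t ∈ Set.Icc x (x + 1),
          HasDerivWithinAt (fun t => D (Φ t) - t • A) (D (Φ₁ t) - A) (Set.Icc x (x + 1)) t := by
        intro t _
        have := (D.hasFDerivAt.comp_hasDerivAt t (h1 t)).sub ((hasDerivAt_id t).smul_const A)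
        rw [one_smul] at this
        exact this.hasDerivWithinAt
      have := (convex_Icc x (x + 1)).norm_image_sub_le_of_norm_hasDerivWithin_le hg
        (C := ε) (fun t ht => by
          rw [← dist_eq_norm]; exact (hx0 t (hx.trans ht.1)).le)
        (Set.left_mem_Icc.2 (by linarith)) (Set.right_mem_Icc.2 (by linarith))
      rw [add_sub_cancel_left, norm_one, mul_one] at this
      convert this using 2
      rw [map_sub, map_sub, add_smul, one_smul]; abel
    have hlim : Tendsto (fun x => ‖D (Φ (x + 1) - up) - D (Φ x - up) - A‖) atTop (𝓝 ‖A‖) := by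
      simpa using (hshift.sub_const A).norm
    exact le_of_tendsto hlim ((eventually_ge_atTop x0).mono hmv)
  refine ⟨κ * (C' / ν + |c| * C), fun x hx => ?_⟩
  have hPx : ‖P x‖ ≤ C' / ν * Real.exp (-ν * x) := by
    have e := integral_Ioi_of_hasDerivAt_of_tendsto' (fun y _ => hPd y) (hFi x hx) (hA0 ▸ hA)
    rw [zero_sub] at e
    rw [← norm_neg, ← e]
    refine (norm_integral_le_of_norm_le (hexpi x) ((ae_restrict_mem measurableSet_Ioi).mono
      fun y hy => by rw [norm_neg]; exact hF y (hx.trans (le_of_lt hy)))).trans (le_of_eq ?_)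
    rw [integral_const_mul, integral_exp_mul_Ioi (by linarith)]
    field_simp
  have h3 : D (Φ₁ x) = P x - c • (Φ x - up) := by simp [hP]
  have h4 : ‖D (Φ₁ x)‖ ≤ C' / ν * Real.exp (-ν * x) + |c| * (C * Real.exp (-ν * x)) := by
    rw [h3]
    refine (norm_sub_le _ _).trans (add_le_add hPx ?_)
    rw [norm_smul, Real.norm_eq_abs]
    exact mul_le_mul_of_nonneg_left (hΦ x hx) (abs_nonneg c)
  calc ‖Φ₁ x‖ ≤ κ * ‖D (Φ₁ x)‖ := hD _
    _ ≤ κ * (C' / ν * Real.exp (-ν * x) + |c| * (C * Real.exp (-ν * x))) := by gcongr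
    _ = κ * (C' / ν + |c| * C) * Real.exp (-ν * x) := by ring

/-- The regularity and the decay of a travelling wave. -/
structure WaveRegularity (Φ₀ : ℝ → E n) (um up : E n) : Prop where
  hasDerivAt : ∀ x, HasDerivAt Φ₀ (deriv Φ₀ x) x
  hasDerivAt_deriv : ∀ x, HasDerivAt (deriv Φ₀) (deriv (deriv Φ₀) x) x
  bounded : ∃ M, ∀ x, ‖Φ₀ x‖ ≤ M
  bounded_deriv : ∃ M, ∀ x, ‖deriv Φ₀ x‖ ≤ M
  memLp_deriv : MemLp (deriv Φ₀) 2 volume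
  memLp_deriv2 : MemLp (deriv (deriv Φ₀)) 2 volume
  exists_deriv3 : ∃ Φ₃, MemLp Φ₃ 2 volume ∧ HasWeakDeriv (deriv (deriv Φ₀)) Φ₃
  memLp_comp : ∀ {Y : Type} [NormedAddCommGroup Y] {φ : E n → Y}, LipOnBalls φ → φ um = 0 →
    φ up = 0 → MemLp (fun x => φ (Φ₀ x)) 2 volume

/-- A locally Lipschitz function that vanishes at both end states decays exponentially along Φ₀,
hence is in L². The derivative Φ₀' decays by the first integral of the equation, Φ₀'' is then in L²
by the equation itself, and differentiating the equation once more produces the third derivative,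
which is not assumed to exist. -/
lemma waveRegularity {ρ : Fin n → ℝ} {f : E n → E n} {um up : E n} {Φ₀ : ℝ → E n} {c₀ : ℝ}
    (hρ : ∀ i, 0 < ρ i) (hf : ContDiff ℝ 1 f) (hfm : f um = 0) (hfp : f up = 0)
    (hΦ : ContDiff ℝ 2 Φ₀)
    (ode : ∀ x, diagMul ρ (deriv (deriv Φ₀) x) + c₀ • deriv Φ₀ x + f (Φ₀ x) = 0)
    (hp : ∃ C ν : ℝ, 0 < ν ∧ ∀ x, 0 ≤ x → ‖Φ₀ x - up‖ ≤ C * Real.exp (-ν * x))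
    (hm : ∃ C ν : ℝ, 0 < ν ∧ ∀ x, x ≤ 0 → ‖Φ₀ x - um‖ ≤ C * Real.exp (ν * x)) :
    WaveRegularity Φ₀ um up := by
  have hΦc : Continuous Φ₀ := hΦ.continuous
  have h1 : ∀ x, HasDerivAt Φ₀ (deriv Φ₀ x) x := fun x =>
    (hΦ.differentiable (by norm_num) x).hasDerivAt
  have hd1 : ContDiff ℝ 1 (deriv Φ₀) := by
    have : ContDiff ℝ (1 + 1) Φ₀ := by simpa [one_add_one_eq_two] using hΦ
    exact (contDiff_succ_iff_deriv.1 this).2.2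
  have h2 : ∀ x, HasDerivAt (deriv Φ₀) (deriv (deriv Φ₀) x) x := fun x =>
    (hd1.differentiable (by norm_num) x).hasDerivAt
  obtain ⟨M, hM⟩ : ∃ M, ∀ x, ‖Φ₀ x‖ ≤ M := by
    obtain ⟨C, ν, hν, hC⟩ := hp
    obtain ⟨C', ν', hν', hC'⟩ := hm
    have key : ∀ C t : ℝ, t ≤ 0 → C * Real.exp t ≤ |C| := fun C t ht => by
      calc C * Real.exp t ≤ |C| * 1 := mul_le_mul (le_abs_self C) (Real.exp_le_one_iff.2 ht)
            (Real.exp_pos t).le (abs_nonneg C)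
        _ = |C| := mul_one _
    refine ⟨‖up‖ + ‖um‖ + |C| + |C'|, fun x => ?_⟩
    rcases le_total 0 x with hx | hx
    · linarith [hC x hx, key C (-ν * x) (by nlinarith), abs_nonneg C', norm_nonneg um,
        norm_le_norm_add_norm_sub' (Φ₀ x) up]
    · linarith [hC' x hx, key C' (ν' * x) (by nlinarith), abs_nonneg C, norm_nonneg up,
        norm_le_norm_add_norm_sub' (Φ₀ x) um]
  have hdec : ∀ {Y : Type} [NormedAddCommGroup Y] {φ : E n → Y}, LipOnBalls φ → φ um = 0 →
      φ up = 0 → DecaysExp fun x => φ (Φ₀ x) := by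
    intro Y _ φ hφ hφm hφp
    obtain ⟨L, hL0, hL⟩ := hφ (max M (max ‖um‖ ‖up‖))
    constructor
    · obtain ⟨C, ν, hν, hC⟩ := hp
      refine ⟨L * C, ν, hν, fun x hx => ?_⟩
      have := hL (Φ₀ x) up ((hM x).trans (le_max_left _ _))
        ((le_max_right _ _).trans (le_max_right _ _))
      rw [hφp, sub_zero] at this
      rw [mul_assoc]
      exact this.trans (mul_le_mul_of_nonneg_left (hC x hx) hL0)
    · obtain ⟨C, ν, hν, hC⟩ := hm
      refine ⟨L * C, ν, hν, fun x hx => ?_⟩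
      have := hL (Φ₀ x) um ((hM x).trans (le_max_left _ _))
        ((le_max_left _ _).trans (le_max_right _ _))
      rw [hφm, sub_zero] at this
      rw [mul_assoc]
      exact this.trans (mul_le_mul_of_nonneg_left (hC x hx) hL0)
  set D := diagCLM ρ with hDdef
  set D' := diagCLM (fun i => (ρ i)⁻¹) with hD'def
  have hD'D : ∀ w, D' (D w) = w := diagMul_inv_diagMul hρ
  have hD : ∀ w, ‖w‖ ≤ ‖D'‖ * ‖D w‖ := fun w => by
    conv_lhs => rw [← hD'D w]
    exact D'.le_opNorm _
  have hfc : Continuous fun x => f (Φ₀ x) := hf.continuous.comp hΦc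
  have hfl := ContDiff.lipOnBalls hf
  have hΦ1 : DecaysExp (deriv Φ₀) := by
    constructor
    · obtain ⟨C, ν, hν, hC⟩ := hp
      obtain ⟨L, hL0, hL⟩ := hfl (max M ‖up‖)
      have hF : ∀ x, 0 ≤ x → ‖f (Φ₀ x)‖ ≤ (L * C) * Real.exp (-ν * x) := fun x hx => by
        have := hL (Φ₀ x) up ((hM x).trans (le_max_left _ _)) (le_max_right _ _)
        rw [hfp, sub_zero] at this
        rw [mul_assoc]
        exact this.trans (mul_le_mul_of_nonneg_left (hC x hx) hL0)
      obtain ⟨K, hK⟩ := norm_deriv_le_exp (norm_nonneg D') hD h1 h2 ode hfc hν hC hF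
      exact ⟨K, ν, hν, hK⟩
    · obtain ⟨C, ν, hν, hC⟩ := hm
      obtain ⟨L, hL0, hL⟩ := hfl (max M ‖um‖)
      have hF : ∀ x, 0 ≤ x → ‖f (Φ₀ (-x))‖ ≤ (L * C) * Real.exp (-ν * x) := fun x hx => by
        have := hL (Φ₀ (-x)) um ((hM _).trans (le_max_left _ _)) (le_max_right _ _)
        rw [hfm, sub_zero] at this
        have h3 := hC (-x) (by linarith)
        rw [mul_assoc]
        refine this.trans (mul_le_mul_of_nonneg_left (h3.trans (le_of_eq ?_)) hL0)
        ring_nf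
      have hC2 : ∀ x, 0 ≤ x → ‖Φ₀ (-x) - um‖ ≤ C * Real.exp (-ν * x) := fun x hx =>
        (hC (-x) (by linarith)).trans (le_of_eq (by ring_nf))
      -- The left end is reduced to the right end by x ↦ -x, which keeps the second derivative and
      -- reverses the sign of the speed.
      have h1' : ∀ x, HasDerivAt (fun x => Φ₀ (-x)) (-deriv Φ₀ (-x)) x := fun x => by
        have := (h1 (-x)).scomp x (hasDerivAt_neg x)
        rwa [neg_one_smul] at this
      have h2' : ∀ x, HasDerivAt (fun x => -deriv Φ₀ (-x)) (deriv (deriv Φ₀) (-x)) x := fun x => by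
        have := ((h2 (-x)).scomp x (hasDerivAt_neg x)).neg
        rwa [neg_one_smul, neg_neg] at this
      obtain ⟨K, hK⟩ := norm_deriv_le_exp (norm_nonneg D') hD h1' h2' (c := -c₀)
        (F := fun x => f (Φ₀ (-x))) (fun x => by rw [neg_smul_neg]; exact ode (-x))
        (hfc.comp continuous_neg) hν hC2 hF
      refine ⟨K, ν, hν, fun x hx => ?_⟩
      have := hK (-x) (by linarith)
      simpa using this
  have hL1 : MemLp (deriv Φ₀) 2 volume := hΦ1.memLp hd1.continuous.aestronglyMeasurable
  have hcomp : ∀ {Y : Type} [NormedAddCommGroup Y] {φ : E n → Y}, LipOnBalls φ → φ um = 0 →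
      φ up = 0 → MemLp (fun x => φ (Φ₀ x)) 2 volume := fun hφ hφm hφp =>
    (hdec hφ hφm hφp).memLp (hφ.continuous.comp hΦc).aestronglyMeasurable
  have hode2 : deriv (deriv Φ₀) = fun x => D' (-(c₀ • deriv Φ₀ x + f (Φ₀ x))) := by
    funext x
    conv_lhs => rw [← hD'D (deriv (deriv Φ₀) x)]
    congr 1
    rw [eq_neg_iff_add_eq_zero, ← add_assoc]
    exact ode x
  have hL2 : MemLp (deriv (deriv Φ₀)) 2 volume := by
    rw [hode2]
    exact D'.comp_memLp' ((hL1.const_smul c₀).add (hcomp hfl hfm hfp)).neg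
  refine ⟨h1, h2, ⟨M, hM⟩, hΦ1.bounded, hL1, hL2,
    ⟨fun x => D' (-(c₀ • deriv (deriv Φ₀) x + fderiv ℝ f (Φ₀ x) (deriv Φ₀ x))), ?_, ?_⟩, hcomp⟩
  · obtain ⟨C, hC⟩ := ((ProperSpace.isCompact_closedBall (0 : E n) M).image
      (hf.continuous_fderiv (by norm_num))).isBounded.exists_norm_le
    refine D'.comp_memLp' ((hL2.const_smul c₀).add ?_).neg
    refine hL1.of_le_mul (c := C) ?_ (ae_of_all _ fun x => ?_)
    · exact (((hf.continuous_fderiv (by norm_num)).comp hΦc).clm_apply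
        hd1.continuous).aestronglyMeasurable
    · exact ((fderiv ℝ f (Φ₀ x)).le_opNorm _).trans (mul_le_mul_of_nonneg_right
        (hC _ ⟨Φ₀ x, by simpa using hM x, rfl⟩) (norm_nonneg _))
  · have hd : ∀ x, HasDerivAt (deriv (deriv Φ₀))
        (D' (-(c₀ • deriv (deriv Φ₀) x + fderiv ℝ f (Φ₀ x) (deriv Φ₀ x)))) x := by
      intro x
      have h3 : HasDerivAt (fun x => f (Φ₀ x)) (fderiv ℝ f (Φ₀ x) (deriv Φ₀ x)) x :=
        (hf.differentiable (by norm_num) _).hasFDerivAt.comp_hasDerivAt x (h1 x)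
      have := D'.hasFDerivAt.comp_hasDerivAt x (((h2 x).const_smul c₀).add h3).neg
      rw [hode2] at *
      exact this
    refine hasWeakDeriv_of_hasDerivAt hd (Continuous.locallyIntegrable ?_)
    have hc2 : Continuous (deriv (deriv Φ₀)) := by
      rw [hode2]
      exact D'.continuous.comp (((hd1.continuous.const_smul c₀).add hfc).neg)
    exact D'.continuous.comp (((hc2.const_smul c₀).add
      (((hf.continuous_fderiv (by norm_num)).comp hΦc).clm_apply hd1.continuous)).neg)

end Decay

/-! ### The linearisation on real functions -/

section Linearisation

variable {n : ℕ}

/-- The inclusion of `ℝⁿ` into `ℂⁿ`. -/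
def ofRealCLM (n : ℕ) : E n →L[ℝ] EC n :=
  LinearMap.toContinuousLinearMap
    { toFun := fun w => WithLp.toLp 2 fun i => (w i : ℂ)
      map_add' := fun a b => by ext i; simp
      map_smul' := fun c a => by ext i; simp }

/-- The real part of a vector in `ℂⁿ`. -/
def rePartCLM (n : ℕ) : EC n →L[ℝ] E n :=
  LinearMap.toContinuousLinearMap
    { toFun := fun z => WithLp.toLp 2 fun i => (z i).re
      map_add' := fun a b => by ext i; simp
      map_smul' := fun c a => by ext i; simp }

/-- Multiplication by a complex number as a real-linear map. -/
def mulComplexCLM (n : ℕ) (c : ℂ) : EC n →L[ℝ] EC n :=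
  (c • ContinuousLinearMap.id ℂ (EC n)).restrictScalars ℝ

@[simp] lemma ofRealCLM_coord (w : E n) (i : Fin n) : ofRealCLM n w i = (w i : ℂ) := rfl

@[simp] lemma rePartCLM_coord (z : EC n) (i : Fin n) : rePartCLM n z i = (z i).re := rfl

@[simp] lemma mulComplexCLM_apply (c : ℂ) (z : EC n) : mulComplexCLM n c z = c • z := rfl

@[simp] lemma rePart_ofReal (w : E n) : rePartCLM n (ofRealCLM n w) = w := by
  ext i; simp

lemma rePart_smul_ofReal (c : ℂ) (w : E n) : rePartCLM n (c • ofRealCLM n w) = c.re • w := by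
  ext i; simp

lemma complexify_ofReal (A : E n →L[ℝ] E n) (w : E n) :
    complexify A (ofRealCLM n w) = ofRealCLM n (A w) := by
  have h1 : (WithLp.toLp 2 fun j => (ofRealCLM n w j).re : E n) = w := by ext j; simp
  have h2 : (WithLp.toLp 2 fun j => (ofRealCLM n w j).im : E n) = 0 := by ext j; simp
  ext i
  simp only [complexify, h1, h2, map_zero]
  simp

lemma rePart_complexify (A : E n →L[ℝ] E n) (z : EC n) :
    rePartCLM n (complexify A z) = A (rePartCLM n z) := by
  have h1 : (WithLp.toLp 2 fun j => (z j).re : E n) = rePartCLM n z := rfl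
  ext i
  simp [complexify, h1]

lemma complexify_smul (A : E n →L[ℝ] E n) (c : ℂ) (z : EC n) :
    complexify A (c • z) = c • complexify A z := by
  have h1 : (WithLp.toLp 2 fun j => ((c • z) j).re : E n)
      = c.re • (WithLp.toLp 2 fun j => (z j).re) - c.im • (WithLp.toLp 2 fun j => (z j).im) := by
    ext j; simp
  have h2 : (WithLp.toLp 2 fun j => ((c • z) j).im : E n)
      = c.re • (WithLp.toLp 2 fun j => (z j).im) + c.im • (WithLp.toLp 2 fun j => (z j).re) := by
    ext j; simp
  ext i
  simp only [complexify, h1, h2, map_sub, map_add, map_smul]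
  apply Complex.ext <;> simp

lemma diagMul_ofReal (ρ : Fin n → ℝ) (w : E n) :
    diagMul ρ (ofRealCLM n w) = ofRealCLM n (diagMul ρ w) := by
  ext i; simp [diagMul]

lemma rePart_diagMul (ρ : Fin n → ℝ) (z : EC n) :
    rePartCLM n (diagMul ρ z) = diagMul ρ (rePartCLM n z) := by
  ext i; simp [diagMul]

lemma diagMul_smul (ρ : Fin n → ℝ) (c : ℂ) (z : EC n) :
    diagMul ρ (c • z) = c • diagMul ρ z := by
  ext i; simp [diagMul, mul_left_comm]

lemma MemH2.clm {F G : Type*} [NormedAddCommGroup F] [NormedSpace ℝ F] [CompleteSpace F]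
    [NormedAddCommGroup G] [NormedSpace ℝ G] [CompleteSpace G] {u : ℝ → F} (hu : MemH2 u)
    (A : F →L[ℝ] G) : MemH2 fun x => A (u x) := by
  obtain ⟨h0, u₁, u₂, h1, h2, hw1, hw2⟩ := hu
  exact ⟨A.comp_memLp' h0, _, _, A.comp_memLp' h1, A.comp_memLp' h2, hw1.clm A, hw2.clm A⟩

variable (ρ : Fin n → ℝ) (f : E n → E n) (Φ₀ : ℝ → E n) (c₀ : ℝ)

lemma linTw_ae_eq {v v₁ v₂ : ℝ → EC n} (h1 : HasWeakDeriv v v₁) (h2 : HasWeakDeriv v₁ v₂) :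
    linTw ρ f Φ₀ c₀ v =ᵐ[volume] fun x =>
      diagMul ρ (v₂ x) + (c₀ : ℂ) • v₁ x + complexify (fderiv ℝ f (Φ₀ x)) (v x) := by
  filter_upwards [h1.weakDeriv_ae_eq, h1.weakDeriv_weakDeriv_ae_eq h2] with x hx1 hx2
  rw [linTw, hx1, hx2]

lemma linTw_smul {v : ℝ → EC n} (hv : MemH2 v) (c : ℂ) :
    linTw ρ f Φ₀ c₀ (fun x => c • v x) =ᵐ[volume] fun x => c • linTw ρ f Φ₀ c₀ v x := by
  obtain ⟨-, v₁, v₂, -, -, h1, h2⟩ := hv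
  have h1' := h1.clm (mulComplexCLM n c)
  have h2' := h2.clm (mulComplexCLM n c)
  filter_upwards [linTw_ae_eq ρ f Φ₀ c₀ h1 h2, linTw_ae_eq ρ f Φ₀ c₀ h1' h2'] with x hx hx'
  simp only [mulComplexCLM_apply] at hx'
  rw [hx, hx', diagMul_smul, complexify_smul, smul_add, smul_add, smul_comm c]

variable {ρ f Φ₀ c₀}

lemma memLp_mulOp {A : ℝ → E n →L[ℝ] E n} (hA : Continuous A) (hM : ∃ M, ∀ x, ‖A x‖ ≤ M)
    (u : L2 n) : MemLp (fun x => A x (u x)) 2 volume := by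
  obtain ⟨M, hM⟩ := hM
  refine (Lp.memLp u).of_le_mul (c := M) ?_ (ae_of_all _ fun x =>
    ((A x).le_opNorm _).trans (mul_le_mul_of_nonneg_right (hM x) (norm_nonneg _)))
  exact (ContinuousLinearMap.id ℝ (E n →L[ℝ] E n)).aestronglyMeasurable_comp₂
    hA.aestronglyMeasurable (Lp.aestronglyMeasurable u)

/-- Multiplication by a bounded continuous matrix-valued function. -/
def mulOp (A : ℝ → E n →L[ℝ] E n) (hA : Continuous A) (hM : ∃ M, ∀ x, ‖A x‖ ≤ M) :
    L2 n →L[ℝ] L2 n :=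
  have hmem := memLp_mulOp hA hM
  LinearMap.mkContinuousOfExistsBound
    { toFun := fun u => (hmem u).toLp _
      map_add' := fun u w => by
        refine Lp.ext ?_
        filter_upwards [(hmem u).coeFn_toLp, (hmem w).coeFn_toLp, (hmem (u + w)).coeFn_toLp,
          Lp.coeFn_add u w, Lp.coeFn_add ((hmem u).toLp _) ((hmem w).toLp _)] with x h1 h2 h3 h4 h5
        rw [h3, h5, Pi.add_apply, h1, h2, h4, Pi.add_apply, map_add]
      map_smul' := fun c u => by
        refine Lp.ext ?_
        filter_upwards [(hmem u).coeFn_toLp, (hmem (c • u)).coeFn_toLp,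
          Lp.coeFn_smul c u, Lp.coeFn_smul c ((hmem u).toLp _)] with x h1 h3 h4 h5
        rw [h3, RingHom.id_apply, h5, Pi.smul_apply, h1, h4, Pi.smul_apply, map_smul] }
    (by
      obtain ⟨M, hM⟩ := hM
      refine ⟨M, fun u => ?_⟩
      refine Lp.norm_le_mul_norm_of_ae_le_mul ?_
      filter_upwards [(hmem u).coeFn_toLp] with x hx
      simp only [LinearMap.coe_mk, AddHom.coe_mk]
      rw [hx]
      exact ((A x).le_opNorm _).trans (mul_le_mul_of_nonneg_right (hM x) (norm_nonneg _)))

lemma mulOp_ae_eq (A : ℝ → E n →L[ℝ] E n) (hA : Continuous A) (hM : ∃ M, ∀ x, ‖A x‖ ≤ M)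
    (u : L2 n) : mulOp A hA hM u =ᵐ[volume] fun x => A x (u x) :=
  (memLp_mulOp hA hM u).coeFn_toLp

/-- The linearisation `L_tw` from the real space `H²` to `L²`. -/
def linOp (ρ : Fin n → ℝ) (c₀ : ℝ) (A : ℝ → E n →L[ℝ] E n) (hA : Continuous A)
    (hM : ∃ M, ∀ x, ‖A x‖ ≤ M) : sobolev n →L[ℝ] L2 n :=
  ((diagCLM ρ).compLpL 2 volume).comp sobolev.d2 + c₀ • sobolev.d1
    + (mulOp A hA hM).comp sobolev.incl

lemma linOp_ae_eq (A : ℝ → E n →L[ℝ] E n) (hA : Continuous A) (hM : ∃ M, ∀ x, ‖A x‖ ≤ M)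
    (v : sobolev n) : linOp ρ c₀ A hA hM v =ᵐ[volume] fun x =>
      diagMul ρ (sobolev.d2 v x) + c₀ • sobolev.d1 v x + A x (sobolev.incl v x) := by
  have e : linOp ρ c₀ A hA hM v = (diagCLM ρ).compLpL 2 volume (sobolev.d2 v)
      + c₀ • sobolev.d1 v + mulOp A hA hM (sobolev.incl v) := rfl
  rw [e]
  filter_upwards [Lp.coeFn_add ((diagCLM ρ).compLpL 2 volume (sobolev.d2 v) + c₀ • sobolev.d1 v)
    (mulOp A hA hM (sobolev.incl v)),
    Lp.coeFn_add ((diagCLM ρ).compLpL 2 volume (sobolev.d2 v)) (c₀ • sobolev.d1 v),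
    Lp.coeFn_smul c₀ (sobolev.d1 v), (diagCLM ρ).coeFn_compLp (sobolev.d2 v),
    mulOp_ae_eq A hA hM (sobolev.incl v)] with x h1 h2 h3 h4 h5
  rw [h1, Pi.add_apply, h2, Pi.add_apply, h3, h5, Pi.smul_apply]
  congr 2

variable (hA : Continuous fun x => fderiv ℝ f (Φ₀ x)) (hM : ∃ M, ∀ x, ‖fderiv ℝ f (Φ₀ x)‖ ≤ M)

lemma linTw_ofReal (v : sobolev n) :
    linTw ρ f Φ₀ c₀ (fun x => ofRealCLM n (sobolev.incl v x))
      =ᵐ[volume] fun x => ofRealCLM n (linOp ρ c₀ _ hA hM v x) := by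
  filter_upwards [linTw_ae_eq ρ f Φ₀ c₀ ((sobolev.hasWeakDeriv_incl v).clm (ofRealCLM n))
    ((sobolev.hasWeakDeriv_d1 v).clm (ofRealCLM n)), linOp_ae_eq (ρ := ρ) (c₀ := c₀) _ hA hM v]
    with x h1 h2
  rw [h1, h2, map_add, map_add, diagMul_ofReal, complexify_ofReal, map_smul, Complex.coe_smul]

/-- The coefficients of L are real, so taking real parts commutes with L; complex solutions thereby
yield real ones. -/
lemma exists_rePart_linTw {w : ℝ → EC n} (hw : MemH2 w) : ∃ v : sobolev n,
    (∀ᵐ x, rePartCLM n (w x) = sobolev.incl v x) ∧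
      ∀ᵐ x, rePartCLM n (linTw ρ f Φ₀ c₀ w x) = linOp ρ c₀ _ hA hM v x := by
  obtain ⟨h0, w₁, w₂, h1, h2, hw1, hw2⟩ := hw
  set R := rePartCLM n
  have m0 := R.comp_memLp' h0
  have m1 := R.comp_memLp' h1
  have m2 := R.comp_memLp' h2
  refine ⟨sobolev.mk m0 m1 m2 (hw1.clm R) (hw2.clm R), m0.coeFn_toLp.symm, ?_⟩
  filter_upwards [linTw_ae_eq ρ f Φ₀ c₀ hw1 hw2, linOp_ae_eq (ρ := ρ) (c₀ := c₀) _ hA hM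
    (sobolev.mk m0 m1 m2 (hw1.clm R) (hw2.clm R)), m0.coeFn_toLp, m1.coeFn_toLp, m2.coeFn_toLp]
    with x e1 e2 e3 e4 e5
  have e3' : sobolev.incl (sobolev.mk m0 m1 m2 (hw1.clm R) (hw2.clm R)) x = R (w x) := e3
  have e4' : sobolev.d1 (sobolev.mk m0 m1 m2 (hw1.clm R) (hw2.clm R)) x = R (w₁ x) := e4
  have e5' : sobolev.d2 (sobolev.mk m0 m1 m2 (hw1.clm R) (hw2.clm R)) x = R (w₂ x) := e5
  rw [e1, e2, e3', e4', e5', map_add, map_add, rePart_diagMul, rePart_complexify,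
    Complex.coe_smul, map_smul]

/-- If zero is a simple eigenvalue of `L_tw` and `φ₀` is a non-zero real element of the kernel, then
the kernel is spanned by `φ₀`, and `L²` is the direct sum of the range and the span of `φ₀`. -/
lemma SimpleZeroEigenvalue.real (h : SimpleZeroEigenvalue ρ f Φ₀ c₀) {φ₀ : sobolev n}
    (hφ₀ : linOp ρ c₀ _ hA hM φ₀ = 0) (hne : φ₀ ≠ 0) :
    (∀ v, linOp ρ c₀ _ hA hM v = 0 → ∃ a : ℝ, v = a • φ₀) ∧
    (∀ r : L2 n, ∃ (a : ℝ) (v : sobolev n), r = a • sobolev.incl φ₀ + linOp ρ c₀ _ hA hM v) ∧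
    ∀ (v : sobolev n) (a : ℝ), linOp ρ c₀ _ hA hM v + a • sobolev.incl φ₀ = 0 → a = 0 := by
  obtain ⟨φ, hφ, hφne, hφker, huniq, hrange, hsum⟩ := h
  have hH2 : ∀ v : sobolev n, MemH2 fun x => ofRealCLM n (sobolev.incl v x) := fun v =>
    (sobolev.memH2 (ae_eq_refl _) : MemH2 (sobolev.incl v)).clm (ofRealCLM n)
  have hz : ∀ v, linOp ρ c₀ _ hA hM v = 0 →
      ∀ᵐ x, linTw ρ f Φ₀ c₀ (fun x => ofRealCLM n (sobolev.incl v x)) x = 0 := by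
    intro v hv
    filter_upwards [linTw_ofReal (ρ := ρ) (c₀ := c₀) hA hM v,
      Lp.coeFn_zero (E n) 2 (volume : Measure ℝ)] with x h1 h2
    rw [h1, hv, h2, Pi.zero_apply, map_zero]
  -- The given complex eigenfunction φ is a complex multiple of the real φ₀. All statements about φ
  -- are rescaled by a⁻¹ and then reduced to real parts.
  obtain ⟨a, ha⟩ := huniq _ (hH2 φ₀) (hz φ₀ hφ₀)
  have ha0 : a ≠ 0 := by
    rintro rfl
    refine hne (sobolev.ext_incl ?_)
    filter_upwards [ha, Lp.coeFn_zero (E n) 2 (volume : Measure ℝ)] with x hx h0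
    rw [zero_smul] at hx
    rw [map_zero, h0, Pi.zero_apply, ← rePart_ofReal (sobolev.incl φ₀ x), hx, map_zero]
  have hφa : ∀ᵐ x, φ x = a⁻¹ • ofRealCLM n (sobolev.incl φ₀ x) := by
    filter_upwards [ha] with x hx
    rw [hx, inv_smul_smul₀ ha0]
  refine ⟨fun v hv => ?_, fun r => ?_, fun v γ hv => ?_⟩
  · obtain ⟨b, hb⟩ := huniq _ (hH2 v) (hz v hv)
    refine ⟨(b * a⁻¹).re, sobolev.ext_incl ?_⟩
    rw [map_smul]
    filter_upwards [hb, hφa, Lp.coeFn_smul (b * a⁻¹).re (sobolev.incl φ₀)] with x h1 h2 h3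
    rw [h3, Pi.smul_apply, ← rePart_ofReal (sobolev.incl v x), h1, h2, smul_smul,
      rePart_smul_ofReal]
  · obtain ⟨b, w, hw, hr⟩ := hsum (fun x => ofRealCLM n (r x))
      ((ofRealCLM n).comp_memLp' (Lp.memLp r))
    obtain ⟨v, -, hv⟩ := exists_rePart_linTw (ρ := ρ) (c₀ := c₀) hA hM hw
    refine ⟨(b * a⁻¹).re, v, Lp.ext ?_⟩
    filter_upwards [hr, hv, hφa, Lp.coeFn_smul (b * a⁻¹).re (sobolev.incl φ₀),
      Lp.coeFn_add ((b * a⁻¹).re • sobolev.incl φ₀) (linOp ρ c₀ _ hA hM v)] with x h1 h2 h3 h4 h5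
    rw [h5, Pi.add_apply, h4, Pi.smul_apply, ← rePart_ofReal (r x), h1, h3, map_add, smul_smul,
      rePart_smul_ofReal, h2]
  · by_contra hγ
    -- This factor turns L v = -γ φ₀ into L (c v) = φ, which would put the eigenfunction into the
    -- range of L.
    set c : ℂ := -((γ : ℂ)⁻¹) * a⁻¹ with hc
    refine hrange (fun x => c • ofRealCLM n (sobolev.incl v x))
      ((hH2 v).clm (mulComplexCLM n c)) ?_
    have hv' : linOp ρ c₀ _ hA hM v = (-γ) • sobolev.incl φ₀ := by
      rw [neg_smul]; exact eq_neg_of_add_eq_zero_left hv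
    filter_upwards [linTw_smul ρ f Φ₀ c₀ (hH2 v) c, linTw_ofReal (ρ := ρ) (c₀ := c₀) hA hM v, hφa,
      Lp.coeFn_smul (-γ) (sobolev.incl φ₀)] with x h1 h2 h3 h4
    rw [h1, h2, hv', h4, Pi.smul_apply, h3, map_smul, ← Complex.coe_smul, smul_smul]
    congr 1
    have : (γ : ℂ) ≠ 0 := Complex.ofReal_ne_zero.2 hγ
    rw [hc]; push_cast; field_simp

/-- The element `Φ₀'` of `H²` spans the kernel of `L_tw`. -/
lemma exists_derivWave {um up : E n} (hW : WaveRegularity Φ₀ um up) (hf : ContDiff ℝ 1 f)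
    (ode : ∀ x, diagMul ρ (deriv (deriv Φ₀) x) + c₀ • deriv Φ₀ x + f (Φ₀ x) = 0) :
    ∃ φ₀ : sobolev n, sobolev.incl φ₀ =ᵐ[volume] deriv Φ₀ ∧ linOp ρ c₀ _ hA hM φ₀ = 0 := by
  obtain ⟨Φ₃, hm3, hw3⟩ := hW.exists_deriv3
  have hw2 : HasWeakDeriv (deriv Φ₀) (deriv (deriv Φ₀)) :=
    hasWeakDeriv_of_hasDerivAt hW.hasDerivAt_deriv (hW.memLp_deriv2.locallyIntegrable (by norm_num))
  have hwf : HasWeakDeriv (fun x => f (Φ₀ x)) (fun x => fderiv ℝ f (Φ₀ x) (deriv Φ₀ x)) := by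
    refine hasWeakDeriv_of_hasDerivAt (fun x =>
      (hf.differentiable (by norm_num) _).hasFDerivAt.comp_hasDerivAt x (hW.hasDerivAt x)) ?_
    have : Continuous (deriv Φ₀) :=
      continuous_iff_continuousAt.2 fun x => (hW.hasDerivAt_deriv x).continuousAt
    exact (hA.clm_apply this).locallyIntegrable
  -- The left side of the wave equation is identically zero, so its weak derivative, which is L Φ₀',
  -- vanishes.
  have h0 := ((hw3.clm (diagCLM ρ)).add (hw2.const_smul c₀)).add hwf
  have h0' : HasWeakDeriv (fun _ : ℝ => (0 : E n)) fun _ => 0 :=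
    hasWeakDeriv_of_hasDerivAt (fun x => hasDerivAt_const x 0) continuous_const.locallyIntegrable
  have hode := (h0.congr (ae_of_all _ ode) (ae_eq_refl _)).unique h0'
  refine ⟨sobolev.mk hW.memLp_deriv hW.memLp_deriv2 hm3 hw2 hw3, hW.memLp_deriv.coeFn_toLp,
    Lp.ext ?_⟩
  filter_upwards [linOp_ae_eq (ρ := ρ) (c₀ := c₀) _ hA hM
    (sobolev.mk hW.memLp_deriv hW.memLp_deriv2 hm3 hw2 hw3), hode, hW.memLp_deriv.coeFn_toLp,
    hW.memLp_deriv2.coeFn_toLp, hm3.coeFn_toLp, Lp.coeFn_zero (E n) 2 (volume : Measure ℝ)]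
    with x e1 e2 e3 e4 e5 e6
  rw [e1, e6, Pi.zero_apply, ← e2]
  have e3' : sobolev.incl (sobolev.mk hW.memLp_deriv hW.memLp_deriv2 hm3 hw2 hw3) x
    = deriv Φ₀ x := e3
  have e4' : sobolev.d1 (sobolev.mk hW.memLp_deriv hW.memLp_deriv2 hm3 hw2 hw3) x
    = deriv (deriv Φ₀) x := e4
  have e5' : sobolev.d2 (sobolev.mk hW.memLp_deriv hW.memLp_deriv2 hm3 hw2 hw3) x
    = Φ₃ x := e5
  rw [e3', e4', e5', diagCLM_apply]

end Linearisation

/-! ### The bordered operator and the fixed point argument -/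

section FixedPoint

variable {X Z : Type*} [NormedAddCommGroup X] [NormedSpace ℝ X] [CompleteSpace X]
  [NormedAddCommGroup Z] [NormedSpace ℝ Z]

/-- The bounded inverse of `(v, γ) ↦ L v + γ p` on the space where a functional vanishes. -/
lemma exists_bordered_inverse [CompleteSpace Z] (L : X →L[ℝ] Z) (p : Z) (l : X →L[ℝ] ℝ) {φ₀ : X} (hφ₀ : L φ₀ = 0)
    (hl : l φ₀ = 1) (hker : ∀ v, L v = 0 → ∃ a : ℝ, v = a • φ₀)
    (hsurj : ∀ r : Z, ∃ (a : ℝ) (v : X), r = a • p + L v)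
    (hinj : ∀ (v : X) (a : ℝ), L v + a • p = 0 → a = 0) :
    ∃ T : Z →L[ℝ] X × ℝ, (∀ z, L (T z).1 + (T z).2 • p = z) ∧ (∀ z, l (T z).1 = 0) ∧
      ∀ y : X × ℝ, l y.1 = 0 → T (L y.1 + y.2 • p) = y := by
  set K : Submodule ℝ (X × ℝ) := LinearMap.ker (l.comp (ContinuousLinearMap.fst ℝ X ℝ)).toLinearMap
    with hK
  have hmem : ∀ y : X × ℝ, y ∈ K ↔ l y.1 = 0 := fun y => by simp [hK]
  have hKc : IsClosed (K : Set (X × ℝ)) :=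
    (l.comp (ContinuousLinearMap.fst ℝ X ℝ)).isClosed_ker
  have : CompleteSpace K := hKc.completeSpace_coe
  set S : X × ℝ →L[ℝ] Z := L.comp (ContinuousLinearMap.fst ℝ X ℝ)
    + (ContinuousLinearMap.snd ℝ X ℝ).smulRight p with hS
  have hSa : ∀ y : X × ℝ, S y = L y.1 + y.2 • p := fun y => by simp [hS]
  set S₀ : K →L[ℝ] Z := S.comp K.subtypeL with hS0
  have hS0a : ∀ y : K, S₀ y = L (y : X × ℝ).1 + (y : X × ℝ).2 • p := fun y => hSa y
  -- The direct sum forces the scalar to vanish; then v = a φ₀, and l v = 0 with l φ₀ = 1 forces a =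
  -- 0.
  have hbot : LinearMap.ker S₀.toLinearMap = ⊥ := by
    rw [LinearMap.ker_eq_bot']
    intro y hy
    have hy' : L (y : X × ℝ).1 + (y : X × ℝ).2 • p = 0 := (hS0a y).symm.trans hy
    have h2 := hinj _ _ hy'
    rw [h2, zero_smul, add_zero] at hy'
    obtain ⟨a, ha⟩ := hker _ hy'
    have h3 := (hmem y).1 y.2
    rw [ha, map_smul, hl, smul_eq_mul, mul_one] at h3
    rw [h3, zero_smul] at ha
    exact Subtype.ext (Prod.ext ha h2)
  have htop : LinearMap.range S₀.toLinearMap = ⊤ := by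
    rw [LinearMap.range_eq_top]
    intro r
    obtain ⟨a, v, hr⟩ := hsurj r
    -- Subtracting a multiple of the kernel element corrects the phase without changing L v.
    refine ⟨⟨(v - l v • φ₀, a), (hmem _).2 ?_⟩, ?_⟩
    · simp [hl]
    · refine (hS0a _).trans ?_
      simp only [map_sub, map_smul, hφ₀, smul_zero, sub_zero]
      rw [hr, add_comm]
  set e := ContinuousLinearEquiv.ofBijective S₀ hbot htop with he
  have hes : ∀ z, S₀ (e.symm z) = z := fun z =>
    ContinuousLinearEquiv.ofBijective_apply_symm_apply S₀ hbot htop z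
  refine ⟨K.subtypeL.comp (e.symm : Z →L[ℝ] K), fun z => ?_, fun z => ?_, fun y hy => ?_⟩
  · exact (hS0a (e.symm z)).symm.trans (hes z)
  · exact (hmem _).1 (e.symm z).2
  · have h1 : S₀ ⟨y, (hmem y).2 hy⟩ = L y.1 + y.2 • p := hS0a _
    have h2 : e.symm (S₀ ⟨y, (hmem y).2 hy⟩) = ⟨y, (hmem y).2 hy⟩ :=
      ContinuousLinearEquiv.ofBijective_symm_apply_apply S₀ hbot htop _
    rw [← h1]
    exact congrArg Subtype.val h2

/-- Solutions of `S y + G_σ(y) = 0` near zero for small `σ`, where `T` is an inverse of `S` on a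
complement of the kernel and `G_σ` is a small Lipschitz perturbation. -/
lemma exists_fixedPoint {Y : Type*} [NormedAddCommGroup Y] [NormedSpace ℝ Y] [CompleteSpace Y]
    (T : Z →L[ℝ] Y) (G : ℝ → Y → Z) {C : ℝ} (hC0 : 0 ≤ C)
    (hG0 : ∀ σ, 0 ≤ σ → σ ≤ 1 → ‖G σ 0‖ ≤ C * σ ^ 2)
    (hG : ∀ σ, 0 ≤ σ → σ ≤ 1 → ∀ r : ℝ, r ≤ 1 → ∀ y z, ‖y‖ ≤ r → ‖z‖ ≤ r →
      ‖G σ y - G σ z‖ ≤ C * (r + σ ^ 2) * ‖y - z‖) :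
    ∃ K₀ : ℝ, 0 < K₀ ∧ ∀ K, K₀ ≤ K → ∃ δ : ℝ, 0 < δ ∧ δ ≤ 1 ∧ ∀ σ, 0 ≤ σ → σ ≤ δ →
      K * σ ^ 2 ≤ 1 ∧
      (∃ y, ‖y‖ ≤ K / 4 * σ ^ 2 ∧ y = T (-G σ y)) ∧
      ∀ y z, ‖y‖ ≤ K * σ ^ 2 → ‖z‖ ≤ K * σ ^ 2 → y - z = T (-(G σ y - G σ z)) → y = z := by
  -- With this K₀, ‖T G_σ(0)‖ ≤ Kσ²/8, half of the radius Kσ²/4 of the invariant ball; contraction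
  -- by 1/2 uses the other half.
  refine ⟨8 * (‖T‖ * C) + 1, by positivity, fun K hK => ?_⟩
  have hTC : 0 ≤ ‖T‖ * C := by positivity
  have hK1 : 1 ≤ K := by linarith
  -- Since σ² ≤ σ ≤ δ, this gives both Kσ² ≤ 1 and ‖T‖ C (K + 1) σ² ≤ 1/2, the contraction factor on
  -- the ball of radius Kσ².
  set δ : ℝ := min 1 (1 / (2 * ((‖T‖ * C + 1) * (K + 1)))) with hδ
  have hδ0 : 0 < δ := lt_min one_pos (by positivity)
  refine ⟨δ, hδ0, min_le_left _ _, fun σ hσ hσδ => ?_⟩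
  have hσ1 : σ ≤ 1 := hσδ.trans (min_le_left _ _)
  have hσ2 : σ ^ 2 ≤ 1 / (2 * ((‖T‖ * C + 1) * (K + 1))) :=
    (by nlinarith : σ ^ 2 ≤ σ).trans (hσδ.trans (min_le_right _ _))
  have hσ2' : σ ^ 2 * (2 * ((‖T‖ * C + 1) * (K + 1))) ≤ 1 := by
    rwa [le_div_iff₀ (by positivity)] at hσ2
  have hs0 : 0 ≤ σ ^ 2 := sq_nonneg σ
  have hKσ : K * σ ^ 2 ≤ 1 := by
    have h1 : 0 ≤ σ ^ 2 * (‖T‖ * C * (K + 1)) := by positivity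
    nlinarith
  have hsmall : ‖T‖ * C * (K * σ ^ 2 + σ ^ 2) ≤ 1 / 2 := by
    have h1 : 0 ≤ σ ^ 2 * (K + 1) := by positivity
    nlinarith
  have hcontr : ∀ y z, ‖y‖ ≤ K * σ ^ 2 → ‖z‖ ≤ K * σ ^ 2 →
      ‖T (-(G σ y - G σ z))‖ ≤ 1 / 2 * ‖y - z‖ := by
    intro y z hy hz
    calc ‖T (-(G σ y - G σ z))‖ ≤ ‖T‖ * ‖-(G σ y - G σ z)‖ := T.le_opNorm _
      _ ≤ ‖T‖ * (C * (K * σ ^ 2 + σ ^ 2) * ‖y - z‖) := by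
        rw [norm_neg]
        exact mul_le_mul_of_nonneg_left (hG σ hσ hσ1 _ hKσ y z hy hz) (norm_nonneg _)
      _ = ‖T‖ * C * (K * σ ^ 2 + σ ^ 2) * ‖y - z‖ := by ring
      _ ≤ 1 / 2 * ‖y - z‖ := by gcongr
  refine ⟨hKσ, ?_, fun y z hy hz hyz => ?_⟩
  -- Existence is sought in a quarter of the ball used for uniqueness: the H² norm costs a factor 2
  -- and the speed adds one more share, and 3/4 still stays below the bound in (1).
  · set r : ℝ := K / 4 * σ ^ 2 with hr
    have hr0 : 0 ≤ r := by positivity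
    have hrK : r ≤ K * σ ^ 2 := by
      have : 0 ≤ K * σ ^ 2 := by positivity
      rw [hr]; linarith
    set s : Set Y := Metric.closedBall 0 r
    have hmaps : Set.MapsTo (fun y => T (-G σ y)) s s := by
      intro y hy
      rw [mem_closedBall_zero_iff] at hy ⊢
      have h1 := hcontr y 0 (hy.trans hrK) (by simpa using hr0.trans hrK)
      have e : T (-G σ y) = T (-(G σ y - G σ 0)) + T (-G σ 0) := by
        rw [← map_add]; congr 1; abel
      have h2 : ‖T (-G σ 0)‖ ≤ ‖T‖ * (C * σ ^ 2) := by
        refine (T.le_opNorm _).trans ?_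
        rw [norm_neg]
        exact mul_le_mul_of_nonneg_left (hG0 σ hσ hσ1) (norm_nonneg _)
      rw [sub_zero] at h1
      change ‖T (-G σ y)‖ ≤ r
      rw [e]
      refine (norm_add_le _ _).trans ?_
      have h3 : (8 * (‖T‖ * C)) * σ ^ 2 ≤ K * σ ^ 2 := by gcongr; linarith
      rw [hr] at hy ⊢
      nlinarith
    have hlip : ContractingWith (1 / 2) (hmaps.restrict (fun y => T (-G σ y)) s s) := by
      refine ⟨by rw [← NNReal.coe_lt_coe]; norm_num, LipschitzWith.of_dist_le_mul fun y z => ?_⟩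
      have hy := mem_closedBall_zero_iff.1 y.2
      have hz := mem_closedBall_zero_iff.1 z.2
      have := hcontr y z (hy.trans hrK) (hz.trans hrK)
      rw [Subtype.dist_eq, Subtype.dist_eq, dist_eq_norm, dist_eq_norm]
      simp only [Set.MapsTo.val_restrict_apply]
      rw [← map_sub, show -G σ (y : Y) - -G σ (z : Y) = -(G σ y - G σ z) by abel]
      simpa using this
    obtain ⟨y, hy, hfix, -⟩ := ContractingWith.exists_fixedPoint'
      (Metric.isClosed_closedBall.isComplete) hmaps hlip
      (Metric.mem_closedBall_self hr0) (edist_ne_top _ _)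
    exact ⟨y, mem_closedBall_zero_iff.1 hy, hfix.symm⟩
  · have := hcontr y z hy hz
    rw [← hyz] at this
    have h0 : ‖y - z‖ = 0 := le_antisymm (by linarith) (norm_nonneg _)
    exact sub_eq_zero.1 (norm_eq_zero.1 h0)

end FixedPoint

/-! ### The covariance operator and the Hilbert-Schmidt norm -/

section Covariance

variable {n m : ℕ}

/-- Symmetry also holds for the default value 0, so the existence of the square root is never
needed. -/
lemma inner_sqrtConv (q : ℝ → Matrix (Fin m) (Fin m) ℝ) (v w : L2 m) :
    inner ℝ (sqrtConv q v) w = inner ℝ v (sqrtConv q w) := by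
  by_cases hR : ∃ R, IsSqrtConv q R
  · rw [sqrtConv, dif_pos hR]
    exact (Classical.choose_spec hR).1.inner_left_eq_inner_right v w
  · rw [sqrtConv, dif_neg hR]
    simp

/-- Moving Q^{1/2} onto w leaves the squared coefficients of Q^{1/2} w in an orthonormal basis,
which Parseval sums. -/
lemma hsNormSq_eq (q : ℝ → Matrix (Fin m) (Fin m) ℝ) {Λ : L2 m → ℝ} {w : L2 m}
    (hΛ : ∀ v, Λ v = inner ℝ w v) : hsNormSq q Λ = ‖sqrtConv q w‖ ^ 2 := by
  obtain ⟨b, hb⟩ := Classical.choose_spec (exists_hilbertBasis ℝ (L2 m))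
  have h := b.tsum_inner_mul_inner (sqrtConv q w) (sqrtConv q w)
  rw [real_inner_self_eq_norm_sq] at h
  rw [← h, hsNormSq]
  refine tsum_congr fun e => ?_
  rw [hΛ, ← inner_sqrtConv, real_inner_comm (sqrtConv q w) (b e), hb, sq]

/-- The convolution kernel as an operator-valued function. -/
def kernelCLM (q : ℝ → Matrix (Fin m) (Fin m) ℝ) (x : ℝ) : E m →L[ℝ] E m :=
  Matrix.toEuclideanCLM (𝕜 := ℝ) (q x)

lemma integrable_sum_smul {V ι : Type*} [Fintype ι] [NormedAddCommGroup V] [NormedSpace ℝ V]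
    {a : ι → ι → ℝ → ℝ} (ha : ∀ i j, Integrable (a i j) volume) (B : ι → ι → V) :
    Integrable (fun x => ∑ i, ∑ j, a i j x • B i j) volume :=
  integrable_finsetSum _ fun i _ => integrable_finsetSum _ fun j _ => (ha i j).smul_const _

lemma kernelCLM_eq_sum (q : ℝ → Matrix (Fin m) (Fin m) ℝ) : kernelCLM q = fun x => ∑ i, ∑ j,
    q x i j • Matrix.toEuclideanCLM (𝕜 := ℝ) (Matrix.single i j (1 : ℝ)) := by
  funext x
  rw [kernelCLM]
  conv_lhs => rw [Matrix.matrix_eq_sum_single (q x)]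
  simp only [map_sum]
  refine Finset.sum_congr rfl fun i _ => Finset.sum_congr rfl fun j _ => ?_
  rw [← map_smul, Matrix.smul_single, smul_eq_mul, mul_one]

lemma integrable_kernelCLM {q : ℝ → Matrix (Fin m) (Fin m) ℝ}
    (hq : ∀ i j, Integrable (fun x => q x i j) volume) : Integrable (kernelCLM q) volume := by
  rw [kernelCLM_eq_sum]
  exact integrable_sum_smul hq _

/-- The substitution y ↦ x - y moves the translation from the kernel to w, in preparation for
differentiation. -/
lemma conv_eq (q : ℝ → Matrix (Fin m) (Fin m) ℝ) (w : ℝ → E m) (x : ℝ) :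
    conv q w x = ∫ y, kernelCLM q y (w (x - y)) := by
  rw [conv, ← integral_sub_left_eq_self (fun y => kernelCLM q y (w (x - y))) volume x]
  simp [kernelCLM]

lemma conv_congr (q : ℝ → Matrix (Fin m) (Fin m) ℝ) {w w' : ℝ → E m} (h : w =ᵐ[volume] w') :
    conv q w = conv q w' := by
  funext x
  exact integral_congr_ae (h.mono fun y hy => by simp only [hy])

/-- The adjoint as a continuous linear map. -/
def adjCLM (n m : ℕ) : (E m →L[ℝ] E n) →L[ℝ] (E n →L[ℝ] E m) :=
  LinearMap.mkContinuous
    { toFun := fun A => ContinuousLinearMap.adjoint A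
      map_add' := fun A B => map_add _ A B
      map_smul' := fun c A => by simp } 1 fun A => by simp

@[simp] lemma adjCLM_apply (A : E m →L[ℝ] E n) : adjCLM n m A = ContinuousLinearMap.adjoint A := rfl

end Covariance

/-! ### The nonlinear terms as families of functions indexed by `H²` -/

section Families

open sobolev

variable {n m : ℕ}

lemma LipL2.coe_clm (T : sobolev n →L[ℝ] L2 n) : LipL2 fun v => ⇑(T v) := by
  refine .of_sub (fun v _ => Lp.aestronglyMeasurable _) (Lp.memLp _) ⟨‖T‖, fun v w _ _ => ?_⟩
  have e : (fun x => T v x - T w x) =ᵐ[volume] T (v - w) := by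
    rw [map_sub]; exact (Lp.coeFn_sub (T v) (T w)).symm
  rw [eLpNorm_congr_ae e, ← ENNReal.ofReal_toReal (Lp.memLp (T (v - w))).2.ne, ← Lp.norm_def]
  exact ENNReal.ofReal_le_ofReal (T.le_opNorm _)

lemma LipL2.congr {X Y : Type*} [NormedAddCommGroup X] [NormedAddCommGroup Y]
    {F G : X → ℝ → Y} (hF : LipL2 F) (h : ∀ v, F v =ᵐ[volume] G v) : LipL2 G := by
  obtain ⟨hm, C, hC0, hC⟩ := hF
  refine ⟨fun v hv => (hm v hv).ae_eq (h v), C, hC0, fun v w hv hw => ⟨?_, ?_⟩⟩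
  · rw [← eLpNorm_congr_ae (h v)]; exact (hC v w hv hw).1
  · have e : (fun x => G v x - G w x) =ᵐ[volume] fun x => F v x - F w x :=
      ((h v).sub (h w)).symm
    rw [eLpNorm_congr_ae e]; exact (hC v w hv hw).2

lemma lipL2_rep : LipL2 (rep : sobolev n → ℝ → E n) := (LipL2.coe_clm incl).congr incl_ae_eq

lemma lipL2_rep1 : LipL2 (rep1 : sobolev n → ℝ → E n) := (LipL2.coe_clm d1).congr d1_ae_eq

lemma lipSup_rep : LipSup (rep : sobolev n → ℝ → E n) := by
  refine .of_sub (fun v _ => (continuous_rep v).aestronglyMeasurable)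
    ⟨0, fun x => by simp [rep_zero]⟩ ⟨2, fun v w _ _ x => ?_⟩
  rw [← Pi.sub_apply, ← rep_sub]
  exact norm_rep_le _ _

lemma lipSup_rep1 : LipSup (rep1 : sobolev n → ℝ → E n) := by
  refine .of_sub (fun v _ => (continuous_rep1 v).aestronglyMeasurable)
    ⟨0, fun x => by simp [rep1_zero]⟩ ⟨2, fun v w _ _ x => ?_⟩
  rw [← Pi.sub_apply, ← rep1_sub]
  exact norm_rep1_le _ _

/-- The profile `Φ₀ + v`. -/
def profile (Φ₀ : ℝ → E n) (v : sobolev n) : ℝ → E n := fun x => Φ₀ x + rep v x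

/-- The derivative of `Φ₀ + v`. -/
def profile1 (Φ₀ : ℝ → E n) (v : sobolev n) : ℝ → E n := fun x => deriv Φ₀ x + rep1 v x

/-- The second derivative of `Φ₀ + v`. -/
def profile2 (Φ₀ : ℝ → E n) (v : sobolev n) : ℝ → E n := fun x => deriv (deriv Φ₀) x + d2 v x

variable (g : E n → (E m →L[ℝ] E n)) (q : ℝ → Matrix (Fin m) (Fin m) ℝ) (Φ₀ Φref r r₁ : ℝ → E n)
  (χlow χhigh : ℝ → ℝ)

/-- `g(Φ₀ + v)ᵀ r`. -/
def adjG (v : sobolev n) : ℝ → E m := fun x => adjCLM n m (g (profile Φ₀ v x)) (r x)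

/-- The derivative of `g(Φ₀ + v)ᵀ r`, where `r₁` is the derivative of `r`. -/
def adjG1 (v : sobolev n) : ℝ → E m := fun x =>
  adjCLM n m (fderiv ℝ g (profile Φ₀ v x) (profile1 Φ₀ v x)) (r x)
    + adjCLM n m (g (profile Φ₀ v x)) (r₁ x)

/-- The product of the cut-off factors. -/
def cutoff (v : sobolev n) : ℝ :=
  χhigh ‖toL2 fun x => (Φ₀ x - Φref x) + rep v x‖ ^ 2
    * (χlow (inner ℝ (toL2 r) (toL2 (profile1 Φ₀ v))))⁻¹

/-- Half of the squared Hilbert-Schmidt norm. -/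
def hsHalf (v : sobolev n) : ℝ :=
  1 / 2 * (cutoff Φ₀ Φref r χlow χhigh v ^ 2 * ‖sqrtConv q (toL2 (adjG g Φ₀ r v))‖ ^ 2)

/-- The derivative of `K_C`. -/
def opC1 (v : sobolev n) : ℝ → E n := fun x =>
  (-cutoff Φ₀ Φref r χlow χhigh v) •
    (fderiv ℝ g (profile Φ₀ v x) (profile1 Φ₀ v x)
        (∫ y, kernelCLM q y (adjG g Φ₀ r v (x - y)))
      + g (profile Φ₀ v x) (∫ y, kernelCLM q y (adjG1 g Φ₀ r r₁ v (x - y))))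

/-- All terms of order `σ²`. -/
def orderTwo (h : E n → E n) (v : sobolev n) : ℝ → E n := fun x =>
  h (profile Φ₀ v x)
    + (hsHalf g q Φ₀ Φref r χlow χhigh v • profile2 Φ₀ v x
      + opC1 g q Φ₀ Φref r r₁ χlow χhigh v x)

variable {g q Φ₀ Φref r r₁ χlow χhigh} {um up : E n}

lemma continuous_profile (hW : WaveRegularity Φ₀ um up) (v : sobolev n) :
    Continuous (profile Φ₀ v) :=
  (continuous_iff_continuousAt.2 fun x => (hW.hasDerivAt x).continuousAt).add (continuous_rep v)

lemma continuous_profile1 (hW : WaveRegularity Φ₀ um up) (v : sobolev n) :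
    Continuous (profile1 Φ₀ v) :=
  (continuous_iff_continuousAt.2 fun x => (hW.hasDerivAt_deriv x).continuousAt).add
    (continuous_rep1 v)

lemma hasDerivAt_profile (hW : WaveRegularity Φ₀ um up) (v : sobolev n) (x : ℝ) :
    HasDerivAt (profile Φ₀ v) (profile1 Φ₀ v x) x := (hW.hasDerivAt x).add (hasDerivAt_rep v x)

lemma lipSup_profile (hW : WaveRegularity Φ₀ um up) : LipSup (profile Φ₀) := by
  obtain ⟨M, hM⟩ := hW.bounded
  exact (LipSup.const (continuous_iff_continuousAt.2 fun x =>
    (hW.hasDerivAt x).continuousAt).aestronglyMeasurable hM).add lipSup_rep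

lemma lipSup_profile1 (hW : WaveRegularity Φ₀ um up) : LipSup (profile1 Φ₀) := by
  obtain ⟨M, hM⟩ := hW.bounded_deriv
  exact (LipSup.const hW.memLp_deriv.1 hM).add lipSup_rep1

lemma lipL2_profile1 (hW : WaveRegularity Φ₀ um up) : LipL2 (profile1 Φ₀) :=
  (LipL2.const hW.memLp_deriv).add lipL2_rep1

lemma lipL2_profile2 (hW : WaveRegularity Φ₀ um up) : LipL2 (profile2 Φ₀) :=
  (LipL2.const hW.memLp_deriv2).add (LipL2.coe_clm d2)

/-- φ(Φ₀) is in L² because φ vanishes at both end states, and differences are bounded pointwise by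
those of v. -/
lemma lipL2_comp_profile (hW : WaveRegularity Φ₀ um up) {Y : Type} [NormedAddCommGroup Y]
    {φ : E n → Y} (hφ : LipOnBalls φ) (hm : φ um = 0) (hp : φ up = 0) :
    LipL2 fun v x => φ (profile Φ₀ v x) := by
  obtain ⟨hFm, C, hC0, hC⟩ := lipSup_profile hW
  obtain ⟨hrm, D, hD0, hD⟩ := lipL2_rep (n := n)
  obtain ⟨L, hL0, hL⟩ := hφ C
  refine .of_sub (fun v hv => hφ.continuous.comp_aestronglyMeasurable (hFm v hv)) ?_
    ⟨L * D, fun v w hv hw => ?_⟩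
  · simpa [profile, rep_zero] using hW.memLp_comp hφ hm hp
  have h1 : ∀ᵐ x ∂volume, ‖φ (profile Φ₀ v x) - φ (profile Φ₀ w x)‖ ≤ L * ‖rep v x - rep w x‖ :=
    ae_of_all _ fun x => by
      have e : rep v x - rep w x = profile Φ₀ v x - profile Φ₀ w x := by simp [profile]
      rw [e]
      exact hL _ _ (hC v w hv hw x).1 (hC w v hw hv x).1
  refine (eLpNorm_le_mul_eLpNorm_of_ae_le_mul h1 2).trans ?_
  rw [mul_assoc, ENNReal.ofReal_mul hL0]
  gcongr
  exact (hD v w hv hw).2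

/-- The reference data of the nonlinear terms: a `C¹` function `r` in `L²`, bounded together with
its derivative `r₁`. -/
structure TestData (r r₁ : ℝ → E n) : Prop where
  memLp : MemLp r 2 volume
  hasDerivAt : ∀ x, HasDerivAt r (r₁ x) x
  continuous_deriv : Continuous r₁
  bounded : ∃ M, ∀ x, ‖r x‖ ≤ M
  bounded_deriv : ∃ M, ∀ x, ‖r₁ x‖ ≤ M

lemma TestData.continuous (hr : TestData r r₁) : Continuous r :=
  continuous_iff_continuousAt.2 fun x => (hr.hasDerivAt x).continuousAt

/-! ### Lipschitz bounds for the terms of order σ² -/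

lemma contDiff_one_fderiv (hg : ContDiff ℝ 2 g) : ContDiff ℝ 1 (fderiv ℝ g) :=
  hg.fderiv_right (by norm_num)

lemma lipSup_g (hW : WaveRegularity Φ₀ um up) (hg : ContDiff ℝ 2 g) :
    LipSup fun v x => g (profile Φ₀ v x) :=
  (lipSup_profile hW).comp (ContDiff.lipOnBalls (hg.of_le (by norm_num)))

lemma lipSup_fderiv_g (hW : WaveRegularity Φ₀ um up) (hg : ContDiff ℝ 2 g) :
    LipSup fun v x => fderiv ℝ g (profile Φ₀ v x) :=
  (lipSup_profile hW).comp (ContDiff.lipOnBalls (contDiff_one_fderiv hg))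

lemma lipSup_adjG (hW : WaveRegularity Φ₀ um up) (hg : ContDiff ℝ 2 g) (hr : TestData r r₁) :
    LipSup (adjG g Φ₀ r) := by
  obtain ⟨M, hM⟩ := hr.bounded
  exact ((lipSup_g hW hg).clm (adjCLM n m)).bilin (ContinuousLinearMap.id ℝ (E n →L[ℝ] E m))
    (LipSup.const hr.continuous.aestronglyMeasurable hM)

lemma lipL2_adjG (hW : WaveRegularity Φ₀ um up) (hg : ContDiff ℝ 2 g) (hr : TestData r r₁) :
    LipL2 (adjG g Φ₀ r) :=
  LipL2.bilin (ContinuousLinearMap.id ℝ (E n →L[ℝ] E m)) ((lipSup_g hW hg).clm (adjCLM n m))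
    (LipL2.const hr.memLp)

lemma lipSup_adjG1 (hW : WaveRegularity Φ₀ um up) (hg : ContDiff ℝ 2 g) (hr : TestData r r₁) :
    LipSup (adjG1 g Φ₀ r r₁) := by
  obtain ⟨M, hM⟩ := hr.bounded
  obtain ⟨M₁, hM₁⟩ := hr.bounded_deriv
  have h1 : LipSup fun v x => fderiv ℝ g (profile Φ₀ v x) (profile1 Φ₀ v x) :=
    (lipSup_fderiv_g hW hg).bilin (ContinuousLinearMap.id ℝ (E n →L[ℝ] E m →L[ℝ] E n))
      (lipSup_profile1 hW)
  have h2 : LipSup fun v x => adjCLM n m (fderiv ℝ g (profile Φ₀ v x) (profile1 Φ₀ v x)) (r x) :=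
    (h1.clm (adjCLM n m)).bilin (ContinuousLinearMap.id ℝ (E n →L[ℝ] E m))
      (LipSup.const hr.continuous.aestronglyMeasurable hM)
  have h3 : LipSup fun v x => adjCLM n m (g (profile Φ₀ v x)) (r₁ x) :=
    ((lipSup_g hW hg).clm (adjCLM n m)).bilin (ContinuousLinearMap.id ℝ (E n →L[ℝ] E m))
      (LipSup.const hr.continuous_deriv.aestronglyMeasurable hM₁)
  exact h2.add h3

lemma hasDerivAt_g (hW : WaveRegularity Φ₀ um up) (hg : ContDiff ℝ 2 g) (v : sobolev n) (x : ℝ) :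
    HasDerivAt (fun x => g (profile Φ₀ v x))
      (fderiv ℝ g (profile Φ₀ v x) (profile1 Φ₀ v x)) x :=
  (hg.differentiable (by norm_num) _).hasFDerivAt.comp_hasDerivAt x (hasDerivAt_profile hW v x)

lemma hasDerivAt_adjG (hW : WaveRegularity Φ₀ um up) (hg : ContDiff ℝ 2 g) (hr : TestData r r₁)
    (v : sobolev n) (x : ℝ) : HasDerivAt (adjG g Φ₀ r v) (adjG1 g Φ₀ r r₁ v x) x :=
  ((adjCLM n m).hasFDerivAt.comp_hasDerivAt x (hasDerivAt_g hW hg v x)).clm_apply (hr.hasDerivAt x)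

lemma continuous_adjG (hW : WaveRegularity Φ₀ um up) (hg : ContDiff ℝ 2 g) (hr : TestData r r₁)
    (v : sobolev n) : Continuous (adjG g Φ₀ r v) :=
  continuous_iff_continuousAt.2 fun x => (hasDerivAt_adjG hW hg hr v x).continuousAt

lemma continuous_adjG1 (hW : WaveRegularity Φ₀ um up) (hg : ContDiff ℝ 2 g) (hr : TestData r r₁)
    (v : sobolev n) : Continuous (adjG1 g Φ₀ r r₁ v) := by
  have h1 := continuous_profile hW v
  have h2 := continuous_profile1 hW v
  have h3 := (contDiff_one_fderiv hg).continuous.comp h1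
  have h4 := hg.continuous.comp h1
  exact (((adjCLM n m).continuous.comp (h3.clm_apply h2)).clm_apply hr.continuous).add
    (((adjCLM n m).continuous.comp h4).clm_apply hr.continuous_deriv)

lemma lipSup_cutoff (hW : WaveRegularity Φ₀ um up) (href : MemLp (fun x => Φ₀ x - Φref x) 2 volume)
    (hlow : ContDiff ℝ 1 χlow) (hlow' : ∀ t, 1 / 4 ≤ χlow t)
    (hhigh : ContDiff ℝ 1 χhigh) :
    LipSup fun (v : sobolev n) (_ : ℝ) => cutoff Φ₀ Φref r χlow χhigh v := by
  have h1 := ((((LipL2.const href).add lipL2_rep).lipSup_toL2).norm).comp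
    (ContDiff.lipOnBalls hhigh)
  have h2 := ((lipL2_profile1 hW).lipSup_toL2.clm (innerSL ℝ (toL2 r))).comp
    (ContDiff.lipOnBalls hlow)
  have h3 := (h1.mul h1).mul (h2.inv (by norm_num : (0 : ℝ) < 1 / 4) fun v x => hlow' _)
  simpa only [cutoff, sq, innerSL_apply_apply] using h3

lemma lipSup_hsHalf (hW : WaveRegularity Φ₀ um up) (hg : ContDiff ℝ 2 g) (hr : TestData r r₁)
    (hc : LipSup fun (v : sobolev n) (_ : ℝ) => cutoff Φ₀ Φref r χlow χhigh v) :
    LipSup fun (v : sobolev n) (_ : ℝ) => hsHalf g q Φ₀ Φref r χlow χhigh v := by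
  have h1 := ((lipL2_adjG hW hg hr).lipSup_toL2.clm (sqrtConv q)).norm
  have h2 : LipSup fun (_ : sobolev n) (_ : ℝ) => (1 / 2 : ℝ) :=
    .const aestronglyMeasurable_const fun _ => le_rfl
  have h3 := h2.mul ((hc.mul hc).mul (h1.mul h1))
  simpa only [hsHalf, sq] using h3

/-- Each summand has one factor in L², namely the derivative of the profile in the first and g along
the profile in the second. The convolutions and the cut-off are measured in the supremum norm. -/
lemma lipL2_opC1 (hW : WaveRegularity Φ₀ um up) (hg : ContDiff ℝ 2 g) (hr : TestData r r₁)
    (hgm : g um = 0) (hgp : g up = 0) (hq : Integrable (kernelCLM q) volume)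
    (hc : LipSup fun (v : sobolev n) (_ : ℝ) => cutoff Φ₀ Φref r χlow χhigh v) :
    LipL2 (opC1 g q Φ₀ Φref r r₁ χlow χhigh) := by
  have k1 := (lipSup_adjG hW hg hr).conv hq (continuous_adjG hW hg hr)
  have k2 := (lipSup_adjG1 hW hg hr).conv hq (continuous_adjG1 hW hg hr)
  have g1 := LipL2.bilin (ContinuousLinearMap.id ℝ (E n →L[ℝ] E m →L[ℝ] E n))
    (lipSup_fderiv_g hW hg) (lipL2_profile1 hW)
  have g2 := lipL2_comp_profile hW (ContDiff.lipOnBalls (hg.of_le (by norm_num))) hgm hgp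
  have h1 := LipL2.bilin' (ContinuousLinearMap.id ℝ (E m →L[ℝ] E n)) g1 k1
  have h2 := LipL2.bilin' (ContinuousLinearMap.id ℝ (E m →L[ℝ] E n)) g2 k2
  have hneg : LipSup fun (v : sobolev n) (_ : ℝ) => -cutoff Φ₀ Φref r χlow χhigh v :=
    hc.clm (-ContinuousLinearMap.id ℝ ℝ)
  exact LipL2.smul hneg (h1.add h2)

lemma lipL2_orderTwo {h : E n → E n} (hW : WaveRegularity Φ₀ um up) (hg : ContDiff ℝ 2 g)
    (hr : TestData r r₁) (hgm : g um = 0) (hgp : g up = 0)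
    (hq : Integrable (kernelCLM q) volume) (href : MemLp (fun x => Φ₀ x - Φref x) 2 volume)
    (hlow : ContDiff ℝ 1 χlow) (hlow' : ∀ t, 1 / 4 ≤ χlow t) (hhigh : ContDiff ℝ 1 χhigh)
    (hh : ContDiff ℝ 1 h) (hhm : h um = 0) (hhp : h up = 0) :
    LipL2 (orderTwo g q Φ₀ Φref r r₁ χlow χhigh h) := by
  have hc := lipSup_cutoff (r := r) hW href hlow hlow' hhigh
  exact (lipL2_comp_profile hW (ContDiff.lipOnBalls hh) hhm hhp).add
    ((LipL2.smul (lipSup_hsHalf hW hg hr hc) (lipL2_profile2 hW)).add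
      (lipL2_opC1 hW hg hr hgm hgp hq hc))

/-- The Taylor remainder of `f(Φ₀ + v)`. -/
def remainder (f : E n → E n) (Φ₀ : ℝ → E n) (v : sobolev n) : ℝ → E n := fun x =>
  f (profile Φ₀ v x) - f (Φ₀ x) - fderiv ℝ f (Φ₀ x) (rep v x)

/-- The map e ↦ f(Φ₀ + e) - f(Φ₀) - Df(Φ₀) e has derivative Df(Φ₀ + e) - Df(Φ₀), of size at most
L|e|. The mean value inequality is applied on the ball of radius 2s, which contains the values of v
and w by the embedding constant 2. -/
lemma remainder_sub_le {f : E n → E n} (hf : ContDiff ℝ 2 f) (hW : WaveRegularity Φ₀ um up) :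
    ∃ C : ℝ, 0 ≤ C ∧ ∀ s : ℝ, s ≤ 1 → ∀ v w : sobolev n, ‖v‖ ≤ s → ‖w‖ ≤ s → ∀ x,
      ‖remainder f Φ₀ v x - remainder f Φ₀ w x‖ ≤ C * s * ‖rep v x - rep w x‖ := by
  obtain ⟨M, hM⟩ := hW.bounded
  obtain ⟨L, hL0, hL⟩ := ContDiff.lipOnBalls (hf.fderiv_right (m := 1) (by norm_num)) (M + 2)
  refine ⟨L * 2, by positivity, fun s hs v w hv hw x => ?_⟩
  have hd : ∀ e ∈ Metric.closedBall (0 : E n) (2 * s), HasFDerivWithinAt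
      (fun e => f (Φ₀ x + e) - f (Φ₀ x) - fderiv ℝ f (Φ₀ x) e)
      (fderiv ℝ f (Φ₀ x + e) - fderiv ℝ f (Φ₀ x)) (Metric.closedBall (0 : E n) (2 * s)) e := by
    intro e _
    have h1 : HasFDerivAt (fun e => f (Φ₀ x + e)) (fderiv ℝ f (Φ₀ x + e)) e :=
      
      (hasFDerivAt_comp_add_left (Φ₀ x)).2 (hf.differentiable (by norm_num) (Φ₀ x + e)).hasFDerivAt
    exact ((h1.sub_const _).sub (fderiv ℝ f (Φ₀ x)).hasFDerivAt).hasFDerivWithinAt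
  have := (convex_closedBall (0 : E n) (2 * s)).norm_image_sub_le_of_norm_hasFDerivWithin_le
    (C := L * 2 * s) hd (fun e he => by
      rw [mem_closedBall_zero_iff] at he
      have h1 := hL (Φ₀ x + e) (Φ₀ x) ((norm_add_le _ _).trans (by linarith [hM x]))
        ((hM x).trans (by linarith))
      rw [add_sub_cancel_left] at h1
      refine h1.trans ?_
      rw [mul_assoc]
      exact mul_le_mul_of_nonneg_left he hL0)
    (x := rep w x) (y := rep v x)
    (mem_closedBall_zero_iff.2 ((norm_rep_le w x).trans (by linarith)))
    (mem_closedBall_zero_iff.2 ((norm_rep_le v x).trans (by linarith)))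
  exact this

lemma remainder_toL2 {f : E n → E n} (hf : ContDiff ℝ 2 f) (hW : WaveRegularity Φ₀ um up) :
    (∀ v, ‖v‖ ≤ 1 → MemLp (remainder f Φ₀ v) 2 volume) ∧
    ∃ C : ℝ, 0 ≤ C ∧ ∀ s : ℝ, s ≤ 1 → ∀ v w : sobolev n, ‖v‖ ≤ s → ‖w‖ ≤ s →
      ‖toL2 (remainder f Φ₀ v) - toL2 (remainder f Φ₀ w)‖ ≤ C * s * ‖v - w‖ := by
  obtain ⟨C, hC0, hC⟩ := remainder_sub_le hf hW
  have hr0 : remainder f Φ₀ (0 : sobolev n) = 0 := by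
    funext x; simp [remainder, profile, rep_zero]
  have hΦc : Continuous Φ₀ := continuous_iff_continuousAt.2 fun x => (hW.hasDerivAt x).continuousAt
  have hcont : ∀ v, Continuous (remainder f Φ₀ v) := fun v =>
    ((hf.continuous.comp (continuous_profile hW v)).sub (hf.continuous.comp hΦc)).sub
      (((hf.continuous_fderiv (by norm_num)).comp hΦc).clm_apply (continuous_rep v))
  have hrep : ∀ v : sobolev n, MemLp (rep v) 2 volume := fun v =>
    (Lp.memLp (incl v)).ae_eq (incl_ae_eq v)
  -- Comparison with the zero function, whose remainder vanishes, bounds the remainder of v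
  -- pointwise by C|v|.
  have hmem : ∀ v, ‖v‖ ≤ 1 → MemLp (remainder f Φ₀ v) 2 volume := fun v hv =>
    (hrep v).of_le_mul (c := C * 1) (hcont v).aestronglyMeasurable (ae_of_all _ fun x => by
      simpa [hr0, rep_zero] using hC 1 le_rfl v 0 hv (by simp) x)
  refine ⟨hmem, C, hC0, fun s hs v w hv hw => ?_⟩
  have hs0 : 0 ≤ s := (norm_nonneg _).trans hv
  have hmv := hmem v (hv.trans hs)
  have hmw := hmem w (hw.trans hs)
  rw [toL2_sub hmv hmw]
  have h1 : ‖toL2 fun x => remainder f Φ₀ v x - remainder f Φ₀ w x‖ ≤ C * s * ‖incl (v - w)‖ := by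
    refine Lp.norm_le_mul_norm_of_ae_le_mul ?_
    have hm : MemLp (fun x => remainder f Φ₀ v x - remainder f Φ₀ w x) 2 volume := hmv.sub hmw
    filter_upwards [toL2_ae_eq hm, incl_ae_eq (v - w)] with x e1 e2
    rw [e1, e2, rep_sub, Pi.sub_apply]
    exact hC s hs v w hv hw x
  exact h1.trans (mul_le_mul_of_nonneg_left (norm_incl_le _) (by positivity))

end Families

/-! ### The equation in the space `H²` -/

section Equation

open sobolev

variable {n m : ℕ} {g : E n → (E m →L[ℝ] E n)} {q : ℝ → Matrix (Fin m) (Fin m) ℝ}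
  {Φ₀ Φref r r₁ ψ : ℝ → E n} {χlow χhigh : ℝ → ℝ} {um up : E n}

lemma l2Inner_eq {u w : ℝ → E n} {a b : L2 n} (hu : u =ᵐ[volume] a) (hw : w =ᵐ[volume] b) :
    l2Inner u w = inner ℝ a b := by
  rw [L2.inner_def]
  refine integral_congr_ae ?_
  filter_upwards [hu, hw] with x h1 h2
  rw [h1, h2]

lemma shift_zero (u : ℝ → E n) : shift 0 u = u := by
  funext x; simp [shift]

lemma hasWeakDeriv_profile (hW : WaveRegularity Φ₀ um up) (v : sobolev n) :
    HasWeakDeriv (profile Φ₀ v) (profile1 Φ₀ v) :=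
  hasWeakDeriv_of_hasDerivAt (hasDerivAt_profile hW v) (continuous_profile1 hW v).locallyIntegrable

lemma hasWeakDeriv_profile1 (hW : WaveRegularity Φ₀ um up) (v : sobolev n) :
    HasWeakDeriv (profile1 Φ₀ v) (profile2 Φ₀ v) :=
  (hasWeakDeriv_of_hasDerivAt hW.hasDerivAt_deriv
    (hW.memLp_deriv2.locallyIntegrable (by norm_num))).add
    ((hasWeakDeriv_d1 v).congr (d1_ae_eq v) (ae_eq_refl _))

lemma memLp_rep (v : sobolev n) : MemLp (rep v) 2 volume :=
  (Lp.memLp (incl v)).ae_eq (incl_ae_eq v)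

lemma memLp_profile1 (hW : WaveRegularity Φ₀ um up) (v : sobolev n) :
    MemLp (profile1 Φ₀ v) 2 volume :=
  hW.memLp_deriv.add ((Lp.memLp (d1 v)).ae_eq (d1_ae_eq v))

lemma cutoff_eq (hW : WaveRegularity Φ₀ um up) (href : MemLp (fun x => Φ₀ x - Φref x) 2 volume)
    (hr : TestData r r₁) (hψ : ψ =ᵐ[volume] r) {U : ℝ → E n} {v : sobolev n}
    (hU : U =ᵐ[volume] profile Φ₀ v) :
    chiH χhigh Φref U 0 ^ 2 * chiL χlow ψ U 0 = cutoff Φ₀ Φref r χlow χhigh v := by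
  have h1 := ((hasWeakDeriv_profile hW v).congr hU.symm (ae_eq_refl _)).weakDeriv_ae_eq
  have h2 : l2Inner (weakDeriv U) (shift 0 ψ) = inner ℝ (toL2 r) (toL2 (profile1 Φ₀ v)) := by
    rw [shift_zero, real_inner_comm]
    exact l2Inner_eq (h1.trans (toL2_ae_eq (memLp_profile1 hW v)).symm)
      (hψ.trans (toL2_ae_eq hr.memLp).symm)
  have hm : MemLp (fun x => (Φ₀ x - Φref x) + rep v x) 2 volume := href.add (memLp_rep v)
  have h3 : l2Norm (fun x => U x - shift 0 Φref x)
      = ‖toL2 fun x => (Φ₀ x - Φref x) + rep v x‖ := by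
    refine l2Norm_eq_norm ?_
    filter_upwards [hU, toL2_ae_eq hm] with x e1 e2
    rw [shift_zero, e1, e2, profile]; abel
  rw [chiH, chiL, h2, h3, cutoff]

/-- The functional b̄ is the inner product with -χ̄_h² χ̄_l g(U)ᵀψ, so the formula for represented
functionals applies. -/
lemma hsNormSq_bBar (hW : WaveRegularity Φ₀ um up)
    (href : MemLp (fun x => Φ₀ x - Φref x) 2 volume)
    (hr : TestData r r₁) (hψ : ψ =ᵐ[volume] r) {U : ℝ → E n} {v : sobolev n}
    (hU : U =ᵐ[volume] profile Φ₀ v) (hm : MemLp (adjG g Φ₀ r v) 2 volume) :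
    1 / 2 * hsNormSq q (bBar g Φref ψ χlow χhigh U 0) = hsHalf g q Φ₀ Φref r χlow χhigh v := by
  have h : ∀ w : L2 m, bBar g Φref ψ χlow χhigh U 0 w
      = inner ℝ ((-cutoff Φ₀ Φref r χlow χhigh v) • toL2 (adjG g Φ₀ r v)) w := by
    intro w
    have e : l2Inner (fun x => g (U x) (w x)) (shift 0 ψ) = inner ℝ (toL2 (adjG g Φ₀ r v)) w := by
      rw [shift_zero, L2.inner_def]
      refine integral_congr_ae ?_
      filter_upwards [hU, hψ, toL2_ae_eq hm] with x e1 e2 e3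
      rw [e1, e2, e3, adjG, adjCLM_apply, ContinuousLinearMap.adjoint_inner_left,
        real_inner_comm]
    rw [bBar, cutoff_eq hW href hr hψ hU, e, real_inner_smul_left, neg_mul]
  rw [hsNormSq_eq q h, hsHalf, map_smul, norm_smul, mul_pow, norm_neg, Real.norm_eq_abs, sq_abs]

/-- Only the class of U and of ψ modulo null sets matters, so both may be replaced by C¹
representatives. The product rule then gives a classical derivative. -/
lemma weakDeriv_opC (hW : WaveRegularity Φ₀ um up) (hg : ContDiff ℝ 2 g)
    (href : MemLp (fun x => Φ₀ x - Φref x) 2 volume) (hr : TestData r r₁) (hψ : ψ =ᵐ[volume] r)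
    (hq : Integrable (kernelCLM q) volume) {U : ℝ → E n} {v : sobolev n} (hv : ‖v‖ ≤ 1)
    (hU : U =ᵐ[volume] profile Φ₀ v)
    (hm : MemLp (opC1 g q Φ₀ Φref r r₁ χlow χhigh v) 2 volume) :
    weakDeriv (opC g q Φref ψ χlow χhigh U 0) =ᵐ[volume] opC1 g q Φ₀ Φref r r₁ χlow χhigh v := by
  have hcongr : opC g q Φref ψ χlow χhigh U 0 =ᵐ[volume] fun x =>
      (-cutoff Φ₀ Φref r χlow χhigh v) •
        g (profile Φ₀ v x) (∫ y, kernelCLM q y (adjG g Φ₀ r v (x - y))) := by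
    have e : (fun x => ContinuousLinearMap.adjoint (g (U x)) (shift 0 ψ x))
        =ᵐ[volume] adjG g Φ₀ r v := by
      filter_upwards [hU, hψ] with x e1 e2
      rw [shift_zero, e1, e2, adjG, adjCLM_apply]
    filter_upwards [hU] with x e1
    rw [opC, gAdj, conv_congr q e, conv_eq, cutoff_eq hW href hr hψ hU, e1, neg_smul]
  obtain ⟨-, C, -, hC⟩ := lipSup_adjG hW hg hr
  obtain ⟨-, C₁, -, hC₁⟩ := lipSup_adjG1 hW hg hr
  have hd : ∀ x, HasDerivAt (fun x => (-cutoff Φ₀ Φref r χlow χhigh v) •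
      g (profile Φ₀ v x) (∫ y, kernelCLM q y (adjG g Φ₀ r v (x - y))))
      (opC1 g q Φ₀ Φref r r₁ χlow χhigh v x) x := fun x =>
    ((hasDerivAt_g hW hg v x).clm_apply (hasDerivAt_conv hq (hasDerivAt_adjG hW hg hr v)
      (continuous_adjG1 hW hg hr v) (fun x => (hC v v hv hv x).1)
      (fun x => (hC₁ v v hv hv x).1) x)).fun_const_smul
        (-cutoff Φ₀ Φref r χlow χhigh v)
  exact ((hasWeakDeriv_of_hasDerivAt hd (hm.locallyIntegrable (by norm_num))).congr hcongr.symm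
    (ae_eq_refl _)).weakDeriv_ae_eq

lemma opK_ae_eq (ρ : Fin n → ℝ) (f h : E n → E n) (hW : WaveRegularity Φ₀ um up)
    (hg : ContDiff ℝ 2 g) (href : MemLp (fun x => Φ₀ x - Φref x) 2 volume) (hr : TestData r r₁)
    (hψ : ψ =ᵐ[volume] r) (hq : Integrable (kernelCLM q) volume) {U : ℝ → E n} {v : sobolev n}
    (hv : ‖v‖ ≤ 1) (hU : U =ᵐ[volume] profile Φ₀ v)
    (hm : MemLp (opC1 g q Φ₀ Φref r r₁ χlow χhigh v) 2 volume) (σ c : ℝ) :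
    opK ρ f h g q Φref ψ χlow χhigh σ U 0 c =ᵐ[volume] fun x =>
      c • profile1 Φ₀ v x + (diagMul ρ (profile2 Φ₀ v x) + f (profile Φ₀ v x))
        + σ ^ 2 • orderTwo g q Φ₀ Φref r r₁ χlow χhigh h v x := by
  have hw := (hasWeakDeriv_profile hW v).congr hU.symm (ae_eq_refl _)
  filter_upwards [hU, hw.weakDeriv_ae_eq,
    hw.weakDeriv_weakDeriv_ae_eq (hasWeakDeriv_profile1 hW v),
    weakDeriv_opC hW hg href hr hψ hq hv hU hm] with x e1 e2 e3 e4
  rw [opK, opA, opB, e1, e2, e3, e4,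
    hsNormSq_bBar hW href hr hψ hU ((lipL2_adjG hW hg hr).1 v hv), orderTwo]
  simp only [smul_add]
  abel

variable (f h : E n → E n) (g q Φ₀ Φref r r₁ χlow χhigh) in
/-- The terms of the equation that are small perturbations of the bordered linear operator. -/
def perturbation (σ : ℝ) (y : sobolev n × ℝ) : L2 n :=
  y.2 • d1 y.1 + toL2 (remainder f Φ₀ y.1)
    + σ ^ 2 • toL2 (orderTwo g q Φ₀ Φref r r₁ χlow χhigh h y.1)

/-- Expanding (c₀ + γ)(Φ₀' + v') and f(Φ₀ + v) and using the wave equation to eliminate f(Φ₀) leaves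
the linear part, the product γ v', the Taylor remainder and the terms of order σ². -/
lemma opK_eq_zero_iff {ρ : Fin n → ℝ} {f h : E n → E n} {c₀ : ℝ} (hW : WaveRegularity Φ₀ um up)
    (hg : ContDiff ℝ 2 g) (href : MemLp (fun x => Φ₀ x - Φref x) 2 volume) (hr : TestData r r₁)
    (hψ : ψ =ᵐ[volume] r) (hq : Integrable (kernelCLM q) volume) (hf : ContDiff ℝ 2 f)
    (ode : ∀ x, diagMul ρ (deriv (deriv Φ₀) x) + c₀ • deriv Φ₀ x + f (Φ₀ x) = 0)
    (hA : Continuous fun x => fderiv ℝ f (Φ₀ x)) (hM : ∃ M, ∀ x, ‖fderiv ℝ f (Φ₀ x)‖ ≤ M)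
    {φ₀ : sobolev n} (hφ₀ : incl φ₀ =ᵐ[volume] deriv Φ₀) {U : ℝ → E n} {y : sobolev n × ℝ}
    (hv : ‖y.1‖ ≤ 1) (hU : U =ᵐ[volume] profile Φ₀ y.1)
    (hmC : MemLp (opC1 g q Φ₀ Φref r r₁ χlow χhigh y.1) 2 volume)
    (hmN : MemLp (orderTwo g q Φ₀ Φref r r₁ χlow χhigh h y.1) 2 volume) (σ : ℝ) :
    (∀ᵐ x, opK ρ f h g q Φref ψ χlow χhigh σ U 0 (c₀ + y.2) x = 0) ↔
      linOp ρ c₀ _ hA hM y.1 + y.2 • incl φ₀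
        + perturbation g q Φ₀ Φref r r₁ χlow χhigh f h σ y = 0 := by
  have hmR := (remainder_toL2 hf hW).1 y.1 hv
  have key : opK ρ f h g q Φref ψ χlow χhigh σ U 0 (c₀ + y.2) =ᵐ[volume]
      ⇑(linOp ρ c₀ _ hA hM y.1 + y.2 • incl φ₀
        + perturbation g q Φ₀ Φref r r₁ χlow χhigh f h σ y) := by
    rw [perturbation]
    filter_upwards [opK_ae_eq ρ f h hW hg href hr hψ hq hv hU hmC σ (c₀ + y.2),
      linOp_ae_eq (ρ := ρ) (c₀ := c₀) _ hA hM y.1, hφ₀, incl_ae_eq y.1, d1_ae_eq y.1,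
      toL2_ae_eq hmR, toL2_ae_eq hmN,
      Lp.coeFn_add (linOp ρ c₀ _ hA hM y.1 + y.2 • incl φ₀)
        (y.2 • d1 y.1 + toL2 (remainder f Φ₀ y.1)
          + σ ^ 2 • toL2 (orderTwo g q Φ₀ Φref r r₁ χlow χhigh h y.1)),
      Lp.coeFn_add (linOp ρ c₀ _ hA hM y.1) (y.2 • incl φ₀), Lp.coeFn_smul y.2 (incl φ₀),
      Lp.coeFn_add (y.2 • d1 y.1 + toL2 (remainder f Φ₀ y.1))
        (σ ^ 2 • toL2 (orderTwo g q Φ₀ Φref r r₁ χlow χhigh h y.1)),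
      Lp.coeFn_add (y.2 • d1 y.1) (toL2 (remainder f Φ₀ y.1)), Lp.coeFn_smul y.2 (d1 y.1),
      Lp.coeFn_smul (σ ^ 2) (toL2 (orderTwo g q Φ₀ Φref r r₁ χlow χhigh h y.1))]
      with x e1 e2 e3 e4 e5 e6 e7 e8 e9 e10 e11 e12 e13 e14
    rw [e1, e8, Pi.add_apply, e9, Pi.add_apply, e10, Pi.smul_apply, e11, Pi.add_apply, e12,
      Pi.add_apply, e13, Pi.smul_apply, e14, Pi.smul_apply, e2, e3, e4, e5, e6, e7]
    have h1 : f (Φ₀ x) = -(diagMul ρ (deriv (deriv Φ₀) x) + c₀ • deriv Φ₀ x) :=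
      (neg_eq_of_add_eq_zero_right (ode x)).symm
    have h2 : diagMul ρ (profile2 Φ₀ y.1 x)
        = diagMul ρ (deriv (deriv Φ₀) x) + diagMul ρ (d2 y.1 x) := map_add (diagCLM ρ) _ _
    rw [remainder, h1, h2, profile1]
    simp only [add_smul, smul_add]
    abel
  rw [Lp.eq_zero_iff_ae_eq_zero]
  exact ⟨fun h0 => key.symm.trans h0, fun h0 => key.trans h0⟩

/-- The bilinear term γ v' contributes the Lipschitz constant 2s, the Taylor remainder a multiple of
s, and the remaining terms a multiple of σ². At the origin only the last ones survive. -/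
lemma perturbation_bounds {f h : E n → E n} (hW : WaveRegularity Φ₀ um up) (hf : ContDiff ℝ 2 f)
    (hN : LipL2 (orderTwo g q Φ₀ Φref r r₁ χlow χhigh h)) :
    ∃ C : ℝ, 0 ≤ C ∧
      (∀ σ : ℝ, 0 ≤ σ → σ ≤ 1 →
        ‖perturbation g q Φ₀ Φref r r₁ χlow χhigh f h σ 0‖ ≤ C * σ ^ 2) ∧
      ∀ σ : ℝ, 0 ≤ σ → σ ≤ 1 → ∀ s : ℝ, s ≤ 1 → ∀ y z, ‖y‖ ≤ s → ‖z‖ ≤ s →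
        ‖perturbation g q Φ₀ Φref r r₁ χlow χhigh f h σ y
          - perturbation g q Φ₀ Φref r r₁ χlow χhigh f h σ z‖ ≤ C * (s + σ ^ 2) * ‖y - z‖ := by
  obtain ⟨hmR, D, hD0, hD⟩ := remainder_toL2 hf hW
  obtain ⟨C, hC0, hC⟩ := hN.toL2
  refine ⟨2 + D + C, by positivity, fun σ _ _ => ?_, fun σ _ _ s hs y z hy hz => ?_⟩
  · have h1 : toL2 (remainder f Φ₀ (0 : sobolev n)) = 0 := by
      have hr0 : remainder f Φ₀ (0 : sobolev n) = fun _ => 0 := by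
        funext x; simp [remainder, profile, rep_zero]
      rw [hr0, toL2, dif_pos MemLp.zero']
      exact MemLp.toLp_zero _
    have h2 := (hC 0 0 (by simp) (by simp)).1
    have e : perturbation g q Φ₀ Φref r r₁ χlow χhigh f h σ 0
        = σ ^ 2 • toL2 (orderTwo g q Φ₀ Φref r r₁ χlow χhigh h 0) := by
      simp [perturbation, h1]
    rw [e, norm_smul, Real.norm_of_nonneg (sq_nonneg σ), mul_comm]
    exact mul_le_mul_of_nonneg_right (by linarith) (sq_nonneg σ)
  · have hs0 : 0 ≤ s := (norm_nonneg _).trans hy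
    have hy1 : ‖y.1‖ ≤ s := (norm_fst_le y).trans hy
    have hz1 : ‖z.1‖ ≤ s := (norm_fst_le z).trans hz
    have hy2 : ‖y.2‖ ≤ s := (norm_snd_le y).trans hy
    have hyz1 : ‖y.1 - z.1‖ ≤ ‖y - z‖ := norm_fst_le (y - z)
    have hyz2 : ‖y.2 - z.2‖ ≤ ‖y - z‖ := norm_snd_le (y - z)
    have e : perturbation g q Φ₀ Φref r r₁ χlow χhigh f h σ y
          - perturbation g q Φ₀ Φref r r₁ χlow χhigh f h σ z
        = y.2 • d1 (y.1 - z.1) + (y.2 - z.2) • d1 z.1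
          + (toL2 (remainder f Φ₀ y.1) - toL2 (remainder f Φ₀ z.1))
          + σ ^ 2 • (toL2 (orderTwo g q Φ₀ Φref r r₁ χlow χhigh h y.1)
            - toL2 (orderTwo g q Φ₀ Φref r r₁ χlow χhigh h z.1)) := by
      simp only [perturbation, map_sub, smul_sub, sub_smul]; abel
    have t1 : ‖y.2 • d1 (y.1 - z.1)‖ ≤ s * ‖y - z‖ := by
      rw [norm_smul]
      exact mul_le_mul hy2 ((norm_d1_le _).trans hyz1) (norm_nonneg _) hs0
    have t2 : ‖(y.2 - z.2) • d1 z.1‖ ≤ s * ‖y - z‖ := by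
      rw [norm_smul, mul_comm]
      exact mul_le_mul ((norm_d1_le _).trans hz1) hyz2 (norm_nonneg _) hs0
    have t3 : ‖toL2 (remainder f Φ₀ y.1) - toL2 (remainder f Φ₀ z.1)‖ ≤ D * s * ‖y - z‖ :=
      (hD s hs y.1 z.1 hy1 hz1).trans (mul_le_mul_of_nonneg_left hyz1 (by positivity))
    have t4 : ‖σ ^ 2 • (toL2 (orderTwo g q Φ₀ Φref r r₁ χlow χhigh h y.1)
        - toL2 (orderTwo g q Φ₀ Φref r r₁ χlow χhigh h z.1))‖ ≤ σ ^ 2 * (C * ‖y - z‖) := by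
      rw [norm_smul, Real.norm_of_nonneg (sq_nonneg σ)]
      exact mul_le_mul_of_nonneg_left ((hC y.1 z.1 (hy1.trans hs) (hz1.trans hs)).2.trans
        (mul_le_mul_of_nonneg_left hyz1 hC0)) (sq_nonneg σ)
    rw [e]
    refine (norm_add_le _ _).trans ((add_le_add ((norm_add_le _ _).trans (add_le_add
      ((norm_add_le _ _).trans (add_le_add t1 t2)) t3)) t4).trans ?_)
    have p1 : 0 ≤ C * s * ‖y - z‖ := by positivity
    have p2 : 0 ≤ (2 + D) * σ ^ 2 * ‖y - z‖ := by positivity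
    nlinarith

end Equation

end

end StochWave

/-! ### Existence and uniqueness of the instantaneous stochastic wave -/

theorem mainTheorem3 {n m : ℕ}
    (ρ : Fin n → ℝ) (f h : StochWave.E n → StochWave.E n)
    (g : StochWave.E n → (StochWave.E m →L[ℝ] StochWave.E n))
    (q : ℝ → Matrix (Fin m) (Fin m) ℝ)
    (um up : StochWave.E n) (Φ₀ : ℝ → StochWave.E n) (c₀ : ℝ)
    (Φref ψ : ℝ → StochWave.E n) (Kup : ℝ) (χlow χhigh : ℝ → ℝ)
    (hq : StochWave.HypQ q)
    (hEq : StochWave.HypEq f h g um up)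
    (hDt : StochWave.HypDt ρ f h)
    (hSt : StochWave.HypSt g)
    (hTw : StochWave.HypTw ρ f um up Φ₀ c₀)
    (hψ : StochWave.IsAdjointEigenfunction ρ f Φ₀ c₀ ψ)
    (hΦref : StochWave.IsReference um up Φ₀ Φref)
    (hKup : 0 < Kup)
    (hlow : StochWave.IsLowCutoff χlow)
    (hhigh : StochWave.IsHighCutoff Kup χhigh) :
    ∃ K₀ : ℝ, 0 < K₀ ∧ ∀ K : ℝ, K₀ ≤ K →
      ∃ δ : ℝ, 0 < δ ∧ ∀ σ : ℝ, 0 ≤ σ → σ ≤ δ →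
        (∃! p : (ℝ →ₘ[MeasureTheory.volume] StochWave.E n) × ℝ,
          StochWave.IsInstantaneousWave ρ f h g q Φref ψ χlow χhigh Φ₀ c₀ K σ p ∧
            StochWave.l2Inner (fun x => p.1 x - Φ₀ x) ψ = 0) ∧
        (∀ p p' : (ℝ →ₘ[MeasureTheory.volume] StochWave.E n) × ℝ,
          StochWave.IsInstantaneousWave ρ f h g q Φref ψ χlow χhigh Φ₀ c₀ K σ p →
          StochWave.IsInstantaneousWave ρ f h g q Φref ψ χlow χhigh Φ₀ c₀ K σ p' →
          StochWave.l2Inner (fun x => p.1 x - p'.1 x) ψ = 0 → p = p') := by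
  open MeasureTheory StochWave StochWave.sobolev in
  have hf1 : ContDiff ℝ 1 f := hDt.f_contDiff.of_le (by norm_num)
  have hf2 : ContDiff ℝ 2 f := hDt.f_contDiff.of_le (by norm_num)
  have hh1 : ContDiff ℝ 1 h := hDt.h_contDiff.of_le (by norm_num)
  have hW : WaveRegularity Φ₀ um up := waveRegularity hDt.rho_pos hf1 hEq.f_minus hEq.f_plus
    hTw.contDiff hTw.ode hTw.exp_plus hTw.exp_minus
  have href : MemLp (fun x => Φ₀ x - Φref x) 2 volume := hΦref.memH2.1
  have hqi : Integrable (kernelCLM q) volume := integrable_kernelCLM hq.integrable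
  obtain ⟨r, r₁, hr, hψr⟩ : ∃ r r₁ : ℝ → E n, TestData r r₁ ∧ ψ =ᵐ[volume] r := by
    obtain ⟨h0, u₁, u₂, h1, h2, hw1, hw2⟩ := hψ.memH2
    obtain ⟨r, r₁, e1, -, h3, h4, h5, h6⟩ := exists_C1_rep h0 h1 h2 hw1 hw2
    exact ⟨r, r₁, ⟨h0.ae_eq e1, h3, h4, ⟨_, h5⟩, ⟨_, h6⟩⟩, e1⟩
  have hlow' : ∀ t, 1 / 4 ≤ χlow t := fun t => by
    rcases le_total t (1 / 4) with ht | ht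
    · exact (hlow.eq_quarter t ht).ge
    · exact (hlow.eq_quarter _ le_rfl).ge.trans (hlow.monotone ht)
  have hlow1 : ContDiff ℝ 1 χlow := hlow.contDiff.of_le (by simp)
  have hhigh1 : ContDiff ℝ 1 χhigh := hhigh.contDiff.of_le (by simp)
  have hN := lipL2_orderTwo hW hSt.contDiff hr hEq.g_minus hEq.g_plus hqi href hlow1 hlow' hhigh1
    hh1 hEq.h_minus hEq.h_plus
  have hC := lipL2_opC1 (Φref := Φref) hW hSt.contDiff hr hEq.g_minus hEq.g_plus hqi
    (lipSup_cutoff (r := r) hW href hlow1 hlow' hhigh1)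
  have hΦc : Continuous Φ₀ := hTw.contDiff.continuous
  have hA : Continuous fun x => fderiv ℝ f (Φ₀ x) := (hf1.continuous_fderiv (by norm_num)).comp hΦc
  have hM : ∃ M, ∀ x, ‖fderiv ℝ f (Φ₀ x)‖ ≤ M := by
    obtain ⟨M, hM⟩ := hW.bounded
    obtain ⟨C, hC⟩ := ((isCompact_closedBall (0 : E n) M).image
      (hf1.continuous_fderiv (by norm_num))).isBounded.exists_norm_le
    exact ⟨C, fun x => hC _ ⟨Φ₀ x, by simpa using hM x, rfl⟩⟩
  obtain ⟨φ₀, hφ₀, hLφ₀⟩ := exists_derivWave (ρ := ρ) (c₀ := c₀) hA hM hW hf1 hTw.ode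
  have hψL : ψ =ᵐ[volume] toL2 r := hψr.trans (toL2_ae_eq hr.memLp).symm
  -- The phase functional v ↦ ⟨v, ψ⟩. The normalisation of ψ makes it equal to 1 on Φ₀', which is
  -- the condition for the bordered inverse.
  set l : sobolev n →L[ℝ] ℝ := (innerSL ℝ (toL2 r)).comp incl with hl
  have hl_eq : ∀ (v : sobolev n) (u : ℝ → E n), u =ᵐ[volume] incl v → l2Inner u ψ = l v :=
    fun v u hu => by
      rw [l2Inner_eq hu hψL, real_inner_comm]; rfl
  have hlφ : l φ₀ = 1 := by rw [← hl_eq φ₀ _ hφ₀.symm]; exact hψ.normalised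
  have hne : φ₀ ≠ 0 := by
    rintro rfl
    rw [map_zero] at hlφ
    exact zero_ne_one hlφ
  obtain ⟨hker, hsurj, hinj⟩ := hTw.simple.real hA hM hLφ₀ hne
  obtain ⟨T, hT1, hT2, hT3⟩ := exists_bordered_inverse _ (incl φ₀) l hLφ₀ hlφ hker hsurj hinj
  obtain ⟨C, hC0, hG0, hG⟩ := perturbation_bounds hW hf2 hN
  obtain ⟨K₀, hK₀, hmain⟩ := exists_fixedPoint T _ hC0 hG0 hG
  refine ⟨K₀, hK₀, fun K hK => ?_⟩
  obtain ⟨δ, hδ0, -, hδ⟩ := hmain K hK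
  refine ⟨δ, hδ0, fun σ hσ hσδ => ?_⟩
  obtain ⟨hK1, ⟨y, hy, hyfix⟩, huniq⟩ := hδ σ hσ hσδ
  have hiff : ∀ (U : ℝ → E n) (y : sobolev n × ℝ), ‖y.1‖ ≤ 1 → U =ᵐ[volume] profile Φ₀ y.1 →
      ((∀ᵐ x, opK ρ f h g q Φref ψ χlow χhigh σ U 0 (c₀ + y.2) x = 0) ↔
        linOp ρ c₀ _ hA hM y.1 + y.2 • incl φ₀
          + perturbation g q Φ₀ Φref r r₁ χlow χhigh f h σ y = 0) := fun U y hy hU =>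
    opK_eq_zero_iff hW hSt.contDiff href hr hψr hqi hf2 hTw.ode hA hM hφ₀ hy hU (hC.1 _ hy)
      (hN.1 _ hy) σ
  -- Every pair satisfying (1), whatever its phase, is a solution y of the bordered equation with
  -- ‖y‖ ≤ Kσ², because the maximum norm is at most the sum in (1).
  have hwave : ∀ p : (ℝ →ₘ[volume] E n) × ℝ,
      IsInstantaneousWave ρ f h g q Φref ψ χlow χhigh Φ₀ c₀ K σ p →
      ∃ y : sobolev n × ℝ, (fun x => p.1 x - Φ₀ x) =ᵐ[volume] incl y.1 ∧ p.2 = c₀ + y.2 ∧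
        ‖y‖ ≤ K * σ ^ 2 ∧ linOp ρ c₀ _ hA hM y.1 + y.2 • incl φ₀
          = -perturbation g q Φ₀ Φref r r₁ χlow χhigh f h σ y := by
    rintro ⟨U, c⟩ ⟨hU1, hU2, hU3⟩
    obtain ⟨v₁, hv₁⟩ := MemH2.exists_sobolev (show MemH2 (fun x => U x - Φref x) from hU1)
    obtain ⟨v₂, hv₂⟩ := hΦref.memH2.exists_sobolev
    have hv : (fun x => U x - Φ₀ x) =ᵐ[volume] incl (v₁ - v₂) := by
      rw [map_sub]
      filter_upwards [hv₁, hv₂, Lp.coeFn_sub (incl v₁) (incl v₂)] with x e1 e2 e3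
      rw [e3, Pi.sub_apply, ← e1, ← e2]; abel
    have hnorm : ‖((v₁ - v₂, c - c₀) : sobolev n × ℝ)‖ ≤ K * σ ^ 2 := by
      refine le_trans ?_ hU3
      have h1 := norm_le_h2Norm hv
      refine max_le ?_ ?_
      · exact h1.trans (le_add_of_nonneg_right (abs_nonneg _))
      · exact le_add_of_nonneg_left (Real.sqrt_nonneg _)
    refine ⟨(v₁ - v₂, c - c₀), hv, by simp, hnorm, eq_neg_of_add_eq_zero_left ?_⟩
    refine (hiff U _ ((norm_fst_le _).trans (hnorm.trans hK1)) ?_).1 ?_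
    · filter_upwards [hv, incl_ae_eq (v₁ - v₂)] with x e1 e2
      rw [profile, ← e2, ← e1]; abel
    · simpa using hU2
  have huniq' : ∀ p p' : (ℝ →ₘ[volume] E n) × ℝ,
      IsInstantaneousWave ρ f h g q Φref ψ χlow χhigh Φ₀ c₀ K σ p →
      IsInstantaneousWave ρ f h g q Φref ψ χlow χhigh Φ₀ c₀ K σ p' →
      l2Inner (fun x => p.1 x - p'.1 x) ψ = 0 → p = p' := by
    intro p p' hp hp' hpp
    obtain ⟨y, hy1, hy2, hy3, hy4⟩ := hwave p hp
    obtain ⟨z, hz1, hz2, hz3, hz4⟩ := hwave p' hp'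
    have hyz : (fun x => p.1 x - p'.1 x) =ᵐ[volume] incl (y - z).1 := by
      rw [Prod.fst_sub, map_sub]
      filter_upwards [hy1, hz1, Lp.coeFn_sub (incl y.1) (incl z.1)] with x e1 e2 e3
      rw [e3, Pi.sub_apply, ← e1, ← e2]; abel
    rw [hl_eq _ _ hyz] at hpp
    -- Only the difference of the two solutions has to satisfy the phase condition for the bordered
    -- inverse to apply.
    have h1 := hT3 (y - z) hpp
    have h2 : linOp ρ c₀ _ hA hM (y - z).1 + (y - z).2 • incl φ₀
        = -(perturbation g q Φ₀ Φref r r₁ χlow χhigh f h σ y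
          - perturbation g q Φ₀ Φref r r₁ χlow χhigh f h σ z) := by
      rw [Prod.fst_sub, Prod.snd_sub, map_sub, sub_smul, sub_add_sub_comm, hy4, hz4]
      abel
    rw [h2] at h1
    have h3 := huniq y z hy3 hz3 h1.symm
    subst h3
    refine Prod.ext (AEEqFun.ext ?_) (hy2.trans hz2.symm)
    filter_upwards [hy1, hz1] with x e1 e2
    exact sub_left_injective (e1.trans e2.symm)
  refine ⟨?_, huniq'⟩
  have hKs : 0 ≤ K * σ ^ 2 := mul_nonneg (hK₀.le.trans hK) (sq_nonneg σ)
  have hy1 : ‖y.1‖ ≤ 1 := (norm_fst_le y).trans (hy.trans (by linarith))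
  set U : ℝ →ₘ[volume] E n :=
    AEEqFun.mk (profile Φ₀ y.1) (continuous_profile hW y.1).aestronglyMeasurable with hUdef
  have hU : U =ᵐ[volume] profile Φ₀ y.1 := AEEqFun.coeFn_mk _ _
  have hUy : (fun x => U x - Φ₀ x) =ᵐ[volume] incl y.1 := by
    filter_upwards [hU, incl_ae_eq y.1] with x e1 e2
    rw [e1, e2, profile]; abel
  have hwaveU : IsInstantaneousWave ρ f h g q Φref ψ χlow χhigh Φ₀ c₀ K σ (U, c₀ + y.2) := by
    refine ⟨?_, (hiff U y hy1 hU).2 ?_, ?_⟩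
    · obtain ⟨v₂, hv₂⟩ := hΦref.memH2.exists_sobolev
      refine memH2 (v := y.1 + v₂) ?_
      rw [map_add]
      filter_upwards [hUy, hv₂, Lp.coeFn_add (incl y.1) (incl v₂)] with x e1 e2 e3
      rw [e3, Pi.add_apply, ← e1, ← e2]; abel
    · have := hT1 (-perturbation g q Φ₀ Φref r r₁ χlow χhigh f h σ y)
      rw [← hyfix] at this
      rw [this, neg_add_cancel]
    -- The sum in (1) is at most 2 · (K/4)σ² + (K/4)σ², which is below Kσ².
    · have h1 := h2Norm_le hUy
      have h2 : |y.2| ≤ K / 4 * σ ^ 2 := (norm_snd_le y).trans hy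
      have h3 := (norm_fst_le y).trans hy
      simp only [add_sub_cancel_left]
      linarith
  refine ⟨(U, c₀ + y.2), ⟨hwaveU, ?_⟩, ?_⟩
  · rw [hl_eq _ _ hUy, hyfix]
    exact hT2 _
  · rintro p ⟨hp, hp0⟩
    -- Two waves whose phases relative to Φ₀ both vanish have a difference of phase zero, so the
    -- second uniqueness statement implies the first.
    refine huniq' p _ hp hwaveU ?_
    obtain ⟨z, hz1, -, -, -⟩ := hwave p hp
    have hzy : (fun x => p.1 x - U x) =ᵐ[volume] incl (z.1 - y.1) := by
      rw [map_sub]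
      filter_upwards [hz1, hUy, Lp.coeFn_sub (incl z.1) (incl y.1)] with x e1 e2 e3
      rw [e3, Pi.sub_apply, ← e1, ← e2]; abel
    rw [hl_eq _ _ hzy, map_sub, ← hl_eq _ _ hz1, hp0, hyfix, hT2, sub_zero]
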